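/- For a complex $2\times 2$ matrix $A$ put $$D_A=\det A-\tfrac{(\operatorname{tr}A)^2}{4},\qquad U_A=\tfrac{\operatorname{tr}A^*A}{2}-\tfrac{|\operatorname{tr}A|^2}{4},\qquad E_A=\Bigl(\tfrac{\operatorname{Im}\operatorname{tr}A}{2}\Bigr)^2+\tfrac{|D_A|-\operatorname{Re}D_A}{2}.$$ The conformal range of $A$ in the Beltrami--Cayley--Klein (BCK) model is the set $$\mathrm{CR}(A)=\Bigl\{\Bigl(\tfrac{2\operatorname{Re}\langle \mathbf y,\mathbf x\rangle}{|\mathbf y|^2+|\mathbf x|^2},\tfrac{|\mathbf y|^2-|\mathbf x|^2}{|\mathbf y|^2+|\mathbf x|^2}\Bigr): \mathbf y=A\mathbf x,\ \mathbf 0\neq \mathbf x\in\mathbb C^2\Bigr\}$$ in the closed unit disk, which is regarded as the asymptotically closed hyperbolic plane (interior points are ordinary, boundary points are asymptotic). Its $h$-isometries are the restrictions of projective transformations of the ambient plane that map the closed disk onto itself. The hyperbolic distance (curvature $-1$) is extended by letting an asymptotic point have distance $+\infty$ from any other point. An unordered ratio $\{a:b:c\}$ is the multiset of its entries up to multiplication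 by a non-zero scalar ($\{0:0:0\}$ is allowed). A possibly degenerate $h$-distance band of radius $r\ge 0$ is the set of points at distance at most $r$ from an $h$-line, together with the two asymptotic points of the line. A possibly degenerate $h$-elliptic parabolic disk is either an elliptical disk contained in the closed unit disk which has exactly one asymptotic point and is not a horodisk, or an asymptotically closed half-line. *Axes.* The major axis of $\mathrm{CR}(A)$ is: if $\mathrm{CR}(A)$ has only ordinary points, a segment in it which is a diameter of an $h$-disk of minimal radius containing it; if it has two asymptotic points, the $h$-line contained in it; if it has exactly one asymptotic point but other points too, its intersection with a symmetry axis; if it is a single asymptotic point, that point. The major semi-axis length is half of the length of the major axis. The minor semi-axis length is half of the length of the intersection of $\mathrm{CR}(A)$ with the perpendicular bisector of the major axis in the first case ($0$ for a point), half of the length of its intersection with any line perpendicular to the major axis in the second case; in the third case $+\infty$ for a horodisk, and otherwise the supremum of the half-lengths of its sections by lines perpendicular to the symmetry axis; in the fourth case $0$. The half $h$-eigendistance of $A$ is half of the distance of $\iota(\lambda_1)$ and $\iota(\lambda_2)$, where $\lambda_1,\lambda_2$ are the eigenvalues of $A$ (with multiplicity) and $\iota(\lambda)=\bigl(\tfrac{2\operatorname{Re}\lambda}{|\lambda|^2+1},\tfrac{|\lambda|^2-1}{|\lambda|^2+1}\bigr)$.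 *Characteristic BCK values.* The triple $(\chi^+,\chi^-,\chi^{\mathrm e})$ is defined to be $(0,0,0)$ for the zero matrix; $(1,\cos\beta,\operatorname{sgn}\beta)$ for $S_\beta=\begin{bmatrix}0&\cos\beta\\0&\mathrm i\sin\beta\end{bmatrix}$, $\beta\in[0,\frac\pi2]$; and $\Bigl(\tfrac{\sqrt{\cos^2\alpha+t^2}}{\sqrt{1+t^2}},\tfrac{t}{\sqrt{1+t^2}},\cos\alpha\Bigr)$ for $L^\pm_{\alpha,t}=\begin{bmatrix}\cos\alpha+\mathrm i\sin\alpha&2t\\0&-\cos\alpha\pm\mathrm i\sin\alpha\end{bmatrix}$, $\alpha\in[0,\frac\pi2]$, $t\ge0$. For a general $A$ it is the triple of one of these matrices that is equivalent to $A$ by an applicable real Möbius transformation $A\mapsto (aA+b)(cA+d)^{-1}$ ($a,b,c,d\in\mathbb R$, $ad-bc\ne0$, $cA+d$ invertible) and a unitary conjugation. **Theorem.** (1) The unordered ratio $$\{U_A-|D_A| : U_A+|D_A| : U_A-|D_A|+2E_A\}\qquad(*)$$ and, when $|D_A|=E_A>0$, the type of $\mathrm{CR}(A)$, which is then exactly one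 of "possibly degenerate $h$-distance band" and "possibly degenerate $h$-elliptic parabolic disk", together form a full invariant of the conformal range up to $h$-isometries: for complex $2\times2$ matrices $A,B$ there is an $h$-isometry that maps $\mathrm{CR}(A)$ onto $\mathrm{CR}(B)$ if and only if these data agree for $A$ and $B$. (2) The ratio $(*)$ can be written as $\{\chi_1:\chi_2:\chi_3\}$ with $0\le\chi_1\le\chi_2\le\chi_3$. Whenever it is written so, the characteristic BCK values of $A$ exist, are unique, and are $$\chi^+=\sqrt{\frac{\chi_2}{\chi_3}},\qquad \chi^-=\sqrt{\frac{\chi_1}{\chi_3}},\qquad \chi^{\mathrm e}=\sqrt{\frac{\chi_2-\chi_1}{\chi_3-\chi_1}}\qquad\bigl(\text{with } \tfrac00=0\bigr).$$ (3) The values $\chi^+,\chi^-,\chi^{\mathrm e}$ lie in $[0,1]$. The major semi-axis length and the minor semi-axis length of $\mathrm{CR}(A)$ and the half $h$-eigendistance of $A$ are well defined, and they are $\operatorname{artanh}\chi^+$, $\operatorname{artanh}\chi^-$ and $\operatorname{artanh}\chi^{\mathrm e}$, respectively, where $\operatorname{artanh}1=+\infty$. Moreover, for $0\le u<1$, $$\operatorname{arcosh}\tfrac1{\sqrt{1-u^2}}=\operatorname{arsinh}\tfrac{u}{\sqrt{1-u^2}}=\operatorname{artanh}u=\tfrac12\operatorname{arcosh}\tfrac{1+u^2}{1-u^2}.$$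 -/

import Mathlib

open scoped ENNReal Matrix

noncomputable section

namespace ConfRange

/-! ### Spectral and metric quantities of a complex `2 × 2` matrix -/

/-- The discriminant `D_A = det A - (tr A)² / 4`. -/
def DA (A : Matrix (Fin 2) (Fin 2) ℂ) : ℂ :=
  A.det - A.trace ^ 2 / 4

/-- The metric discriminant `U_A = tr (A* A) / 2 - |tr A|² / 4`
(the trace of `A* A` is real). -/
def UA (A : Matrix (Fin 2) (Fin 2) ℂ) : ℝ :=
  (Aᴴ * A).trace.re / 2 - ‖A.trace‖ ^ 2 / 4

/-- `E_A = (Im (tr A) / 2)² + (|D_A| - Re D_A) / 2`. -/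
def EA (A : Matrix (Fin 2) (Fin 2) ℂ) : ℝ :=
  (A.trace.im / 2) ^ 2 + (‖DA A‖ - (DA A).re) / 2

/-- The three entries of the unordered ratio
`{U_A - |D_A| : U_A + |D_A| : U_A - |D_A| + 2 E_A}`. -/
def ratioEntries (A : Matrix (Fin 2) (Fin 2) ℂ) : Multiset ℝ :=
  {UA A - ‖DA A‖, UA A + ‖DA A‖, UA A - ‖DA A‖ + 2 * EA A}

/-- Two unordered ratios are the same if their entries agree, as multisets, up to
multiplication by a non-zero scalar (so `{0 : 0 : 0}` is the same only as itself). -/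
def SameRatio (s t : Multiset ℝ) : Prop :=
  ∃ c : ℝ, c ≠ 0 ∧ s.map (fun x => c * x) = t

/-! ### The asymptotically closed hyperbolic plane, Beltrami--Cayley--Klein model -/

/-- The base set of the model: the closed unit disk, with coordinates `(x, z)`. -/
def closedPlane : Set (ℝ × ℝ) := {p | p.1 ^ 2 + p.2 ^ 2 ≤ 1}

/-- Ordinary points: the open unit disk. -/
def IsOrdinary (p : ℝ × ℝ) : Prop := p.1 ^ 2 + p.2 ^ 2 < 1

/-- Asymptotic points: the unit circle. -/
def IsAsymptotic (p : ℝ × ℝ) : Prop := p.1 ^ 2 + p.2 ^ 2 = 1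

open Classical in
/-- The hyperbolic distance (curvature `-1`), extended to the asymptotically closed plane: the
distance of an asymptotic point to any other point is `∞`. -/
def hdist (p q : ℝ × ℝ) : ℝ≥0∞ :=
  if p = q then 0
  else if IsOrdinary p ∧ IsOrdinary q then
    ENNReal.ofReal (Real.arcosh ((1 - p.1 * q.1 - p.2 * q.2) /
      (√(1 - p.1 ^ 2 - p.2 ^ 2) * √(1 - q.1 ^ 2 - q.2 ^ 2))))
  else ⊤

/-- `f` restricts to a collineation (equivalently: congruence, isometry) of the asymptotically
closed hyperbolic plane: on the closed unit disk it is given by a projective transformation of the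
ambient projective plane, and it maps the closed unit disk onto itself.
(Its values outside of the closed disk play no role.) -/
def IsHIsometry (f : ℝ × ℝ → ℝ × ℝ) : Prop :=
  ∃ M : Matrix (Fin 3) (Fin 3) ℝ, M.det ≠ 0 ∧
    (∀ p ∈ closedPlane,
      (M *ᵥ ![p.1, p.2, 1]) 2 ≠ 0 ∧
      f p = ((M *ᵥ ![p.1, p.2, 1]) 0 / (M *ᵥ ![p.1, p.2, 1]) 2,
             (M *ᵥ ![p.1, p.2, 1]) 1 / (M *ᵥ ![p.1, p.2, 1]) 2)) ∧
    f '' closedPlane = closedPlane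

/-- Equality of subsets of the closed hyperbolic plane up to hyperbolic isometries. -/
def HCongruent (S T : Set (ℝ × ℝ)) : Prop :=
  ∃ f : ℝ × ℝ → ℝ × ℝ, IsHIsometry f ∧ f '' S = T

/-- Asymptotically closed lines: intersections of the closed disk with Euclidean lines that
meet the open disk. -/
def IsHLine (l : Set (ℝ × ℝ)) : Prop :=
  ∃ a b c : ℝ, (a ≠ 0 ∨ b ≠ 0) ∧
    l = {p | p ∈ closedPlane ∧ a * p.1 + b * p.2 = c} ∧ ∃ p ∈ l, IsOrdinary p

/-- `f` is the hyperbolic reflection in the line `l`: an isometry whose set of fixed points is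
exactly `l`. -/
def IsHReflection (f : ℝ × ℝ → ℝ × ℝ) (l : Set (ℝ × ℝ)) : Prop :=
  IsHIsometry f ∧ IsHLine l ∧ {p | p ∈ closedPlane ∧ f p = p} = l

/-- The lines `l` and `m` are perpendicular: they are different, and the reflection in `l`
maps `m` to itself. -/
def IsPerp (l m : Set (ℝ × ℝ)) : Prop :=
  IsHLine m ∧ l ≠ m ∧ ∃ f, IsHReflection f l ∧ f '' m = m

/-- `l` is a symmetry axis of `S`. -/
def IsSymmetryAxis (S l : Set (ℝ × ℝ)) : Prop :=
  ∃ f, IsHReflection f l ∧ f '' S = S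

/-! ### Types of figures -/

/-- The asymptotically closed, possibly degenerate distance band of radius `r` around the line
`l`. Here `r = 0` gives the line `l`; since `hdist P P = 0`, the two
asymptotic points of `l` are included, and no other asymptotic point is. -/
def distanceBand (l : Set (ℝ × ℝ)) (r : NNReal) : Set (ℝ × ℝ) :=
  {p | p ∈ closedPlane ∧ (⨅ q ∈ l, hdist p q) ≤ (r : ℝ≥0∞)}

/-- Possibly degenerate (asymptotically closed) distance bands. -/
def IsDistanceBand (S : Set (ℝ × ℝ)) : Prop :=
  ∃ (l : Set (ℝ × ℝ)) (r : NNReal), IsHLine l ∧ S = distanceBand l r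

/-- Asymptotically closed horodisks: their boundary conic is generated by the unit circle and the
double line tangent to it at the asymptotic point `P`. -/
def IsHorodisk (S : Set (ℝ × ℝ)) : Prop :=
  ∃ (P : ℝ × ℝ) (c : ℝ), IsAsymptotic P ∧ 0 < c ∧
    S = {p | p.1 ^ 2 + p.2 ^ 2 - 1 + c * (1 - (p.1 * P.1 + p.2 * P.2)) ^ 2 ≤ 0}

/-- Non-degenerate Euclidean elliptical disks: images of the closed unit disk under
affine isomorphisms. -/
def IsEllipticalDisk (S : Set (ℝ × ℝ)) : Prop :=
  ∃ a b c d u v : ℝ, a * d - b * c ≠ 0 ∧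
    S = (fun p : ℝ × ℝ => (a * p.1 + b * p.2 + u, c * p.1 + d * p.2 + v)) '' closedPlane

/-- Possibly degenerate (asymptotically closed) elliptic parabolic disks: the non-degenerate ones
are the elliptical disks in the closed unit disk which have exactly one asymptotic point and are not
horodisks; the degenerate ones are the asymptotically closed half-lines. -/
def IsEllipticParabolicDisk (S : Set (ℝ × ℝ)) : Prop :=
  (IsEllipticalDisk S ∧ S ⊆ closedPlane ∧ (∃! P, P ∈ S ∧ IsAsymptotic P) ∧ ¬ IsHorodisk S) ∨
  ∃ P Q : ℝ × ℝ, IsAsymptotic P ∧ IsOrdinary Q ∧ S = segment ℝ P Q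

/-! ### Major and minor axes -/

/-- `IsMajorAxis S P Q`: the segment with end points `P`, `Q` is a major axis (segment) of `S`. -/
inductive IsMajorAxis (S : Set (ℝ × ℝ)) : ℝ × ℝ → ℝ × ℝ → Prop
  /-- If `S` has only ordinary points: a segment in `S` which is a diameter (through the center
  `C`) of a hyperbolic disk of minimal radius containing `S`. -/
  | bounded (P Q C : ℝ × ℝ) (r : ℝ≥0∞)
      (hS : ∀ p ∈ S, IsOrdinary p) (hC : IsOrdinary C)
      (hball : ∀ p ∈ S, hdist C p ≤ r)
      (hmin : ∀ C' r', IsOrdinary C' → (∀ p ∈ S, hdist C' p ≤ r') → r ≤ r')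
      (hPQ : segment ℝ P Q ⊆ S)
      (hP : hdist C P = r) (hQ : hdist C Q = r) (hd : hdist P Q = 2 * r) :
      IsMajorAxis S P Q
  /-- If `S` has two asymptotic points: the line contained in `S`. -/
  | line (P Q : ℝ × ℝ) (hP : IsAsymptotic P) (hQ : IsAsymptotic Q) (hne : P ≠ Q)
      (hPQ : segment ℝ P Q ⊆ S) :
      IsMajorAxis S P Q
  /-- If `S` has a single asymptotic point `P`, but is not `{P}`: the intersection of `S` with
  a symmetry axis. -/
  | halfLine (P Q : ℝ × ℝ) (l : Set (ℝ × ℝ)) (hP : IsAsymptotic P)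
      (huniq : ∀ p ∈ S, IsAsymptotic p → p = P) (hne : P ≠ Q)
      (hl : IsSymmetryAxis S l) (hPQ : S ∩ l = segment ℝ P Q) :
      IsMajorAxis S P Q
  /-- If `S` consists of a single asymptotic point: `S` itself. -/
  | asymptoticPoint (P : ℝ × ℝ) (hP : IsAsymptotic P) (hS : S = {P}) :
      IsMajorAxis S P P

/-- `s` is the major semi-axis length of `S`. -/
def IsMajorSemiAxisLength (S : Set (ℝ × ℝ)) (s : ℝ≥0∞) : Prop :=
  ∃ P Q, IsMajorAxis S P Q ∧ s = hdist P Q / 2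

/-- `h` is the half-length of the segment which `S` cuts out from `m`. -/
def IsHalfSectionLength (S m : Set (ℝ × ℝ)) (h : ℝ≥0∞) : Prop :=
  ∃ M N : ℝ × ℝ, S ∩ m = segment ℝ M N ∧ h = hdist M N / 2

/-- `IsMinorSemiAxisLength S s`: `s` is the (generalized) minor semi-axis length of `S`. -/
inductive IsMinorSemiAxisLength (S : Set (ℝ × ℝ)) : ℝ≥0∞ → Prop
  /-- If `S` has only ordinary points: the minor axis is the intersection of `S` and the
  perpendicular bisector of the major axis (if `S` is a point, then it is this point). -/
  | bounded (P Q : ℝ × ℝ) (s : ℝ≥0∞) (hS : ∀ p ∈ S, IsOrdinary p) (hPQ : IsMajorAxis S P Q)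
      (hs : IsHalfSectionLength S {p | IsOrdinary p ∧ hdist p P = hdist p Q} s) :
      IsMinorSemiAxisLength S s
  /-- If `S` has two asymptotic points: the minor axes are the intersections of `S` with the lines
  perpendicular to the major axis. -/
  | line (P Q : ℝ × ℝ) (m : Set (ℝ × ℝ)) (s : ℝ≥0∞)
      (hP : IsAsymptotic P) (hQ : IsAsymptotic Q) (hne : P ≠ Q) (hPQ : IsMajorAxis S P Q)
      (hm : IsPerp (segment ℝ P Q) m) (hs : IsHalfSectionLength S m s) :
      IsMinorSemiAxisLength S s
  /-- For horodisks the length is infinite by declaration. -/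
  | horodisk (hS : IsHorodisk S) : IsMinorSemiAxisLength S ⊤
  /-- If `S` has a single asymptotic point, but it is neither a point nor a horodisk: the supremum of
  the half-lengths of the sections of `S` by the lines perpendicular to the symmetry axis `l`. -/
  | halfLine (P Q : ℝ × ℝ) (l : Set (ℝ × ℝ)) (hP : IsAsymptotic P)
      (huniq : ∀ p ∈ S, IsAsymptotic p → p = P) (hne : P ≠ Q) (hS : ¬ IsHorodisk S)
      (hl : IsSymmetryAxis S l) (hPQ : S ∩ l = segment ℝ P Q) :
      IsMinorSemiAxisLength S
        (sSup {h | ∃ m, IsPerp l m ∧ IsHalfSectionLength S m h})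
  /-- If `S` is a single asymptotic point, then the length is `0`. -/
  | asymptoticPoint (P : ℝ × ℝ) (hP : IsAsymptotic P) (hS : S = {P}) :
      IsMinorSemiAxisLength S 0

/-! ### The conformal range -/

/-- The conformal range (real Davis--Wielandt shell) of a complex `2 × 2` matrix in the
Beltrami--Cayley--Klein model. -/
def conformalRange (A : Matrix (Fin 2) (Fin 2) ℂ) : Set (ℝ × ℝ) :=
  {p | ∃ x y : EuclideanSpace ℂ (Fin 2), x ≠ 0 ∧ y = Matrix.toEuclideanLin A x ∧
    p = (2 * (inner ℂ y x).re / (‖y‖ ^ 2 + ‖x‖ ^ 2),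
         (‖y‖ ^ 2 - ‖x‖ ^ 2) / (‖y‖ ^ 2 + ‖x‖ ^ 2))}

/-- The map `ι` from complex numbers to the asymptotically closed hyperbolic plane; the
`h`-eigenpoints of `A` are the points `ι(λ)` for the eigenvalues `λ` of `A`. -/
def eigenpoint (z : ℂ) : ℝ × ℝ :=
  (2 * z.re / (‖z‖ ^ 2 + 1), (‖z‖ ^ 2 - 1) / (‖z‖ ^ 2 + 1))

/-- `s` is half of the hyperbolic distance of the two `h`-eigenpoints of `A` (eigenvalues taken with
multiplicity). -/
def IsHalfEigendistance (A : Matrix (Fin 2) (Fin 2) ℂ) (s : ℝ≥0∞) : Prop :=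
  ∃ z w : ℂ, A.charpoly.roots = {z, w} ∧ s = hdist (eigenpoint z) (eigenpoint w) / 2

/-! ### Characteristic BCK values -/

/-- Equivalence by real Möbius transformations `f(λ) = (aλ + b) / (cλ + d)` applicable to `A`
(that is, `cA + d` is invertible) and unitary conjugation. -/
def RealMobiusEquiv (A B : Matrix (Fin 2) (Fin 2) ℂ) : Prop :=
  ∃ a b c d : ℝ, a * d - b * c ≠ 0 ∧
    ((c : ℂ) • A + (d : ℂ) • (1 : Matrix (Fin 2) (Fin 2) ℂ)).det ≠ 0 ∧
    ∃ V ∈ Matrix.unitaryGroup (Fin 2) ℂ,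
      B = V * (((a : ℂ) • A + (b : ℂ) • 1) * ((c : ℂ) • A + (d : ℂ) • 1)⁻¹) * star V

/-- The matrix `S_β`. -/
def matS (β : ℝ) : Matrix (Fin 2) (Fin 2) ℂ :=
  !![0, (Real.cos β : ℂ); 0, Complex.I * (Real.sin β : ℂ)]

/-- The matrix `L_{α,t}^±`, where `ε = ±1`. -/
def matL (α t ε : ℝ) : Matrix (Fin 2) (Fin 2) ℂ :=
  !![(Real.cos α : ℂ) + Complex.I * (Real.sin α : ℂ), 2 * (t : ℂ);
     0, -(Real.cos α : ℂ) + (ε : ℂ) * (Complex.I * (Real.sin α : ℂ))]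

/-- The characteristic BCK values `χ⁺, χ⁻, χᵉ` of the canonical representatives `0`, `S_β` and
`L_{α,t}^±`. For `L_{α,t}^±` they are the Euclidean semi-axes of the conformal range, an ellipse
centered at the origin, and the Euclidean distance of the `h`-eigenpoints from the origin; in the
other cases they are fixed by declaration. -/
inductive CanonicalBCKValues : Matrix (Fin 2) (Fin 2) ℂ → ℝ → ℝ → ℝ → Prop
  | zero : CanonicalBCKValues 0 0 0 0
  | S (β : ℝ) (h0 : 0 ≤ β) (h1 : β ≤ Real.pi / 2) :
      CanonicalBCKValues (matS β) 1 (Real.cos β) (Real.sign β)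
  | L (α t ε : ℝ) (h0 : 0 ≤ α) (h1 : α ≤ Real.pi / 2) (ht : 0 ≤ t) (hε : ε = 1 ∨ ε = -1) :
      CanonicalBCKValues (matL α t ε) (√(Real.cos α ^ 2 + t ^ 2) / √(1 + t ^ 2))
        (t / √(1 + t ^ 2)) (Real.cos α)

/-- `χp`, `χm`, `χe` are the characteristic BCK values `χ⁺, χ⁻, χᵉ` of `A`: those of a canonical
representative equivalent to `A`. -/
def HasBCKValues (A : Matrix (Fin 2) (Fin 2) ℂ) (χp χm χe : ℝ) : Prop :=
  ∃ C, RealMobiusEquiv A C ∧ CanonicalBCKValues C χp χm χe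

/-- `artanh u` for `0 ≤ u ≤ 1`, with value `∞` for `u = 1`. -/
def artanhExt (u : ℝ) : ℝ≥0∞ :=
  if u < 1 then ENNReal.ofReal (Real.artanh u) else ⊤

end ConfRange

end

noncomputable section

namespace ConfRange

/-! ### Lorentz matrices -/

/-! For y = Ax the point of the conformal range depends only on |y|², |x|² and Re⟨y, x⟩, and these
numbers are the coordinates of a vector of the Lorentz space of signature (2,1), namely `rangeVec`.
Unitary conjugation does not change them. A real Möbius transformation is a real linear substitution
of the pair (y, x), so it acts on them by a matrix that multiplies the Lorentz form by (ad - bc)².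
Hence equivalent matrices have congruent ranges (`RealMobiusEquiv.hCongruent`). Since h-isometries
are exactly the maps induced by Lorentz matrices (`IsHIsometry.exists_lorentzPair`), all figure
types and lengths involved are invariant, and it suffices to study canonical representatives.

These exist for every matrix (`exists_hasBCKValues`): triangularize, then move the two eigenvalues
by PGL₂(ℝ) and normalize the phase of the off-diagonal entry. For a triangular matrix with diagonal
l, m and off-diagonal entry s one has U - |D| = |s|²/2, |D| = |l - m|²/4 and E = |l - m̄|²/4, so the
ratio is {|s|² : |s|² + |l - m|² : |s|² + |l - m̄|²}. A real Möbius map commutes with conjugation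
and multiplies the three squared moduli by one common factor, so the ratio is an invariant
(`exists_scale_of_realMobiusEquiv`). On the representatives other than 0 it equals {(χ⁻)² : (χ⁺)² :
1}, whence the formulas and the uniqueness of the values.

The range of L_{α,t} is an ellipse centred at the origin with Euclidean semi-axes χ⁺, χ⁻
(`conformalRange_matL`); a Euclidean radius u from the centre has hyperbolic length artanh u, and χ⁺
= 1 gives a distance band. The range of S_β touches the unit circle at one point
(`conformalRange_matS`). The distance d of the eigenpoints satisfies cosh d = (|D| + E) / |E - |D||,
and one of |D|, E is (χᵉ)² times the other.

For the classification, congruent ranges have equal semi-axis lengths, hence equal χ⁺, χ⁻ and equal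
ratios; only the ordinary point and the asymptotic point, with equal lengths but different ratios,
need a separate argument. Conversely, equal ratios give equal χ⁺, χ⁻, and then the ranges of the
representatives are the same set, except that a band may face an elliptic parabolic disk. In that
case |D| = E > 0, and the type decides. -/

/-- The Lorentz form on `ℝ³` whose null cone is the cone over the unit circle. -/
def hform (v w : Fin 3 → ℝ) : ℝ := v 0 * w 0 + v 1 * w 1 - v 2 * w 2

/-- Homogeneous coordinates of a point of the plane. -/
def homog (p : ℝ × ℝ) : Fin 3 → ℝ := ![p.1, p.2, 1]

/-- The point of the plane with given homogeneous coordinates. -/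
def dehomog (v : Fin 3 → ℝ) : ℝ × ℝ := (v 0 / v 2, v 1 / v 2)

/-- The projective transformation induced by a matrix. -/
def act (M : Matrix (Fin 3) (Fin 3) ℝ) (p : ℝ × ℝ) : ℝ × ℝ := dehomog (M *ᵥ homog p)

/-- Orthochronous Lorentz matrices. -/
structure IsLorentz (M : Matrix (Fin 3) (Fin 3) ℝ) : Prop where
  form : ∀ v w, hform (M *ᵥ v) (M *ᵥ w) = hform v w
  pos : ∀ p ∈ closedPlane, 0 < (M *ᵥ homog p) 2

@[simp] lemma homog_zero (p : ℝ × ℝ) : homog p 0 = p.1 := rfl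
@[simp] lemma homog_one (p : ℝ × ℝ) : homog p 1 = p.2 := rfl
@[simp] lemma homog_two (p : ℝ × ℝ) : homog p 2 = 1 := rfl

lemma mem_closedPlane {p : ℝ × ℝ} : p ∈ closedPlane ↔ p.1 ^ 2 + p.2 ^ 2 ≤ 1 := Iff.rfl

lemma hform_smul_left (c : ℝ) (v w : Fin 3 → ℝ) : hform (c • v) w = c * hform v w := by
  simp only [hform, Pi.smul_apply, smul_eq_mul]; ring

lemma hform_smul_right (c : ℝ) (v w : Fin 3 → ℝ) : hform v (c • w) = c * hform v w := by
  simp only [hform, Pi.smul_apply, smul_eq_mul]; ring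

lemma hform_homog (p q : ℝ × ℝ) : hform (homog p) (homog q) = p.1 * q.1 + p.2 * q.2 - 1 := by
  simp [hform]

lemma smul_homog_dehomog {v : Fin 3 → ℝ} (hv : v 2 ≠ 0) : v 2 • homog (dehomog v) = v := by
  ext i; fin_cases i <;> simp [homog, dehomog] <;> field_simp

lemma dehomog_smul {c : ℝ} (hc : c ≠ 0) (v : Fin 3 → ℝ) : dehomog (c • v) = dehomog v := by
  simp only [dehomog, Pi.smul_apply, smul_eq_mul, mul_div_mul_left _ _ hc]

lemma dehomog_homog (p : ℝ × ℝ) : dehomog (homog p) = p := by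
  simp [dehomog]

lemma hform_smul_smul (c d : ℝ) (v w : Fin 3 → ℝ) :
    hform (c • v) (d • w) = c * d * hform v w := by
  rw [hform_smul_left, hform_smul_right]; ring

lemma hform_self_eq {v : Fin 3 → ℝ} (hv : v 2 ≠ 0) :
    hform v v = v 2 ^ 2 * ((dehomog v).1 ^ 2 + (dehomog v).2 ^ 2 - 1) := by
  conv_lhs => rw [← smul_homog_dehomog hv]
  rw [hform_smul_smul, hform_homog]; ring

lemma dehomog_mem_closedPlane {v : Fin 3 → ℝ} (hv : v 2 ≠ 0) :
    dehomog v ∈ closedPlane ↔ hform v v ≤ 0 := by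
  have : 0 < v 2 ^ 2 := by positivity
  rw [hform_self_eq hv, mem_closedPlane, mul_nonpos_iff_neg_imp_nonneg]
  constructor
  · intro h; exact ⟨fun h' => by linarith, fun h' => by linarith⟩
  · intro h
    by_contra hc
    have := h.2 (by linarith)
    linarith

lemma isOrdinary_dehomog {v : Fin 3 → ℝ} (hv : v 2 ≠ 0) :
    IsOrdinary (dehomog v) ↔ hform v v < 0 := by
  have : 0 < v 2 ^ 2 := by positivity
  rw [hform_self_eq hv, IsOrdinary]
  constructor
  · intro h; exact mul_neg_of_pos_of_neg this (by linarith)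
  · intro h
    by_contra hc
    nlinarith

lemma IsOrdinary.mem {p : ℝ × ℝ} (h : IsOrdinary p) : p ∈ closedPlane := le_of_lt h

lemma IsAsymptotic.mem {p : ℝ × ℝ} (h : IsAsymptotic p) : p ∈ closedPlane := le_of_eq h

lemma isOrdinary_or_isAsymptotic {p : ℝ × ℝ} (h : p ∈ closedPlane) :
    IsOrdinary p ∨ IsAsymptotic p := lt_or_eq_of_le h

lemma IsAsymptotic.not_isOrdinary {p : ℝ × ℝ} (h : IsAsymptotic p) : ¬ IsOrdinary p := by
  unfold IsAsymptotic at h; unfold IsOrdinary; linarith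

/-- Reversed Cauchy–Schwarz inequality, for points of the disk. -/
lemma dot_lt_one {p q : ℝ × ℝ} (hp : IsOrdinary p) (hq : q ∈ closedPlane) :
    p.1 * q.1 + p.2 * q.2 < 1 := by
  unfold IsOrdinary at hp; rw [mem_closedPlane] at hq
  nlinarith [sq_nonneg (p.1 - q.1), sq_nonneg (p.2 - q.2)]

lemma dot_le_one {p q : ℝ × ℝ} (hp : p ∈ closedPlane) (hq : q ∈ closedPlane) :
    p.1 * q.1 + p.2 * q.2 ≤ 1 := by
  rw [mem_closedPlane] at hp hq
  nlinarith [sq_nonneg (p.1 - q.1), sq_nonneg (p.2 - q.2)]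

lemma eq_of_dot_eq_one {p q : ℝ × ℝ} (hp : p ∈ closedPlane) (hq : q ∈ closedPlane)
    (h : p.1 * q.1 + p.2 * q.2 = 1) : p = q := by
  rw [mem_closedPlane] at hp hq
  have h1 : (p.1 - q.1) ^ 2 + (p.2 - q.2) ^ 2 ≤ 0 := by nlinarith
  have h2 : p.1 - q.1 = 0 := by nlinarith [sq_nonneg (p.1 - q.1), sq_nonneg (p.2 - q.2)]
  have h3 : p.2 - q.2 = 0 := by nlinarith [sq_nonneg (p.1 - q.1), sq_nonneg (p.2 - q.2)]
  ext <;> linarith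

namespace IsLorentz

variable {M N : Matrix (Fin 3) (Fin 3) ℝ}

lemma homog_act (hM : IsLorentz M) {p : ℝ × ℝ} (hp : p ∈ closedPlane) :
    (M *ᵥ homog p) 2 • homog (act M p) = M *ᵥ homog p :=
  smul_homog_dehomog (hM.pos p hp).ne'

lemma hform_act (hM : IsLorentz M) {p q : ℝ × ℝ} (hp : p ∈ closedPlane) (hq : q ∈ closedPlane) :
    (M *ᵥ homog p) 2 * (M *ᵥ homog q) 2 * hform (homog (act M p)) (homog (act M q)) =
      hform (homog p) (homog q) := by
  rw [← hform_smul_smul, hM.homog_act hp, hM.homog_act hq, hM.form]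

lemma mapsTo (hM : IsLorentz M) {p : ℝ × ℝ} (hp : p ∈ closedPlane) : act M p ∈ closedPlane := by
  rw [act, dehomog_mem_closedPlane (hM.pos p hp).ne', hM.form, hform_homog]
  rw [mem_closedPlane] at hp; linarith

lemma isOrdinary (hM : IsLorentz M) {p : ℝ × ℝ} (hp : p ∈ closedPlane) :
    IsOrdinary (act M p) ↔ IsOrdinary p := by
  rw [act, isOrdinary_dehomog (hM.pos p hp).ne', hM.form, hform_homog, IsOrdinary]
  constructor <;> intro h <;> linarith

lemma isAsymptotic (hM : IsLorentz M) {p : ℝ × ℝ} (hp : p ∈ closedPlane) :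
    IsAsymptotic (act M p) ↔ IsAsymptotic p := by
  have h1 := hM.isOrdinary hp
  have h2 := isOrdinary_or_isAsymptotic hp
  have h3 := isOrdinary_or_isAsymptotic (hM.mapsTo hp)
  have h4 := fun h : IsAsymptotic p => h.not_isOrdinary
  have h5 := fun h : IsAsymptotic (act M p) => h.not_isOrdinary
  tauto

lemma act_mul (hN : IsLorentz N) {p : ℝ × ℝ} (hp : p ∈ closedPlane) :
    act (M * N) p = act M (act N p) := by
  have h := (hN.pos p hp).ne'
  rw [act, ← Matrix.mulVec_mulVec, ← hN.homog_act hp, Matrix.mulVec_smul, dehomog_smul h]; rfl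

lemma mul (hM : IsLorentz M) (hN : IsLorentz N) : IsLorentz (M * N) where
  form v w := by rw [← Matrix.mulVec_mulVec, ← Matrix.mulVec_mulVec, hM.form, hN.form]
  pos p hp := by
    rw [← Matrix.mulVec_mulVec, ← hN.homog_act hp, Matrix.mulVec_smul]
    exact mul_pos (hN.pos p hp) (hM.pos _ (hN.mapsTo hp))

lemma act_one (p : ℝ × ℝ) : act 1 p = p := by simp [act, dehomog_homog]

/-- Every Lorentz matrix has a Lorentz inverse. -/
lemma exists_inv (hM : IsLorentz M) : ∃ N, IsLorentz N ∧ N * M = 1 ∧ M * N = 1 := by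
  set J : Matrix (Fin 3) (Fin 3) ℝ := Matrix.diagonal ![1, 1, -1] with hJ
  have hform_eq (v w : Fin 3 → ℝ) : hform v w = v ⬝ᵥ J *ᵥ w := by
    simp [hJ, hform, Matrix.mulVec_diagonal, dotProduct, Fin.sum_univ_three]; ring
  have hJJ : J * J = 1 := by
    rw [hJ, Matrix.diagonal_mul_diagonal, ← Matrix.diagonal_one]
    congr 1; ext i; fin_cases i <;> simp
  -- Testing invariance of the form on basis vectors gives MᵀJM = J, so that the inverse is JMᵀJ.
  have hMJ : Mᵀ * J * M = J := by
    ext i j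
    have := hM.form (Pi.single i 1) (Pi.single j 1)
    rw [hform_eq, hform_eq, Matrix.mulVec_mulVec, Matrix.dotProduct_mulVec, ← Matrix.mulVec_transpose,
      Matrix.mulVec_mulVec] at this
    rw [Matrix.mulVec_single_one, single_one_dotProduct, Matrix.mulVec_single_one,
      dotProduct_single_one] at this
    have h2 : (Mᵀ * J * M) i j = ((J * M)ᵀ * M) j i := by
      rw [← Matrix.transpose_apply ((J * M)ᵀ * M), Matrix.transpose_mul, Matrix.transpose_transpose,
        Matrix.mul_assoc]
    rw [h2]
    exact this
  have h1 : (J * Mᵀ * J) * M = 1 := by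
    rw [Matrix.mul_assoc, Matrix.mul_assoc, ← Matrix.mul_assoc Mᵀ, hMJ, hJJ]
  have h2 : M * (J * Mᵀ * J) = 1 := mul_eq_one_comm.mp h1
  have hf : ∀ v w, hform ((J * Mᵀ * J) *ᵥ v) ((J * Mᵀ * J) *ᵥ w) = hform v w := fun v w => by
    rw [← hM.form, Matrix.mulVec_mulVec, Matrix.mulVec_mulVec, h2, Matrix.one_mulVec,
      Matrix.one_mulVec]
  refine ⟨J * Mᵀ * J, ⟨hf, fun p hp => ?_⟩, h1, h2⟩
  have h0 : (0 : ℝ × ℝ) ∈ closedPlane := by simp [mem_closedPlane]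
  have hu0 : IsOrdinary (0 : ℝ × ℝ) := by simp [IsOrdinary]
  -- The third coordinate of a vector is minus its Lorentz product with `homog 0`. Applying M to
  -- both factors turns it into a product with the image of the origin, whose sign is known since
  -- that image is an ordinary point.
  have key : ((J * Mᵀ * J) *ᵥ homog p) 2 = - hform (M *ᵥ homog 0) (homog p) := by
    rw [← hf, Matrix.mulVec_mulVec, h1, Matrix.one_mulVec]
    simp [hform]
  rw [key, ← hM.homog_act h0, hform_smul_left, hform_homog, neg_pos]
  refine mul_neg_of_pos_of_neg (hM.pos _ h0) ?_
  have := dot_lt_one ((hM.isOrdinary h0).2 hu0) hp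
  linarith

end IsLorentz

/-- Pairs of mutually inverse Lorentz matrices. -/
structure LorentzPair (M N : Matrix (Fin 3) (Fin 3) ℝ) : Prop where
  left : IsLorentz M
  right : IsLorentz N
  inv_left : N * M = 1
  inv_right : M * N = 1

namespace LorentzPair

variable {M N : Matrix (Fin 3) (Fin 3) ℝ}

lemma symm (h : LorentzPair M N) : LorentzPair N M := ⟨h.2, h.1, h.4, h.3⟩

lemma act_act (h : LorentzPair M N) {p : ℝ × ℝ} (hp : p ∈ closedPlane) : act N (act M p) = p := by
  rw [← IsLorentz.act_mul h.left hp, h.inv_left, IsLorentz.act_one]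

lemma image_image (h : LorentzPair M N) {S : Set (ℝ × ℝ)} (hS : S ⊆ closedPlane) :
    act N '' (act M '' S) = S := by
  rw [Set.image_image]
  ext p
  constructor
  · rintro ⟨q, hq, rfl⟩
    simpa only [h.act_act (hS hq)] using hq
  · intro hp
    exact ⟨p, hp, h.act_act (hS hp)⟩

lemma image_closedPlane (h : LorentzPair M N) : act M '' closedPlane = closedPlane := by
  apply Set.Subset.antisymm
  · rintro _ ⟨p, hp, rfl⟩; exact h.left.mapsTo hp
  · intro p hp
    exact ⟨act N p, h.right.mapsTo hp, h.symm.act_act hp⟩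

lemma isHIsometry (h : LorentzPair M N) : IsHIsometry (act M) := by
  refine ⟨M, ?_, fun p hp => ⟨(h.left.pos p hp).ne', rfl⟩, h.image_closedPlane⟩
  intro hd
  have := congrArg Matrix.det h.inv_left
  rw [Matrix.det_mul, hd] at this
  simp at this

lemma injOn (h : LorentzPair M N) : Set.InjOn (act M) closedPlane := fun p hp q hq hpq => by
  rw [← h.act_act hp, ← h.act_act hq, hpq]

end LorentzPair

lemma image_subset_closedPlane {M : Matrix (Fin 3) (Fin 3) ℝ} (h : IsLorentz M)
    {S : Set (ℝ × ℝ)} (hS : S ⊆ closedPlane) : act M '' S ⊆ closedPlane := by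
  rintro _ ⟨p, hp, rfl⟩; exact h.mapsTo (hS hp)

/-! ### Isometries of the disk are induced by Lorentz matrices -/

/-- A quadratic form on `ℝ³` vanishing on the null cone is a multiple of the Lorentz form. -/
lemma quadForm_eq_smul_of_null {B : (Fin 3 → ℝ) → (Fin 3 → ℝ) → ℝ} {Q : Matrix (Fin 3) (Fin 3) ℝ}
    (hQ : ∀ v w, B v w = v ⬝ᵥ Q *ᵥ w) (hsymm : Qᵀ = Q)
    (hnull : ∀ p, IsAsymptotic p → B (homog p) (homog p) = 0) (v w : Fin 3 → ℝ) :
    B v w = Q 0 0 * hform v w := by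
  have s01 : Q 1 0 = Q 0 1 := congrFun (congrFun hsymm 0) 1
  have s02 : Q 2 0 = Q 0 2 := congrFun (congrFun hsymm 0) 2
  have s12 : Q 2 1 = Q 1 2 := congrFun (congrFun hsymm 1) 2
  -- Five points of the circle determine the six coefficients up to scale. The four axis points
  -- settle all but the mixed coefficient `Q 0 1`, which the rational point (3/5, 4/5) kills.
  have e1 := hnull (1, 0) (by norm_num [IsAsymptotic])
  have e2 := hnull (-1, 0) (by norm_num [IsAsymptotic])
  have e3 := hnull (0, 1) (by norm_num [IsAsymptotic])
  have e4 := hnull (0, -1) (by norm_num [IsAsymptotic])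
  have e5 := hnull (3 / 5, 4 / 5) (by norm_num [IsAsymptotic])
  simp only [hQ, Matrix.mulVec, dotProduct, Fin.sum_univ_three, homog_zero, homog_one,
    homog_two, s01, s02, s12] at e1 e2 e3 e4 e5
  have q02 : Q 0 2 = 0 := by linarith
  have q12 : Q 1 2 = 0 := by linarith
  have q22 : Q 2 2 = - Q 0 0 := by linarith
  have q11 : Q 1 1 = Q 0 0 := by linarith
  have q01 : Q 0 1 = 0 := by rw [q11, q02, q12, q22] at e5; linarith
  simp only [hQ, Matrix.mulVec, dotProduct, Fin.sum_univ_three, s01, s02, s12, q02, q12, q22, q11,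
    q01, hform]
  ring

lemma isOrdinary_origin : IsOrdinary (0 : ℝ × ℝ) := by simp [IsOrdinary]

/-- An isometry of the asymptotically closed plane is induced by a Lorentz matrix. -/
theorem IsHIsometry.exists_lorentzPair {f : ℝ × ℝ → ℝ × ℝ} (hf : IsHIsometry f) :
    ∃ M N, LorentzPair M N ∧ Set.EqOn f (act M) closedPlane := by
  obtain ⟨M, hdet, hM, himg⟩ := hf
  have hM2 : ∀ p ∈ closedPlane, (M *ᵥ homog p) 2 ≠ 0 := fun p hp => (hM p hp).1
  have hfM : ∀ p ∈ closedPlane, f p = act M p := fun p hp => (hM p hp).2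
  have hmem : ∀ p ∈ closedPlane, act M p ∈ closedPlane := fun p hp => by
    rw [← hfM p hp, ← himg]; exact ⟨p, hp, rfl⟩
  have hunit : IsUnit M.det := isUnit_iff_ne_zero.mpr hdet
  have hinv : ∀ v, M⁻¹ *ᵥ (M *ᵥ v) = v := fun v => by
    rw [Matrix.mulVec_mulVec, Matrix.nonsing_inv_mul M hunit, Matrix.one_mulVec]
  have hinv' : ∀ v, M *ᵥ (M⁻¹ *ᵥ v) = v := fun v => by
    rw [Matrix.mulVec_mulVec, Matrix.mul_nonsing_inv M hunit, Matrix.one_mulVec]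
  -- A point with timelike image lies in the disk: the image is a disk point, hence by surjectivity
  -- the image of some q in the disk, and invertibility of M gives p = q.
  have hpt : ∀ p : ℝ × ℝ, hform (M *ᵥ homog p) (M *ᵥ homog p) < 0 → p ∈ closedPlane := by
    intro p hp
    have h2 : (M *ᵥ homog p) 2 ≠ 0 := by
      intro h0; simp only [hform, h0] at hp; nlinarith [sq_nonneg ((M *ᵥ homog p) 0),
        sq_nonneg ((M *ᵥ homog p) 1)]
    have h3 : act M p ∈ closedPlane := (dehomog_mem_closedPlane h2).2 hp.le
    rw [← himg] at h3
    obtain ⟨q, hq, hqp⟩ := h3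
    rw [hfM q hq] at hqp
    have h4 := smul_homog_dehomog h2
    have h5 := smul_homog_dehomog (hM2 q hq)
    change (M *ᵥ homog p) 2 • homog (act M p) = _ at h4
    change (M *ᵥ homog q) 2 • homog (act M q) = _ at h5
    have h6 : homog p = ((M *ᵥ homog p) 2 / (M *ᵥ homog q) 2) • homog q := by
      have h6 : M *ᵥ homog p = ((M *ᵥ homog p) 2 / (M *ᵥ homog q) 2) • (M *ᵥ homog q) :=
        calc M *ᵥ homog p = (M *ᵥ homog p) 2 • homog (act M p) := h4.symm
          _ = ((M *ᵥ homog p) 2 / (M *ᵥ homog q) 2) • ((M *ᵥ homog q) 2 • homog (act M q)) := by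
            rw [smul_smul, div_mul_cancel₀ _ (hM2 q hq), hqp]
          _ = _ := by rw [h5]
      have h7 := congrArg (M⁻¹ *ᵥ ·) h6
      simpa only [Matrix.mulVec_smul, hinv] using h7
    have h7 := congrFun h6 2
    simp only [homog_two, Pi.smul_apply, smul_eq_mul, mul_one] at h7
    rw [← h7, one_smul] at h6
    rwa [← dehomog_homog p, h6, dehomog_homog]
  -- If a circle point had timelike image, so would, by continuity, points slightly outside the
  -- disk, contrary to `hpt`.
  have hnull : ∀ p, IsAsymptotic p → hform (M *ᵥ homog p) (M *ᵥ homog p) = 0 := by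
    intro p hp
    apply le_antisymm
    · exact (dehomog_mem_closedPlane (hM2 p hp.mem)).1 (hmem p hp.mem)
    · by_contra hlt
      push Not at hlt
      have hcont : Continuous fun r : ℝ => hform (M *ᵥ homog (r * p.1, r * p.2))
          (M *ᵥ homog (r * p.1, r * p.2)) := by
        simp only [hform, Matrix.mulVec, dotProduct, Fin.sum_univ_three, homog_zero, homog_one,
          homog_two]
        fun_prop
      have h1 : ∀ᶠ r in nhds (1 : ℝ), hform (M *ᵥ homog (r * p.1, r * p.2))
          (M *ᵥ homog (r * p.1, r * p.2)) < 0 :=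
        hcont.continuousAt.eventually_lt_const (by simpa using hlt)
      have h2 := (h1.filter_mono nhdsWithin_le_nhds).and
        (self_mem_nhdsWithin : ∀ᶠ r in nhdsWithin (1 : ℝ) (Set.Ioi 1), r ∈ Set.Ioi (1 : ℝ))
      obtain ⟨r, hr, hr1⟩ := h2.exists
      have h3 := hpt _ hr
      rw [mem_closedPlane] at h3
      unfold IsAsymptotic at hp
      have hr2 : 1 < r := hr1
      have h4 : r ^ 2 * (p.1 ^ 2 + p.2 ^ 2) ≤ 1 := by linarith
      rw [hp] at h4
      nlinarith
  set J : Matrix (Fin 3) (Fin 3) ℝ := Matrix.diagonal ![1, 1, -1] with hJ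
  have hform_eq (v w : Fin 3 → ℝ) : hform v w = v ⬝ᵥ J *ᵥ w := by
    simp [hJ, hform, Matrix.mulVec_diagonal, dotProduct, Fin.sum_univ_three]; ring
  set k := (Mᵀ * J * M) 0 0
  have hk : ∀ v w, hform (M *ᵥ v) (M *ᵥ w) = k * hform v w :=
    quadForm_eq_smul_of_null (B := fun v w => hform (M *ᵥ v) (M *ᵥ w)) (Q := Mᵀ * J * M)
      (fun v w => by
        rw [hform_eq, Matrix.mulVec_mulVec, Matrix.dotProduct_mulVec, Matrix.vecMul_mulVec,
          ← Matrix.dotProduct_mulVec, Matrix.mul_assoc])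
      (by simp [Matrix.transpose_mul, hJ, Matrix.mul_assoc]) hnull
  have h0 := isOrdinary_origin.mem
  have hk0 : 0 ≤ k := by
    have h1 := (dehomog_mem_closedPlane (hM2 0 h0)).1 (hmem 0 h0)
    rw [hk, hform_homog] at h1
    simp at h1; exact h1
  have hkpos : 0 < k := by
    refine lt_of_le_of_ne hk0 fun h => ?_
    have h1 := hk (M⁻¹ *ᵥ ![1, 0, 0]) (M⁻¹ *ᵥ ![1, 0, 0])
    rw [hinv', ← h] at h1
    simp [hform] at h1
  -- The third coordinate keeps its sign on the disk: times the one at the origin and a non-positive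
  -- factor (dot product minus 1) it equals -k.
  have hsgn : ∀ p ∈ closedPlane, 0 < (M *ᵥ homog 0) 2 * (M *ᵥ homog p) 2 := by
    intro p hp
    have h1 := hk (homog 0) (homog p)
    rw [← smul_homog_dehomog (hM2 0 h0), ← smul_homog_dehomog (hM2 p hp), hform_smul_smul,
      hform_homog, hform_homog] at h1
    have h2 := dot_le_one (hmem 0 h0) (hmem p hp)
    simp only [act] at h2
    simp only [Prod.fst_zero, Prod.snd_zero, zero_mul, add_zero, zero_sub] at h1
    by_contra hneg
    push Not at hneg
    nlinarith
  -- The factor 1/√k makes M preserve the form exactly; its sign makes the third coordinate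
  -- positive.
  obtain ⟨c, hc, hck⟩ : ∃ c : ℝ, 0 < c * (M *ᵥ homog 0) 2 ∧ c ^ 2 * k = 1 := by
    have hs : √k ^ 2 = k := Real.sq_sqrt hk0
    have hs0 : 0 < √k := Real.sqrt_pos.2 hkpos
    rcases lt_or_gt_of_ne (hM2 0 h0) with h | h
    · refine ⟨-(√k)⁻¹, ?_, ?_⟩
      · have := inv_pos.2 hs0
        nlinarith
      · rw [neg_sq, inv_pow, hs, inv_mul_cancel₀ hkpos.ne']
    · refine ⟨(√k)⁻¹, by positivity, ?_⟩
      rw [inv_pow, hs, inv_mul_cancel₀ hkpos.ne']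
  have hc0 : c ≠ 0 := by rintro rfl; simp at hc
  have hL : IsLorentz (c • M) := by
    refine ⟨fun v w => ?_, fun p hp => ?_⟩
    · rw [Matrix.smul_mulVec, Matrix.smul_mulVec, hform_smul_smul, hk, ← mul_assoc, ← sq, hck,
        one_mul]
    · rw [Matrix.smul_mulVec, Pi.smul_apply, smul_eq_mul]
      have := hsgn p hp
      have h3 : 0 < (c * (M *ᵥ homog p) 2) * (M *ᵥ homog 0) 2 ^ 2 := by
        have := mul_pos hc this
        nlinarith
      exact pos_of_mul_pos_left h3 (sq_nonneg _)
  obtain ⟨N, hN, h1, h2⟩ := hL.exists_inv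
  refine ⟨c • M, N, ⟨hL, hN, h1, h2⟩, fun p hp => ?_⟩
  rw [hfM p hp, act, act, Matrix.smul_mulVec, dehomog_smul hc0]

/-! ### Distances -/

/-- The hyperbolic cosine of the distance of ordinary points. -/
def coshDist (p q : ℝ × ℝ) : ℝ :=
  (1 - p.1 * q.1 - p.2 * q.2) / (√(1 - p.1 ^ 2 - p.2 ^ 2) * √(1 - q.1 ^ 2 - q.2 ^ 2))

lemma one_le_coshDist {p q : ℝ × ℝ} (hp : IsOrdinary p) (hq : IsOrdinary q) :
    1 ≤ coshDist p q := by
  have h := dot_lt_one hp hq.mem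
  unfold IsOrdinary at hp hq
  have h1 : 0 < 1 - p.1 ^ 2 - p.2 ^ 2 := by linarith
  have h2 : 0 < 1 - q.1 ^ 2 - q.2 ^ 2 := by linarith
  rw [coshDist, le_div_iff₀ (mul_pos (Real.sqrt_pos.2 h1) (Real.sqrt_pos.2 h2)), one_mul,
    ← Real.sqrt_mul h1.le]
  apply Real.sqrt_le_iff.2 ⟨by linarith, ?_⟩
  nlinarith [mul_nonneg h1.le (add_nonneg (sq_nonneg (p.1 - q.1)) (sq_nonneg (p.2 - q.2))),
    sq_nonneg (p.1 * (q.1 - p.1) + p.2 * (q.2 - p.2))]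

lemma coshDist_self {p : ℝ × ℝ} (hp : IsOrdinary p) : coshDist p p = 1 := by
  unfold IsOrdinary at hp
  have h1 : 0 < 1 - p.1 ^ 2 - p.2 ^ 2 := by linarith
  rw [coshDist, Real.mul_self_sqrt h1.le]
  rw [div_eq_one_iff_eq h1.ne']; ring

lemma hdist_ordinary {p q : ℝ × ℝ} (hp : IsOrdinary p) (hq : IsOrdinary q) :
    hdist p q = ENNReal.ofReal (Real.arcosh (coshDist p q)) := by
  unfold hdist
  split_ifs with h1 h2
  · subst h1; rw [coshDist_self hp]; simp
  · rfl
  · exact absurd ⟨hp, hq⟩ h2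

lemma hdist_self (p : ℝ × ℝ) : hdist p p = 0 := by simp [hdist]

lemma hdist_eq_top_left {p q : ℝ × ℝ} (hp : IsAsymptotic p) (hpq : p ≠ q) : hdist p q = ⊤ := by
  unfold hdist
  rw [if_neg hpq, if_neg (fun h => hp.not_isOrdinary h.1)]

lemma hdist_eq_top_right {p q : ℝ × ℝ} (hq : IsAsymptotic q) (hpq : p ≠ q) : hdist p q = ⊤ := by
  unfold hdist
  rw [if_neg hpq, if_neg (fun h => hq.not_isOrdinary h.2)]

/-- The expression is homogeneous of degree 0 in the homogeneous coordinates of either point, so the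
scale factors introduced by `act` cancel. -/
lemma IsLorentz.coshDist_act {M : Matrix (Fin 3) (Fin 3) ℝ} (hM : IsLorentz M) {p q : ℝ × ℝ}
    (hp : p ∈ closedPlane) (hq : q ∈ closedPlane) :
    coshDist (act M p) (act M q) = coshDist p q := by
  have hcd : ∀ p q : ℝ × ℝ, coshDist p q = - hform (homog p) (homog q) /
      (√(- hform (homog p) (homog p)) * √(- hform (homog q) (homog q))) := by
    intro p q
    rw [hform_homog, hform_homog, hform_homog, coshDist]
    congr 1
    · ring
    · congr 2 <;> ring
  have hs : ∀ p ∈ closedPlane, √(- hform (homog p) (homog p)) =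
      (M *ᵥ homog p) 2 * √(- hform (homog (act M p)) (homog (act M p))) := by
    intro p hp
    have := hM.pos p hp
    rw [← hM.hform_act hp hp, ← sq, ← mul_neg, Real.sqrt_mul (sq_nonneg _), Real.sqrt_sq this.le]
  have h1 := hM.pos p hp
  have h2 := hM.pos q hq
  rw [hcd, hcd p q, hs p hp, hs q hq, ← hM.hform_act hp hq, mul_mul_mul_comm, ← mul_neg,
    mul_div_mul_left _ _ (mul_pos h1 h2).ne']

lemma LorentzPair.hdist_act {M N : Matrix (Fin 3) (Fin 3) ℝ} (hM : LorentzPair M N) {p q : ℝ × ℝ}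
    (hp : p ∈ closedPlane) (hq : q ∈ closedPlane) : hdist (act M p) (act M q) = hdist p q := by
  by_cases hpq : p = q
  · subst hpq; rw [hdist_self, hdist_self]
  have hne : act M p ≠ act M q := fun h => hpq (hM.injOn hp hq h)
  rcases isOrdinary_or_isAsymptotic hp with h1 | h1
  · rcases isOrdinary_or_isAsymptotic hq with h2 | h2
    · rw [hdist_ordinary h1 h2, hdist_ordinary ((hM.left.isOrdinary hp).2 h1)
        ((hM.left.isOrdinary hq).2 h2), hM.left.coshDist_act hp hq]
    · rw [hdist_eq_top_right h2 hpq, hdist_eq_top_right ((hM.left.isAsymptotic hq).2 h2) hne]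
  · rw [hdist_eq_top_left h1 hpq, hdist_eq_top_left ((hM.left.isAsymptotic hp).2 h1) hne]

/-! ### Segments and lines -/

lemma convex_closedPlane : Convex ℝ closedPlane := by
  intro p hp q hq a b ha hb hab
  rw [mem_closedPlane] at *
  simp only [Prod.fst_add, Prod.smul_fst, smul_eq_mul, Prod.snd_add, Prod.smul_snd]
  obtain rfl : b = 1 - a := by linarith
  nlinarith [sq_nonneg (p.1 - q.1), sq_nonneg (p.2 - q.2), mul_nonneg ha hb,
    mul_nonneg (mul_nonneg ha hb) (sq_nonneg (p.1 - q.1)),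
    mul_nonneg (mul_nonneg ha hb) (sq_nonneg (p.2 - q.2)),
    mul_le_mul_of_nonneg_left hp ha, mul_le_mul_of_nonneg_left hq hb]

lemma segment_subset_closedPlane {p q : ℝ × ℝ} (hp : p ∈ closedPlane) (hq : q ∈ closedPlane) :
    segment ℝ p q ⊆ closedPlane := convex_closedPlane.segment_subset hp hq

/-- A projective map takes a convex combination to one whose weights are rescaled by the third
coordinates of the images; these are positive on the disk, so no sign is lost. -/
lemma IsLorentz.image_segment_subset {M : Matrix (Fin 3) (Fin 3) ℝ} (hM : IsLorentz M)
    {p q : ℝ × ℝ} (hp : p ∈ closedPlane) (hq : q ∈ closedPlane) :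
    act M '' segment ℝ p q ⊆ segment ℝ (act M p) (act M q) := by
  rintro _ ⟨_, ⟨a, b, ha, hb, hab, rfl⟩, rfl⟩
  have h1 := hM.pos p hp
  have h2 := hM.pos q hq
  have h3 : homog (a • p + b • q) = a • homog p + b • homog q := by
    ext i; fin_cases i <;> simp [homog, hab]
  have h0 : 0 < a * (M *ᵥ homog p) 2 + b * (M *ᵥ homog q) 2 := by
    rcases ha.eq_or_lt with h | h
    · subst h
      obtain rfl : b = 1 := by linarith
      linarith
    · have := mul_nonneg hb h2.le
      have := mul_pos h h1
      linarith
  refine ⟨a * (M *ᵥ homog p) 2 / (a * (M *ᵥ homog p) 2 + b * (M *ᵥ homog q) 2),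
    b * (M *ᵥ homog q) 2 / (a * (M *ᵥ homog p) 2 + b * (M *ᵥ homog q) 2), by positivity,
    by positivity, ?_, ?_⟩
  · rw [← add_div, div_self h0.ne']
  · rw [act, act, act, h3, Matrix.mulVec_add, Matrix.mulVec_smul, Matrix.mulVec_smul]
    ext <;> simp [dehomog] <;> field_simp

lemma LorentzPair.image_segment {M N : Matrix (Fin 3) (Fin 3) ℝ} (h : LorentzPair M N)
    {p q : ℝ × ℝ} (hp : p ∈ closedPlane) (hq : q ∈ closedPlane) :
    act M '' segment ℝ p q = segment ℝ (act M p) (act M q) := by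
  apply (h.left.image_segment_subset hp hq).antisymm
  have h1 := h.right.image_segment_subset (h.left.mapsTo hp) (h.left.mapsTo hq)
  rw [h.act_act hp, h.act_act hq] at h1
  have h2 := Set.image_mono (f := act M) h1
  rwa [h.symm.image_image (segment_subset_closedPlane (h.left.mapsTo hp) (h.left.mapsTo hq))] at h2

lemma IsHLine.subset {l : Set (ℝ × ℝ)} (hl : IsHLine l) : l ⊆ closedPlane := by
  obtain ⟨a, b, c, -, rfl, -⟩ := hl
  exact fun p hp => hp.1

lemma image_inter_of_subset {M N : Matrix (Fin 3) (Fin 3) ℝ} (h : LorentzPair M N)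
    {S T : Set (ℝ × ℝ)} (hS : S ⊆ closedPlane) (hT : T ⊆ closedPlane) :
    act M '' (S ∩ T) = act M '' S ∩ act M '' T :=
  Set.InjOn.image_inter h.injOn hS hT

lemma LorentzPair.mem_image {M N : Matrix (Fin 3) (Fin 3) ℝ} (h : LorentzPair M N)
    {S : Set (ℝ × ℝ)} (hS : S ⊆ closedPlane) {p : ℝ × ℝ} :
    p ∈ act M '' S ↔ p ∈ closedPlane ∧ act N p ∈ S := by
  constructor
  · rintro ⟨q, hq, rfl⟩
    exact ⟨h.left.mapsTo (hS hq), by rwa [h.act_act (hS hq)]⟩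
  · rintro ⟨h1, h2⟩
    exact ⟨_, h2, h.symm.act_act h1⟩

/-- A line is the kernel of a covector n, and its image is the kernel of nN. -/
lemma LorentzPair.isHLine_image {M N : Matrix (Fin 3) (Fin 3) ℝ} (h : LorentzPair M N)
    {l : Set (ℝ × ℝ)} (hl : IsHLine l) : IsHLine (act M '' l) := by
  have hsub := hl.subset
  obtain ⟨a, b, c, hab, hl, p, hp, hpo⟩ := hl
  set n : Fin 3 → ℝ := ![a, b, -c] with hn
  have hl' : ∀ q, q ∈ l ↔ q ∈ closedPlane ∧ n ⬝ᵥ homog q = 0 := by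
    intro q
    rw [hl]
    simp only [Set.mem_ofPred_eq, hn, dotProduct, Fin.sum_univ_three, homog_zero, homog_one,
      homog_two, Matrix.cons_val_zero, Matrix.cons_val_one, Matrix.cons_val]
    refine and_congr_right fun _ => ⟨fun h => by linarith, fun h => by linarith⟩
  set n' := n ᵥ* N with hn'
  have key : ∀ q, q ∈ act M '' l ↔ q ∈ closedPlane ∧ n' 0 * q.1 + n' 1 * q.2 = - n' 2 := by
    intro q
    rw [h.mem_image hsub]
    refine and_congr_right fun hq => ?_
    rw [hl' (act N q)]
    have h1 : n' ⬝ᵥ homog q = (N *ᵥ homog q) 2 * (n ⬝ᵥ homog (act N q)) := by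
      rw [hn', ← Matrix.dotProduct_mulVec, ← h.right.homog_act hq, dotProduct_smul, smul_eq_mul,
        h.right.homog_act hq]
    have h2 : n' ⬝ᵥ homog q = n' 0 * q.1 + n' 1 * q.2 + n' 2 := by
      simp [dotProduct, Fin.sum_univ_three]
    have h3 := (h.right.pos q hq).ne'
    constructor
    · intro hh; rw [hh.2, mul_zero, h2] at h1; linarith
    · intro hh
      refine ⟨h.right.mapsTo hq, ?_⟩
      rw [h2, hh, neg_add_cancel] at h1
      rcases mul_eq_zero.1 h1.symm with h4 | h4
      · exact absurd h4 h3
      · exact h4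
  have hpM : act M p ∈ act M '' l := ⟨p, hp, rfl⟩
  refine ⟨n' 0, n' 1, -n' 2, ?_, ?_, act M p, hpM, (h.left.isOrdinary (hsub hp)).2 hpo⟩
  -- If the first two entries of nN vanished, so would the third, because the line has a point; then
  -- n = (nN)M would be zero.
  · by_contra hcon
    push Not at hcon
    have h1 := ((key _).1 hpM).2
    rw [hcon.1, hcon.2] at h1
    have h2 : n' = 0 := by ext i; fin_cases i <;> simp [hcon.1, hcon.2]; linarith
    have h3 : n = n' ᵥ* M := by rw [hn', Matrix.vecMul_vecMul, h.inv_left, Matrix.vecMul_one]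
    rw [h2, Matrix.zero_vecMul] at h3
    have h30 := congrFun h3 0
    have h31 := congrFun h3 1
    simp [hn] at h30 h31
    tauto
  · ext q; exact key q

/-! ### Invariance under isometries -/

lemma LorentzPair.isHIsometry_of_eqOn {M N : Matrix (Fin 3) (Fin 3) ℝ} (h : LorentzPair M N)
    {f : ℝ × ℝ → ℝ × ℝ} (hf : Set.EqOn f (act M) closedPlane) : IsHIsometry f := by
  obtain ⟨A, hA, hact, himg⟩ := h.isHIsometry
  refine ⟨A, hA, fun p hp => ?_, ?_⟩
  · rw [hf hp]; exact hact p hp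
  · rw [hf.image_eq, himg]

lemma LorentzPair.mul {M N M' N' : Matrix (Fin 3) (Fin 3) ℝ} (h : LorentzPair M N)
    (h' : LorentzPair M' N') : LorentzPair (M * M') (N' * N) where
  left := h.left.mul h'.left
  right := h'.right.mul h.right
  inv_left := by rw [Matrix.mul_assoc, ← Matrix.mul_assoc N, h.inv_left, Matrix.one_mul, h'.inv_left]
  inv_right := by
    rw [Matrix.mul_assoc, ← Matrix.mul_assoc M', h'.inv_right, Matrix.one_mul, h.inv_right]

lemma IsHIsometry.comp {f g : ℝ × ℝ → ℝ × ℝ} (hf : IsHIsometry f) (hg : IsHIsometry g) :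
    IsHIsometry (f ∘ g) := by
  obtain ⟨M, N, h, hfM⟩ := hf.exists_lorentzPair
  obtain ⟨M', N', h', hgM⟩ := hg.exists_lorentzPair
  refine (h.mul h').isHIsometry_of_eqOn fun p hp => ?_
  rw [Function.comp, hgM hp, hfM (h'.left.mapsTo hp), h'.left.act_mul hp]

lemma IsHIsometry.mapsTo {f : ℝ × ℝ → ℝ × ℝ} (hf : IsHIsometry f) {p : ℝ × ℝ}
    (hp : p ∈ closedPlane) : f p ∈ closedPlane := by
  obtain ⟨M, -, -, h⟩ := hf
  rw [← h]; exact ⟨p, hp, rfl⟩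

lemma hCongruent_iff {S T : Set (ℝ × ℝ)} (hS : S ⊆ closedPlane) :
    HCongruent S T ↔ ∃ M N, LorentzPair M N ∧ act M '' S = T := by
  constructor
  · rintro ⟨f, hf, rfl⟩
    obtain ⟨M, N, h, hfM⟩ := hf.exists_lorentzPair
    exact ⟨M, N, h, ((hfM.mono hS).image_eq).symm⟩
  · rintro ⟨M, N, h, rfl⟩
    exact ⟨act M, h.isHIsometry, rfl⟩

lemma HCongruent.subset {S T : Set (ℝ × ℝ)} (hS : S ⊆ closedPlane) (h : HCongruent S T) :
    T ⊆ closedPlane := by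
  obtain ⟨f, hf, rfl⟩ := h
  rintro _ ⟨p, hp, rfl⟩
  exact hf.mapsTo (hS hp)

lemma HCongruent.symm {S T : Set (ℝ × ℝ)} (hS : S ⊆ closedPlane) (h : HCongruent S T) :
    HCongruent T S := by
  have hT := h.subset hS
  obtain ⟨M, N, hM, rfl⟩ := (hCongruent_iff hS).1 h
  exact (hCongruent_iff hT).2 ⟨N, M, hM.symm, hM.image_image hS⟩

lemma HCongruent.trans {S T U : Set (ℝ × ℝ)} (h : HCongruent S T) (h' : HCongruent T U) :
    HCongruent S U := by
  obtain ⟨f, hf, rfl⟩ := h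
  obtain ⟨g, hg, rfl⟩ := h'
  exact ⟨g ∘ f, hg.comp hf, Set.image_comp g f S⟩

namespace LorentzPair

variable {M N : Matrix (Fin 3) (Fin 3) ℝ}

lemma isHReflection (h : LorentzPair M N) {f : ℝ × ℝ → ℝ × ℝ} {l : Set (ℝ × ℝ)}
    (hf : IsHReflection f l) : IsHReflection (act M ∘ f ∘ act N) (act M '' l) := by
  obtain ⟨h1, h2, h3⟩ := hf
  refine ⟨h.isHIsometry.comp (h1.comp h.symm.isHIsometry), h.isHLine_image h2, ?_⟩
  ext p
  rw [h.mem_image h2.subset, ← h3]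
  simp only [Set.mem_ofPred_eq, Function.comp]
  refine and_congr_right fun hp => ?_
  have hNp := h.right.mapsTo hp
  constructor
  · intro h4
    refine ⟨hNp, ?_⟩
    rw [← h.act_act (h1.mapsTo hNp), h4]
  · rintro ⟨-, h4⟩
    rw [h4, h.symm.act_act hp]

lemma image_conj (h : LorentzPair M N) {f : ℝ × ℝ → ℝ × ℝ} {S : Set (ℝ × ℝ)}
    (hS : S ⊆ closedPlane) (hf : f '' S = S) : (act M ∘ f ∘ act N) '' (act M '' S) = act M '' S := by
  rw [Set.image_comp, Set.image_comp, h.image_image hS, hf]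

lemma isSymmetryAxis (h : LorentzPair M N) {S l : Set (ℝ × ℝ)} (hS : S ⊆ closedPlane)
    (hl : IsSymmetryAxis S l) : IsSymmetryAxis (act M '' S) (act M '' l) := by
  obtain ⟨f, hf, hfS⟩ := hl
  exact ⟨_, h.isHReflection hf, h.image_conj hS hfS⟩

lemma isPerp (h : LorentzPair M N) {l m : Set (ℝ × ℝ)} (hl : IsPerp l m) :
    IsPerp (act M '' l) (act M '' m) := by
  obtain ⟨hm, hne, f, hf, hfm⟩ := hl
  refine ⟨h.isHLine_image hm, fun heq => hne ?_, _, h.isHReflection hf, h.image_conj hm.subset hfm⟩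
  rw [← h.image_image hf.2.1.subset, heq, h.image_image hm.subset]

lemma isHalfSectionLength (h : LorentzPair M N) {S m : Set (ℝ × ℝ)} {s : ℝ≥0∞}
    (hS : S ⊆ closedPlane) (hm : m ⊆ closedPlane) (hs : IsHalfSectionLength S m s) :
    IsHalfSectionLength (act M '' S) (act M '' m) s := by
  obtain ⟨P, Q, hPQ, rfl⟩ := hs
  have hP : P ∈ closedPlane := hS (hPQ.symm.subset (left_mem_segment ℝ P Q)).1
  have hQ : Q ∈ closedPlane := hS (hPQ.symm.subset (right_mem_segment ℝ P Q)).1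
  exact ⟨act M P, act M Q, by rw [← image_inter_of_subset h hS hm, hPQ, h.image_segment hP hQ],
    by rw [h.hdist_act hP hQ]⟩

lemma forall_image_isOrdinary (h : LorentzPair M N) {S : Set (ℝ × ℝ)} (hS : S ⊆ closedPlane)
    (hSo : ∀ p ∈ S, IsOrdinary p) : ∀ p ∈ act M '' S, IsOrdinary p := by
  rintro _ ⟨p, hp, rfl⟩
  exact (h.left.isOrdinary (hS hp)).2 (hSo p hp)

lemma unique_asymptotic (h : LorentzPair M N) {S : Set (ℝ × ℝ)} (hS : S ⊆ closedPlane) {P : ℝ × ℝ}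
    (huniq : ∀ p ∈ S, IsAsymptotic p → p = P) :
    ∀ p ∈ act M '' S, IsAsymptotic p → p = act M P := by
  rintro _ ⟨p, hp, rfl⟩ hp'
  rw [huniq p hp ((h.left.isAsymptotic (hS hp)).1 hp')]

end LorentzPair

lemma IsMajorAxis.mem {S : Set (ℝ × ℝ)} {P Q : ℝ × ℝ} (h : IsMajorAxis S P Q) : P ∈ S ∧ Q ∈ S := by
  rcases h with ⟨_, C, r, -, -, -, -, hPQ, -, -, -⟩ | ⟨_, -, -, -, hPQ⟩ |
    ⟨_, l, -, -, -, -, hPQ⟩ | ⟨-, hS⟩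
  · exact ⟨hPQ (left_mem_segment ℝ P Q), hPQ (right_mem_segment ℝ P Q)⟩
  · exact ⟨hPQ (left_mem_segment ℝ P Q), hPQ (right_mem_segment ℝ P Q)⟩
  · exact ⟨(hPQ.symm.subset (left_mem_segment ℝ P Q)).1,
      (hPQ.symm.subset (right_mem_segment ℝ P Q)).1⟩
  · subst hS; exact ⟨rfl, rfl⟩

lemma LorentzPair.isMajorAxis {M N : Matrix (Fin 3) (Fin 3) ℝ} (h : LorentzPair M N)
    {S : Set (ℝ × ℝ)} (hSc : S ⊆ closedPlane) {P Q : ℝ × ℝ} (hPQ : IsMajorAxis S P Q) :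
    IsMajorAxis (act M '' S) (act M P) (act M Q) := by
  have hPc : P ∈ closedPlane := hSc hPQ.mem.1
  have hQc : Q ∈ closedPlane := hSc hPQ.mem.2
  rcases hPQ with ⟨_, C, r, hS, hC, hball, hmin, hPQ, hP, hQ, hd⟩ | ⟨_, hP, hQ, hne, hPQ⟩ |
    ⟨_, l, hP, huniq, hne, hl, hPQ⟩ | ⟨hP, hS⟩
  · refine .bounded _ _ (act M C) r (h.forall_image_isOrdinary hSc hS)
      ((h.left.isOrdinary hC.mem).2 hC) ?_ ?_ ?_ ?_ ?_ ?_
    · rintro _ ⟨p, hp, rfl⟩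
      rw [h.hdist_act hC.mem (hSc hp)]; exact hball p hp
    -- A competing disk for the image is pulled back by N to a competing disk for S.
    · intro C' r' hC' hr'
      refine hmin (act N C') r' ((h.right.isOrdinary hC'.mem).2 hC') fun p hp => ?_
      have := hr' _ ⟨p, hp, rfl⟩
      rwa [← h.symm.hdist_act hC'.mem (h.left.mapsTo (hSc hp)), h.act_act (hSc hp)] at this
    · rw [← h.image_segment hPc hQc]; exact Set.image_mono hPQ
    · rw [h.hdist_act hC.mem hPc, hP]
    · rw [h.hdist_act hC.mem hQc, hQ]
    · rw [h.hdist_act hPc hQc, hd]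
  · refine .line _ _ ((h.left.isAsymptotic hPc).2 hP) ((h.left.isAsymptotic hQc).2 hQ)
      (fun heq => hne (h.injOn hPc hQc heq)) ?_
    rw [← h.image_segment hPc hQc]; exact Set.image_mono hPQ
  · refine .halfLine _ _ (act M '' l) ((h.left.isAsymptotic hPc).2 hP)
      (h.unique_asymptotic hSc huniq) (fun heq => hne (h.injOn hPc hQc heq))
      (h.isSymmetryAxis hSc hl) ?_
    obtain ⟨f, hf, -⟩ := hl
    rw [← image_inter_of_subset h hSc hf.2.1.subset, hPQ, h.image_segment hPc hQc]
  · subst hS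
    exact .asymptoticPoint _ ((h.left.isAsymptotic hPc).2 hP) Set.image_singleton

lemma IsHorodisk.subset {S : Set (ℝ × ℝ)} (hS : IsHorodisk S) : S ⊆ closedPlane := by
  obtain ⟨P, c, -, hc, rfl⟩ := hS
  intro p hp
  have : p.1 ^ 2 + p.2 ^ 2 - 1 + c * (1 - (p.1 * P.1 + p.2 * P.2)) ^ 2 ≤ 0 := hp
  rw [mem_closedPlane]
  nlinarith [mul_nonneg hc.le (sq_nonneg (1 - (p.1 * P.1 + p.2 * P.2)))]

/-- In homogeneous coordinates the inequality is ⟨p,p⟩ + c⟨p,P⟩² ≤ 0, of degree 2 in p.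
Renormalizing the image of P therefore only multiplies c by the square of its third coordinate. -/
lemma LorentzPair.isHorodisk {M N : Matrix (Fin 3) (Fin 3) ℝ} (h : LorentzPair M N)
    {S : Set (ℝ × ℝ)} (hS : IsHorodisk S) : IsHorodisk (act M '' S) := by
  have hsub := hS.subset
  obtain ⟨P, c, hP, hc, rfl⟩ := hS
  have hmem : ∀ (P : ℝ × ℝ) (c : ℝ) (p : ℝ × ℝ),
      p ∈ {p : ℝ × ℝ | p.1 ^ 2 + p.2 ^ 2 - 1 + c * (1 - (p.1 * P.1 + p.2 * P.2)) ^ 2 ≤ 0} ↔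
      hform (homog p) (homog p) + c * hform (homog p) (homog P) ^ 2 ≤ 0 := by
    intro P c p
    rw [hform_homog, hform_homog, Set.mem_ofPred_eq]
    constructor <;> intro h <;> nlinarith
  have hwP := h.left.pos P hP.mem
  refine ⟨act M P, c * (M *ᵥ homog P) 2 ^ 2, (h.left.isAsymptotic hP.mem).2 hP, by positivity, ?_⟩
  ext p
  rw [h.mem_image hsub]
  have key : ∀ p ∈ closedPlane, (act N p ∈ {p : ℝ × ℝ | p.1 ^ 2 + p.2 ^ 2 - 1 +
        c * (1 - (p.1 * P.1 + p.2 * P.2)) ^ 2 ≤ 0} ↔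
      p ∈ {p : ℝ × ℝ | p.1 ^ 2 + p.2 ^ 2 - 1 + c * (M *ᵥ homog P) 2 ^ 2 *
        (1 - (p.1 * (act M P).1 + p.2 * (act M P).2)) ^ 2 ≤ 0}) := by
    intro p hp
    rw [hmem, hmem]
    have hq := h.right.mapsTo hp
    have e1 := h.left.hform_act hq hq
    have e2 := h.left.hform_act hq hP.mem
    rw [h.symm.act_act hp] at e1 e2
    have hw := h.left.pos _ hq
    rw [← e1, ← e2, show ∀ a b x y : ℝ, a * a * x + c * (a * b * y) ^ 2 =
      a ^ 2 * (x + c * b ^ 2 * y ^ 2) by intros; ring]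
    exact ⟨fun h => nonpos_of_mul_nonpos_right h (by positivity),
      fun h => mul_nonpos_of_nonneg_of_nonpos (by positivity) h⟩
  constructor
  · rintro ⟨h1, h2⟩; exact (key p h1).1 h2
  · intro h1
    have h2 : p ∈ closedPlane :=
      IsHorodisk.subset ⟨_, _, (h.left.isAsymptotic hP.mem).2 hP, by positivity, rfl⟩ h1
    exact ⟨h2, (key p h2).2 h1⟩

lemma LorentzPair.isHorodisk_iff {M N : Matrix (Fin 3) (Fin 3) ℝ} (h : LorentzPair M N)
    {S : Set (ℝ × ℝ)} (hS : S ⊆ closedPlane) : IsHorodisk (act M '' S) ↔ IsHorodisk S :=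
  ⟨fun h1 => by simpa only [h.image_image hS] using h.symm.isHorodisk h1, h.isHorodisk⟩

lemma LorentzPair.isMajorSemiAxisLength {M N : Matrix (Fin 3) (Fin 3) ℝ} (h : LorentzPair M N)
    {S : Set (ℝ × ℝ)} (hS : S ⊆ closedPlane) {s : ℝ≥0∞} (hs : IsMajorSemiAxisLength S s) :
    IsMajorSemiAxisLength (act M '' S) s := by
  obtain ⟨P, Q, hPQ, rfl⟩ := hs
  exact ⟨_, _, h.isMajorAxis hS hPQ, by rw [h.hdist_act (hS hPQ.mem.1) (hS hPQ.mem.2)]⟩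

lemma LorentzPair.isMinorSemiAxisLength {M N : Matrix (Fin 3) (Fin 3) ℝ} (h : LorentzPair M N)
    {S : Set (ℝ × ℝ)} (hSc : S ⊆ closedPlane) {s : ℝ≥0∞} (hs : IsMinorSemiAxisLength S s) :
    IsMinorSemiAxisLength (act M '' S) s := by
  rcases hs with ⟨P, Q, s, hS, hPQ, hs⟩ | ⟨P, Q, m, s, hP, hQ, hne, hPQ, hm, hs⟩ | ⟨hS⟩ |
    ⟨P, Q, l, hP, huniq, hne, hS, hl, hPQ⟩ | ⟨P, hP, hS⟩
  · refine .bounded _ _ s (h.forall_image_isOrdinary hSc hS) (h.isMajorAxis hSc hPQ) ?_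
    have hPc := hSc hPQ.mem.1
    have hQc := hSc hPQ.mem.2
    have hsub : {p | IsOrdinary p ∧ hdist p P = hdist p Q} ⊆ closedPlane := fun p hp => hp.1.mem
    convert h.isHalfSectionLength hSc hsub hs using 1
    ext p
    rw [h.mem_image hsub]
    simp only [Set.mem_ofPred_eq]
    constructor
    · rintro ⟨h1, h2⟩
      refine ⟨h1.mem, (h.right.isOrdinary h1.mem).2 h1, ?_⟩
      rwa [← h.hdist_act (h.right.mapsTo h1.mem) hPc, ← h.hdist_act (h.right.mapsTo h1.mem) hQc,
        h.symm.act_act h1.mem]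
    · rintro ⟨h1, h2, h3⟩
      refine ⟨(h.right.isOrdinary h1).1 h2, ?_⟩
      rwa [← h.hdist_act (h.right.mapsTo h1) hPc, ← h.hdist_act (h.right.mapsTo h1) hQc,
        h.symm.act_act h1] at h3
  · have hPc := hP.mem
    have hQc := hQ.mem
    refine .line _ _ (act M '' m) s ((h.left.isAsymptotic hPc).2 hP)
      ((h.left.isAsymptotic hQc).2 hQ) (fun heq => hne (h.injOn hPc hQc heq))
      (h.isMajorAxis hSc hPQ) ?_ (h.isHalfSectionLength hSc hm.1.subset hs)
    rw [← h.image_segment hPc hQc]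
    exact h.isPerp hm
  · exact .horodisk (h.isHorodisk hS)
  · have hPc := hP.mem
    have hQc : Q ∈ closedPlane := hSc (hPQ.symm.subset (right_mem_segment ℝ P Q)).1
    have hlc : l ⊆ closedPlane := by obtain ⟨f, hf, -⟩ := hl; exact hf.2.1.subset
    have := IsMinorSemiAxisLength.halfLine (S := act M '' S) (act M P) (act M Q) (act M '' l)
      ((h.left.isAsymptotic hPc).2 hP) (h.unique_asymptotic hSc huniq)
      (fun heq => hne (h.injOn hPc hQc heq)) (by rwa [h.isHorodisk_iff hSc])
      (h.isSymmetryAxis hSc hl)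
      (by rw [← image_inter_of_subset h hSc hlc, hPQ, h.image_segment hPc hQc])
    -- The set of section lengths is unchanged because perpendicular lines and sections are
    -- transported in both directions.
    convert this using 2
    ext s
    constructor
    · rintro ⟨m, hm, hs⟩
      exact ⟨act M '' m, h.isPerp hm, h.isHalfSectionLength hSc hm.1.subset hs⟩
    · rintro ⟨m, hm, hs⟩
      have h1 := h.symm.isPerp hm
      have h2 := h.symm.isHalfSectionLength (image_subset_closedPlane h.left hSc) hm.1.subset hs
      rw [h.image_image hlc] at h1
      rw [h.image_image hSc] at h2
      exact ⟨_, h1, h2⟩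
  · subst hS
    exact .asymptoticPoint _ ((h.left.isAsymptotic hP.mem).2 hP) Set.image_singleton

theorem HCongruent.isMajorSemiAxisLength_iff {S T : Set (ℝ × ℝ)} (hS : S ⊆ closedPlane)
    (h : HCongruent S T) (s : ℝ≥0∞) : IsMajorSemiAxisLength S s ↔ IsMajorSemiAxisLength T s := by
  obtain ⟨M, N, hM, rfl⟩ := (hCongruent_iff hS).1 h
  refine ⟨hM.isMajorSemiAxisLength hS, fun hs => ?_⟩
  have := hM.symm.isMajorSemiAxisLength (image_subset_closedPlane hM.left hS) hs
  rwa [hM.image_image hS] at this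

theorem HCongruent.isMinorSemiAxisLength_iff {S T : Set (ℝ × ℝ)} (hS : S ⊆ closedPlane)
    (h : HCongruent S T) (s : ℝ≥0∞) : IsMinorSemiAxisLength S s ↔ IsMinorSemiAxisLength T s := by
  obtain ⟨M, N, hM, rfl⟩ := (hCongruent_iff hS).1 h
  refine ⟨hM.isMinorSemiAxisLength hS, fun hs => ?_⟩
  have := hM.symm.isMinorSemiAxisLength (image_subset_closedPlane hM.left hS) hs
  rwa [hM.image_image hS] at this

/-! ### Invariance of distance bands -/

lemma LorentzPair.isDistanceBand {M N : Matrix (Fin 3) (Fin 3) ℝ} (h : LorentzPair M N)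
    {S : Set (ℝ × ℝ)} (hS : IsDistanceBand S) : IsDistanceBand (act M '' S) := by
  obtain ⟨l, r, hl, rfl⟩ := hS
  refine ⟨act M '' l, r, h.isHLine_image hl, ?_⟩
  ext p
  rw [h.mem_image (fun p hp => hp.1)]
  simp only [distanceBand, Set.mem_ofPred_eq]
  constructor
  · rintro ⟨h1, h2, h3⟩
    refine ⟨h1, ?_⟩
    rw [iInf_image]
    refine le_of_eq_of_le (iInf_congr fun q => iInf_congr fun hq => ?_) h3
    rw [← h.hdist_act h2 (hl.subset hq), h.symm.act_act h1]
  · rintro ⟨h1, h2⟩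
    refine ⟨h1, h.right.mapsTo h1, ?_⟩
    rw [iInf_image] at h2
    refine le_of_eq_of_le (iInf_congr fun q => iInf_congr fun hq => ?_) h2
    rw [← h.hdist_act (h.right.mapsTo h1) (hl.subset hq), h.symm.act_act h1]

theorem HCongruent.isDistanceBand_iff {S T : Set (ℝ × ℝ)} (hS : S ⊆ closedPlane)
    (h : HCongruent S T) : IsDistanceBand S ↔ IsDistanceBand T := by
  obtain ⟨M, N, hM, rfl⟩ := (hCongruent_iff hS).1 h
  refine ⟨hM.isDistanceBand, fun hs => ?_⟩
  have := hM.symm.isDistanceBand hs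
  rwa [hM.image_image hS] at this

/-! ### Elliptical disks -/

/-- The Lorentz boost with last row `(x, y, w)`. -/
def boost (x y w : ℝ) : Matrix (Fin 3) (Fin 3) ℝ :=
  !![1 + x ^ 2 / (1 + w), x * y / (1 + w), x; x * y / (1 + w), 1 + y ^ 2 / (1 + w), y; x, y, w]

lemma add_pos_of_timelike {x y w : ℝ} (hw : 0 < w) (h : x ^ 2 + y ^ 2 < w ^ 2) {p : ℝ × ℝ}
    (hp : p ∈ closedPlane) : 0 < x * p.1 + y * p.2 + w := by
  rw [mem_closedPlane] at hp
  by_contra hc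
  push Not at hc
  have h1 : (x * p.1 + y * p.2) ^ 2 ≤ x ^ 2 + y ^ 2 := by
    nlinarith [sq_nonneg (x * p.2 - y * p.1), sq_nonneg x, sq_nonneg y]
  nlinarith

lemma isLorentz_boost {x y w : ℝ} (hw : 0 < w) (h : w ^ 2 - x ^ 2 - y ^ 2 = 1) :
    IsLorentz (boost x y w) := by
  have hk : (1 + w)⁻¹ * (1 + w) = 1 := inv_mul_cancel₀ (by positivity)
  refine ⟨fun v u => ?_, fun p hp => ?_⟩
  · simp only [hform, boost, Matrix.mulVec, dotProduct, Fin.sum_univ_three, Matrix.of_apply,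
      Matrix.cons_val_zero, Matrix.cons_val_one, Matrix.cons_val, div_eq_mul_inv]
    set k := (1 + w)⁻¹
    linear_combination (-(k * (x * v 0 + y * v 1) + v 2) * (k * (x * u 0 + y * u 1) + u 2)) * h +
      ((x * v 0 + y * v 1) * (x * u 0 + y * u 1) * ((w - 1) * k + 1) +
        ((x * v 0 + y * v 1) * u 2 + v 2 * (x * u 0 + y * u 1)) * (w - 1)) * hk
  · have := add_pos_of_timelike hw (x := x) (y := y) (by linarith) hp
    simpa [boost, Matrix.mulVec, dotProduct, Fin.sum_univ_three] using this

lemma timelike_of_pos {x y w : ℝ} (h : ∀ p ∈ closedPlane, 0 < x * p.1 + y * p.2 + w) :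
    0 < w ∧ x ^ 2 + y ^ 2 < w ^ 2 := by
  have hw : 0 < w := by simpa using h 0 isOrdinary_origin.mem
  refine ⟨hw, ?_⟩
  rcases eq_or_ne (x ^ 2 + y ^ 2) 0 with h0 | h0
  · rw [h0]; positivity
  have hr : 0 < x ^ 2 + y ^ 2 := lt_of_le_of_ne (by positivity) h0.symm
  have hs := Real.sqrt_pos.2 hr
  have hs2 := Real.sq_sqrt hr.le
  set s := √(x ^ 2 + y ^ 2)
  -- This is the point of the unit disk where the affine function attains its minimum, w - s.
  have h1 := h (-x / s, -y / s) (by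
    rw [mem_closedPlane]; simp only [div_pow, neg_sq]; rw [← add_div, hs2, div_self h0])
  have h2 : x * (-x / s) + y * (-y / s) + w = w - s := by
    field_simp; linear_combination hs2
  simp only [h2] at h1
  nlinarith

/-- The composite R of M with the affine parametrization is projective but not affine. Its last row
is positive on the disk, hence timelike, hence proportional to the last row of a boost L. Since L
maps the disk onto itself, replacing R by RL⁻¹ keeps the image and leaves an affine map. -/
lemma LorentzPair.isEllipticalDisk {M N : Matrix (Fin 3) (Fin 3) ℝ} (h : LorentzPair M N)
    {S : Set (ℝ × ℝ)} (hSc : S ⊆ closedPlane) (hS : IsEllipticalDisk S) :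
    IsEllipticalDisk (act M '' S) := by
  obtain ⟨a, b, c, d, u, v, hdet, rfl⟩ := hS
  set K : Matrix (Fin 3) (Fin 3) ℝ := !![a, b, u; c, d, v; 0, 0, 1] with hK
  have hKp : ∀ p : ℝ × ℝ, K *ᵥ homog p = homog (a * p.1 + b * p.2 + u, c * p.1 + d * p.2 + v) := by
    intro p
    ext i; fin_cases i <;> simp [hK, Matrix.mulVec, dotProduct, Fin.sum_univ_three, homog]
  have hKdet : K.det = a * d - b * c := by simp [hK, Matrix.det_fin_three]
  set R := M * K with hR
  have hRp : ∀ p, R *ᵥ homog p = M *ᵥ homog (a * p.1 + b * p.2 + u, c * p.1 + d * p.2 + v) := by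
    intro p; rw [hR, ← Matrix.mulVec_mulVec, hKp]
  obtain ⟨hw, htl⟩ := timelike_of_pos (x := R 2 0) (y := R 2 1) (w := R 2 2) (fun p hp => by
    have := h.left.pos _ (hSc ⟨p, hp, rfl⟩)
    rw [← hRp] at this
    simpa [Matrix.mulVec, dotProduct, Fin.sum_univ_three] using this)
  set ρ := √(R 2 2 ^ 2 - R 2 0 ^ 2 - R 2 1 ^ 2) with hρ
  have hρpos : 0 < ρ := Real.sqrt_pos.2 (by linarith)
  have hρ2 : ρ ^ 2 = R 2 2 ^ 2 - R 2 0 ^ 2 - R 2 1 ^ 2 := Real.sq_sqrt (by linarith)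
  have hL := isLorentz_boost (x := R 2 0 / ρ) (y := R 2 1 / ρ) (w := R 2 2 / ρ) (by positivity)
    (by rw [div_pow, div_pow, div_pow, ← sub_div, ← sub_div, hρ2, div_self]; rw [← hρ2]; positivity)
  set L := boost (R 2 0 / ρ) (R 2 1 / ρ) (R 2 2 / ρ) with hLdef
  obtain ⟨L', hL', h1, h2⟩ := hL.exists_inv
  have hLp : LorentzPair L L' := ⟨hL, hL', h1, h2⟩
  set T := R * L' with hT
  have hrow : ∀ j, R 2 j = ρ * L 2 j := by
    intro j; fin_cases j <;> simp [hLdef, boost] <;> field_simp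
  have hTrow : ∀ j, T 2 j = ρ * (1 : Matrix (Fin 3) (Fin 3) ℝ) 2 j := by
    intro j
    rw [← h2, hT, Matrix.mul_apply, Matrix.mul_apply, Finset.mul_sum]
    exact Finset.sum_congr rfl fun i _ => by rw [hrow, mul_assoc]
  have hT0 : T 2 0 = 0 := by simpa using hTrow 0
  have hT1 : T 2 1 = 0 := by simpa using hTrow 1
  have hT2 : T 2 2 = ρ := by simpa using hTrow 2
  have hTL : T * L = R := by rw [hT, Matrix.mul_assoc, h1, Matrix.mul_one]
  have hTdet : T.det ≠ 0 := by
    have e1 : M.det ≠ 0 := fun h0 => by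
      have := congrArg Matrix.det h.inv_left
      rw [Matrix.det_mul, h0] at this; simp at this
    have e2 : L'.det ≠ 0 := fun h0 => by
      have := congrArg Matrix.det h1
      rw [Matrix.det_mul, h0] at this; simp at this
    rw [hT, hR, Matrix.det_mul, Matrix.det_mul, hKdet]
    exact mul_ne_zero (mul_ne_zero e1 hdet) e2
  refine ⟨T 0 0 / ρ, T 0 1 / ρ, T 1 0 / ρ, T 1 1 / ρ, T 0 2 / ρ, T 1 2 / ρ, ?_, ?_⟩
  · intro h0
    apply hTdet
    rw [Matrix.det_fin_three, hT0, hT1, hT2]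
    field_simp at h0
    linear_combination ρ * h0
  · conv_rhs => rw [← hLp.image_closedPlane]
    rw [Set.image_image, Set.image_image]
    refine Set.image_congr fun p hp => ?_
    have e1 : act M (a * p.1 + b * p.2 + u, c * p.1 + d * p.2 + v) =
        dehomog (T *ᵥ homog (act L p)) := by
      rw [act, ← hRp, ← hTL, ← Matrix.mulVec_mulVec, ← hL.homog_act hp, Matrix.mulVec_smul,
        dehomog_smul (hL.pos p hp).ne']
    rw [e1]
    ext <;> simp [dehomog, Matrix.mulVec, dotProduct, Fin.sum_univ_three, hT0, hT1, hT2] <;>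
      field_simp

lemma LorentzPair.isEllipticParabolicDisk {M N : Matrix (Fin 3) (Fin 3) ℝ} (h : LorentzPair M N)
    {S : Set (ℝ × ℝ)} (hS : IsEllipticParabolicDisk S) :
    IsEllipticParabolicDisk (act M '' S) := by
  rcases hS with ⟨h1, h2, ⟨P, ⟨hPS, hP⟩, huniq⟩, h4⟩ | ⟨P, Q, hP, hQ, rfl⟩
  · refine .inl ⟨h.isEllipticalDisk h2 h1, image_subset_closedPlane h.left h2,
      ⟨act M P, ⟨⟨P, hPS, rfl⟩, (h.left.isAsymptotic hP.mem).2 hP⟩, ?_⟩,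
      by rwa [h.isHorodisk_iff h2]⟩
    rintro q ⟨hq, hq'⟩
    exact h.unique_asymptotic h2 (fun p hp hp' => huniq p ⟨hp, hp'⟩) q hq hq'
  · exact .inr ⟨act M P, act M Q, (h.left.isAsymptotic hP.mem).2 hP,
      (h.left.isOrdinary hQ.mem).2 hQ, h.image_segment hP.mem hQ.mem⟩

theorem HCongruent.isEllipticParabolicDisk_iff {S T : Set (ℝ × ℝ)} (hS : S ⊆ closedPlane)
    (h : HCongruent S T) : IsEllipticParabolicDisk S ↔ IsEllipticParabolicDisk T := by
  obtain ⟨M, N, hM, rfl⟩ := (hCongruent_iff hS).1 h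
  refine ⟨hM.isEllipticParabolicDisk, fun hs => ?_⟩
  have := hM.symm.isEllipticParabolicDisk hs
  rwa [hM.image_image hS] at this

/-- A distance band contains two asymptotic points, so it is no elliptic parabolic disk. -/
lemma IsHLine.exists_two_asymptotic {l : Set (ℝ × ℝ)} (hl : IsHLine l) :
    ∃ P ∈ l, ∃ Q ∈ l, IsAsymptotic P ∧ IsAsymptotic Q ∧ P ≠ Q := by
  obtain ⟨a, b, c, hab, rfl, p, ⟨-, hpl⟩, hpo⟩ := hl
  unfold IsOrdinary at hpo
  have hr : 0 < a ^ 2 + b ^ 2 := by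
    rcases hab with h | h
    · have := sq_pos_of_ne_zero h; positivity
    · have := sq_pos_of_ne_zero h; positivity
  have hc : c ^ 2 < a ^ 2 + b ^ 2 := by
    rw [← hpl]
    nlinarith [sq_nonneg (a * p.2 - b * p.1)]
  set s := √(a ^ 2 + b ^ 2 - c ^ 2)
  have hs : 0 < s := Real.sqrt_pos.2 (by linarith)
  have hs2 : s ^ 2 = a ^ 2 + b ^ 2 - c ^ 2 := Real.sq_sqrt (by linarith)
  -- The points sought are the foot c(a, b)/(a² + b²) of the perpendicular from the origin, moved by
  -- ±s/(a² + b²) along the direction (-b, a).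
  have key : ∀ t : ℝ, t ^ 2 = s ^ 2 →
      IsAsymptotic ((a * c - b * t) / (a ^ 2 + b ^ 2), (b * c + a * t) / (a ^ 2 + b ^ 2)) ∧
      a * ((a * c - b * t) / (a ^ 2 + b ^ 2)) + b * ((b * c + a * t) / (a ^ 2 + b ^ 2)) = c := by
    intro t ht
    constructor
    · unfold IsAsymptotic
      simp only
      field_simp
      linear_combination (a ^ 2 + b ^ 2) * (ht + hs2)
    · field_simp; ring
  refine ⟨_, ⟨(key s rfl).1.mem, (key s rfl).2⟩, _, ⟨(key (-s) (neg_sq s)).1.mem,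
    (key (-s) (neg_sq s)).2⟩, (key s rfl).1, (key (-s) (neg_sq s)).1, fun heq => ?_⟩
  have e1 := congrArg Prod.fst heq
  have e2 := congrArg Prod.snd heq
  simp only at e1 e2
  rw [div_left_inj' hr.ne'] at e1 e2
  have e3 : b * s = 0 := by linarith
  have e4 : a * s = 0 := by linarith
  rcases hab with h | h
  · exact h ((mul_eq_zero.1 e4).resolve_right hs.ne')
  · exact h ((mul_eq_zero.1 e3).resolve_right hs.ne')

lemma IsDistanceBand.not_isEllipticParabolicDisk {S : Set (ℝ × ℝ)} (hS : IsDistanceBand S) :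
    ¬ IsEllipticParabolicDisk S := by
  obtain ⟨l, r, hl, rfl⟩ := hS
  have hsub : l ⊆ distanceBand l r := fun p hp => ⟨hl.subset hp,
    (iInf₂_le p hp).trans (by rw [hdist_self]; exact zero_le)⟩
  obtain ⟨P, hP, Q, hQ, hPa, hQa, hne⟩ := hl.exists_two_asymptotic
  rintro (⟨-, -, h3, -⟩ | ⟨A, B, hA, hB, h⟩)
  · exact hne (h3.unique ⟨hsub hP, hPa⟩ ⟨hsub hQ, hQa⟩)
  · rw [h] at hsub
    -- A half-line meets the circle only in its end A, by strict convexity, whereas the band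
    -- contains both ends of its line.
    have key : ∀ p ∈ segment ℝ A B, IsAsymptotic p → p = A := by
      rintro _ ⟨a, b, ha, hb, hab, rfl⟩ hp
      obtain rfl : a = 1 - b := by linarith
      rcases hb.eq_or_lt with h0 | h0
      · subst h0; simp
      exfalso
      have h1 := dot_lt_one hB hA.mem
      unfold IsAsymptotic at hA hp
      unfold IsOrdinary at hB
      simp only [Prod.fst_add, Prod.smul_fst, smul_eq_mul, Prod.snd_add, Prod.smul_snd] at hp
      have : b * ((1 - b) * (2 * (1 - (B.1 * A.1 + B.2 * A.2))) +
          b * (1 - (B.1 ^ 2 + B.2 ^ 2))) = 0 := by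
        linear_combination -hp + (1 - b) ^ 2 * hA
      have h2 := (mul_eq_zero.1 this).resolve_left h0.ne'
      have h3 : 0 < b * (1 - (B.1 ^ 2 + B.2 ^ 2)) := mul_pos h0 (by linarith)
      have h4 : 0 ≤ (1 - b) * (2 * (1 - (B.1 * A.1 + B.2 * A.2))) := mul_nonneg ha (by linarith)
      linarith
    exact hne ((key P (hsub hP) hPa).trans (key Q (hsub hQ) hQa).symm)

/-! ### Inverse hyperbolic functions -/

lemma arcosh_one_div_sqrt {u : ℝ} (h0 : 0 ≤ u) (h1 : u < 1) :
    Real.arcosh (1 / √(1 - u ^ 2)) = Real.artanh u := by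
  rw [← Real.cosh_artanh ⟨by linarith, h1⟩, Real.arcosh_cosh (Real.artanh_nonneg h0)]

lemma arsinh_div_sqrt {u : ℝ} (h0 : 0 ≤ u) (h1 : u < 1) :
    Real.arsinh (u / √(1 - u ^ 2)) = Real.artanh u := by
  rw [← Real.sinh_artanh ⟨by linarith, h1⟩, Real.arsinh_sinh]

lemma arcosh_double {u : ℝ} (h0 : 0 ≤ u) (h1 : u < 1) :
    Real.arcosh ((1 + u ^ 2) / (1 - u ^ 2)) = 2 * Real.artanh u := by
  have hu : 0 < 1 - u ^ 2 := by nlinarith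
  rw [← Real.arcosh_cosh (x := 2 * Real.artanh u) (by have := Real.artanh_nonneg h0; linarith),
    Real.cosh_two_mul, Real.cosh_artanh ⟨by linarith, h1⟩, Real.sinh_artanh ⟨by linarith, h1⟩,
    div_pow, div_pow, Real.sq_sqrt hu.le]
  congr 1
  field_simp

lemma artanhExt_of_lt {u : ℝ} (h : u < 1) : artanhExt u = ENNReal.ofReal (Real.artanh u) := if_pos h

lemma artanhExt_one : artanhExt 1 = ⊤ := if_neg (lt_irrefl 1)

lemma artanhExt_injOn : Set.InjOn artanhExt (Set.Icc 0 1) := by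
  intro x hx y hy hxy
  rcases hx.2.lt_or_eq with h1 | h1 <;> rcases hy.2.lt_or_eq with h2 | h2
  · rw [artanhExt_of_lt h1, artanhExt_of_lt h2, ENNReal.ofReal_eq_ofReal_iff
      (Real.artanh_nonneg hx.1) (Real.artanh_nonneg hy.1)] at hxy
    exact Real.artanh_injOn ⟨by linarith [hx.1], h1⟩ ⟨by linarith [hy.1], h2⟩ hxy
  · subst h2; rw [artanhExt_of_lt h1, artanhExt_one] at hxy; exact absurd hxy ENNReal.ofReal_ne_top
  · subst h1
    rw [artanhExt_of_lt h2, artanhExt_one] at hxy; exact absurd hxy.symm ENNReal.ofReal_ne_top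
  · rw [h1, h2]

lemma artanhExt_zero : artanhExt 0 = 0 := by rw [artanhExt_of_lt one_pos]; simp

lemma ofReal_two_mul_div_two (x : ℝ) : ENNReal.ofReal (2 * x) / 2 = ENNReal.ofReal x := by
  rw [ENNReal.ofReal_mul (by norm_num), ENNReal.ofReal_ofNat, mul_comm]
  exact ENNReal.mul_div_cancel_right (by norm_num) (by norm_num)

lemma ENNReal_top_div_two : (⊤ : ℝ≥0∞) / 2 = ⊤ := ENNReal.top_div_of_ne_top (by norm_num)

/-! ### Computing distances -/

lemma hdist_comm (p q : ℝ × ℝ) : hdist p q = hdist q p := by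
  by_cases h : p = q
  · rw [h]
  unfold hdist
  rw [if_neg h, if_neg (Ne.symm h)]
  by_cases h2 : IsOrdinary p ∧ IsOrdinary q
  · rw [if_pos h2, if_pos h2.symm, mul_comm p.1, mul_comm p.2, mul_comm √(1 - p.1 ^ 2 - p.2 ^ 2)]
  · rw [if_neg h2, if_neg (fun h3 => h2 h3.symm)]

/-- The duplication formula cosh 2x = (1 + u²)/(1 - u²) for u = tanh x: half-lengths of segments and
the half eigendistance are obtained from rational expressions, without ever solving for x. -/
lemma hdist_div_two {p q : ℝ × ℝ} (hp : IsOrdinary p) (hq : IsOrdinary q) {u : ℝ} (h0 : 0 ≤ u)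
    (h1 : u < 1) (h : coshDist p q = (1 + u ^ 2) / (1 - u ^ 2)) :
    hdist p q / 2 = ENNReal.ofReal (Real.artanh u) := by
  rw [hdist_ordinary hp hq, h, arcosh_double h0 h1, ofReal_two_mul_div_two]

lemma ofReal_arcosh_le {x y : ℝ} (hx : 1 ≤ x) (hy : 1 ≤ y) :
    ENNReal.ofReal (Real.arcosh x) ≤ ENNReal.ofReal (Real.arcosh y) ↔ x ≤ y := by
  rw [ENNReal.ofReal_le_ofReal_iff (Real.arcosh_nonneg hy),
    Real.arcosh_le_arcosh (by linarith) (by linarith)]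

lemma ofReal_arcosh_inj {x y : ℝ} (hx : 1 ≤ x) (hy : 1 ≤ y) :
    ENNReal.ofReal (Real.arcosh x) = ENNReal.ofReal (Real.arcosh y) ↔ x = y := by
  rw [le_antisymm_iff, ofReal_arcosh_le hx hy, ofReal_arcosh_le hy hx, le_antisymm_iff]

lemma coshDist_zero_left (p : ℝ × ℝ) : coshDist 0 p = 1 / √(1 - (p.1 ^ 2 + p.2 ^ 2)) := by
  simp [coshDist, sub_sub]

lemma one_le_one_div_sqrt {u : ℝ} (h0 : 0 ≤ u) (h1 : u < 1) : 1 ≤ 1 / √(1 - u) := by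
  have : 0 < √(1 - u) := Real.sqrt_pos.2 (by linarith)
  rw [le_div_iff₀ this, one_mul]
  exact Real.sqrt_le_one.2 (by linarith)

/-! ### Segments -/

/-- Makes section lengths single-valued. Each pair of ends has parameters in [0, 1] with respect to
the other pair, and substituting one parametrization into the other forces them to be 0 and 1. -/
lemma segment_endpoints {A B M N : ℝ × ℝ} (h : segment ℝ A B = segment ℝ M N) :
    (A = M ∧ B = N) ∨ (A = N ∧ B = M) := by
  have hA : A ∈ segment ℝ M N := h ▸ left_mem_segment ℝ A B
  have hB : B ∈ segment ℝ M N := h ▸ right_mem_segment ℝ A B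
  have hM : M ∈ segment ℝ A B := h.symm ▸ left_mem_segment ℝ M N
  have hN : N ∈ segment ℝ A B := h.symm ▸ right_mem_segment ℝ M N
  rw [segment_eq_image'] at hA hB hM hN
  obtain ⟨s, ⟨hs0, hs1⟩, rfl⟩ := hA
  obtain ⟨t, ⟨ht0, ht1⟩, rfl⟩ := hB
  obtain ⟨x, ⟨hx0, hx1⟩, hx⟩ := hM
  obtain ⟨y, ⟨hy0, hy1⟩, hy⟩ := hN
  by_cases hMN : N - M = 0
  · left; simp [sub_eq_zero.1 hMN]
  have h1 : (s + x * (t - s)) • (N - M) = 0 := by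
    have : M + (s + x * (t - s)) • (N - M) = M := by
      conv_rhs => rw [← hx]
      module
    simpa using this
  have h2 : (s + y * (t - s) - 1) • (N - M) = 0 := by
    have : M + (s + y * (t - s)) • (N - M) = N := by
      conv_rhs => rw [← hy]
      module
    have h3 : M + (s + y * (t - s)) • (N - M) - N = (s + y * (t - s) - 1) • (N - M) := by module
    rw [← h3, this, sub_self]
  have e1 := (smul_eq_zero.1 h1).resolve_right hMN
  have e2 := (smul_eq_zero.1 h2).resolve_right hMN
  rcases le_total s t with hst | hst
  · have hs : s = 0 := by nlinarith [mul_nonneg hx0 (sub_nonneg.2 hst)]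
    have ht : t = 1 := by nlinarith [mul_nonneg (sub_nonneg.2 hy1) (sub_nonneg.2 hst)]
    left; subst hs ht; simp
  · have ht : t = 0 := by nlinarith [mul_nonneg (sub_nonneg.2 hx1) (sub_nonneg.2 hst)]
    have hs : s = 1 := by nlinarith [mul_nonneg hy0 (sub_nonneg.2 hst)]
    right; subst hs ht; simp

lemma isHalfSectionLength_iff {S m : Set (ℝ × ℝ)} {A B : ℝ × ℝ} (h : S ∩ m = segment ℝ A B)
    (s : ℝ≥0∞) : IsHalfSectionLength S m s ↔ s = hdist A B / 2 := by
  constructor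
  · rintro ⟨M, N, hMN, rfl⟩
    rcases segment_endpoints (h.symm.trans hMN) with ⟨rfl, rfl⟩ | ⟨rfl, rfl⟩
    · rfl
    · rw [hdist_comm]
  · rintro rfl; exact ⟨A, B, h, rfl⟩

lemma mem_segment_neg {R p : ℝ × ℝ} : p ∈ segment ℝ (-R) R ↔ ∃ t : ℝ, t ^ 2 ≤ 1 ∧ p = t • R := by
  constructor
  · rintro ⟨a, b, ha, hb, hab, rfl⟩
    refine ⟨b - a, ?_, by module⟩
    obtain rfl : b = 1 - a := by linarith
    nlinarith
  · rintro ⟨t, ht, rfl⟩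
    have h1 := abs_le.1 ((sq_le_one_iff_abs_le_one t).1 ht)
    exact ⟨(1 - t) / 2, (1 + t) / 2, by linarith [h1.2], by linarith [h1.1], by ring, by module⟩

/-! ### Reflections -/

/-- The formula for the reflection in a line. -/
lemma IsHReflection.apply {f : ℝ × ℝ → ℝ × ℝ} {l : Set (ℝ × ℝ)} (hf : IsHReflection f l)
    {a b c : ℝ} (hl : l = {p | p ∈ closedPlane ∧ a * p.1 + b * p.2 = c}) (hab : a ≠ 0 ∨ b ≠ 0) {p : ℝ × ℝ}
    (hp : p ∈ closedPlane) :
    f p = dehomog (homog p - (2 * (a * p.1 + b * p.2 - c) / (a ^ 2 + b ^ 2 - c ^ 2)) •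
      ![a, b, c]) := by
  obtain ⟨hiso, hline, hfix⟩ := hf
  obtain ⟨M, N, hM, hfM⟩ := hiso.exists_lorentzPair
  obtain ⟨P, hP, Q, hQ, hPa, hQa, hne⟩ := hline.exists_two_asymptotic
  have hfixp : ∀ q ∈ l, act M q = q := fun q hq => by
    rw [← hfix] at hq; rw [← hfM hq.1]; exact hq.2
  have hMq : ∀ q ∈ l, M *ᵥ homog q = (M *ᵥ homog q) 2 • homog q := fun q hq => by
    conv_lhs => rw [← hM.left.homog_act (hline.subset hq), hfixp q hq]
  have hne' : P.1 - Q.1 ≠ 0 ∨ P.2 - Q.2 ≠ 0 := by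
    by_contra hcon
    push Not at hcon
    exact hne (Prod.ext (by linarith) (by linarith))
  have hPl : a * P.1 + b * P.2 = c := by rw [hl] at hP; exact hP.2
  have hQl : a * Q.1 + b * Q.2 = c := by rw [hl] at hQ; exact hQ.2
  have hmid : ((1 / 2 : ℝ) • P + (1 / 2 : ℝ) • Q) ∈ l := by
    rw [hl]
    refine ⟨convex_closedPlane hPa.mem hQa.mem (by norm_num) (by norm_num) (by norm_num), ?_⟩
    simp only [Prod.fst_add, Prod.smul_fst, smul_eq_mul, Prod.snd_add, Prod.smul_snd]
    linarith
  have hPQ : hform (homog P) (homog Q) ≠ 0 := by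
    rw [hform_homog]
    intro h0
    exact hne (eq_of_dot_eq_one hPa.mem hQa.mem (by linarith))
  have hwP := hM.left.pos P hPa.mem
  have hwQ := hM.left.pos Q hQa.mem
  have hMP := hMq P hP
  have hMQ := hMq Q hQ
  have hMmid := hMq _ hmid
  set wP := (M *ᵥ homog P) 2
  set wQ := (M *ᵥ homog Q) 2
  -- The null vectors of P and Q are eigenvectors of M; their Lorentz product is non-zero and
  -- preserved, so the eigenvalues are inverse to each other. Next, the fixed midpoint of P and Q
  -- forces the eigenvalues to be equal, and positivity makes both 1.
  have hw : wP * wQ = 1 := by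
    have h1 := hM.left.form (homog P) (homog Q)
    rw [hMP, hMQ, hform_smul_smul] at h1
    exact mul_right_cancel₀ hPQ (by rw [h1, one_mul])
  have hweq : wP = wQ := by
    have h1 : homog ((1 / 2 : ℝ) • P + (1 / 2 : ℝ) • Q) =
        (1 / 2 : ℝ) • homog P + (1 / 2 : ℝ) • homog Q := by
      ext i; fin_cases i <;> simp [homog]; norm_num
    rw [h1, Matrix.mulVec_add, Matrix.mulVec_smul, Matrix.mulVec_smul, hMP, hMQ] at hMmid
    have e0 := congrFun hMmid 0
    have e1 := congrFun hMmid 1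
    simp only [Pi.add_apply, Pi.smul_apply, smul_eq_mul, homog_zero, homog_two, homog_one] at e0 e1
    rcases hne' with h | h
    · have : (wP - wQ) * (P.1 - Q.1) = 0 := by linear_combination 4 * e0
      linarith [(mul_eq_zero.1 this).resolve_right h]
    · have : (wP - wQ) * (P.2 - Q.2) = 0 := by linear_combination 4 * e1
      linarith [(mul_eq_zero.1 this).resolve_right h]
  have hwP1 : wP = 1 := by
    rw [← hweq] at hw; nlinarith
  have hwQ1 : wQ = 1 := by rw [← hweq, hwP1]
  rw [hwP1, one_smul] at hMP
  rw [hwQ1, one_smul] at hMQ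
  set v := M *ᵥ homog p with hv
  have o1 : hform v (homog P) = hform (homog p) (homog P) := by
    rw [← hM.left.form (homog p), hMP]
  have o2 : hform v (homog Q) = hform (homog p) (homog Q) := by
    rw [← hM.left.form (homog p), hMQ]
  have o3 : hform v v = hform (homog p) (homog p) := hM.left.form _ _
  have habc : 0 < a ^ 2 + b ^ 2 - c ^ 2 := by
    obtain ⟨a', b', c', -, -, q, hq, hqo⟩ := hline
    rw [hl] at hq
    have hq2 := hq.2
    unfold IsOrdinary at hqo
    have hab0 : 0 < a ^ 2 + b ^ 2 := by
      rcases hab with h | h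
      · have := sq_pos_of_ne_zero h; positivity
      · have := sq_pos_of_ne_zero h; positivity
    rw [← hq2]
    nlinarith [sq_nonneg (a * q.2 - b * q.1)]
  -- The displacement v - `homog p` is Lorentz-orthogonal to P and Q, hence a multiple of the
  -- Lorentz normal (a, b, c) of the line.
  obtain ⟨φ, hφ⟩ : ∃ φ : ℝ, v = homog p + φ • ![a, b, c] := by
    simp only [hform, homog_zero, homog_one, homog_two, mul_one] at o1 o2
    have hab0 : a ^ 2 + b ^ 2 ≠ 0 := by nlinarith [sq_nonneg c]
    have hpar : (v 0 - p.1) * b = (v 1 - p.2) * a := by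
      have e1 : (v 0 - p.1) * (P.1 - Q.1) + (v 1 - p.2) * (P.2 - Q.2) = 0 := by
        linear_combination o1 - o2
      have e2 : a * (P.1 - Q.1) + b * (P.2 - Q.2) = 0 := by linear_combination hPl - hQl
      rcases hne' with h | h
      · apply mul_right_cancel₀ h; linear_combination b * e1 - (v 1 - p.2) * e2
      · apply mul_right_cancel₀ h; linear_combination (v 0 - p.1) * e2 - a * e1
    refine ⟨((v 0 - p.1) * a + (v 1 - p.2) * b) / (a ^ 2 + b ^ 2), ?_⟩
    have f0 : v 0 = p.1 + ((v 0 - p.1) * a + (v 1 - p.2) * b) / (a ^ 2 + b ^ 2) * a := by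
      field_simp; linear_combination b * hpar
    have f1 : v 1 = p.2 + ((v 0 - p.1) * a + (v 1 - p.2) * b) / (a ^ 2 + b ^ 2) * b := by
      field_simp; linear_combination -a * hpar
    have f2 : v 2 = 1 + ((v 0 - p.1) * a + (v 1 - p.2) * b) / (a ^ 2 + b ^ 2) * c := by
      linear_combination -o1 + P.1 * f0 + P.2 * f1 +
        ((v 0 - p.1) * a + (v 1 - p.2) * b) / (a ^ 2 + b ^ 2) * hPl
    ext i; fin_cases i
    · simpa using f0
    · simpa using f1
    · simpa using f2
  -- Invariance of the norm is a quadratic equation for φ. The root 0 means that p is fixed, hence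
  -- on the line, where the reflection formula gives the same value.
  have hφ2 : φ * (2 * (a * p.1 + b * p.2 - c) + φ * (a ^ 2 + b ^ 2 - c ^ 2)) = 0 := by
    rw [hφ] at o3
    simp [hform] at o3
    linear_combination o3
  have hfp : f p = dehomog (homog p + φ • ![a, b, c]) := by rw [hfM hp, act, ← hφ]
  rcases mul_eq_zero.1 hφ2 with h | h
  · rw [h, zero_smul, add_zero, dehomog_homog] at hfp
    have hpl : p ∈ l := by rw [← hfix]; exact ⟨hp, hfp⟩
    rw [hl] at hpl
    rw [hpl.2, sub_self, mul_zero, zero_div, zero_smul, sub_zero, dehomog_homog, hfp]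
  · rw [hfp]
    have : φ = - (2 * (a * p.1 + b * p.2 - c) / (a ^ 2 + b ^ 2 - c ^ 2)) := by
      field_simp; linear_combination h
    rw [this, neg_smul, ← sub_eq_add_neg]

/-! ### The coordinate diameters and the lines perpendicular to them -/

/-- The diameter on the first coordinate axis. -/
def axisX : Set (ℝ × ℝ) := {p | p ∈ closedPlane ∧ p.2 = 0}

/-- The diameter on the second coordinate axis. -/
def axisZ : Set (ℝ × ℝ) := {p | p ∈ closedPlane ∧ p.1 = 0}

lemma isHLine_axisX : IsHLine axisX :=
  ⟨0, 1, 0, .inr one_ne_zero, by simp [axisX], 0, ⟨isOrdinary_origin.mem, rfl⟩, isOrdinary_origin⟩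

lemma isHLine_axisZ : IsHLine axisZ :=
  ⟨1, 0, 0, .inl one_ne_zero, by simp [axisZ], 0, ⟨isOrdinary_origin.mem, rfl⟩, isOrdinary_origin⟩

lemma isHIsometry_of_diagonal {s t : ℝ} (hs : s ^ 2 = 1) (ht : t ^ 2 = 1) :
    IsHIsometry (fun p => (s * p.1, t * p.2)) := by
  have hL : IsLorentz (Matrix.diagonal ![s, t, 1]) := by
    refine ⟨fun v w => ?_, fun p _ => ?_⟩
    · simp [hform, Matrix.mulVec_diagonal]
      linear_combination v 0 * w 0 * hs + v 1 * w 1 * ht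
    · simp [Matrix.mulVec_diagonal]
  obtain ⟨N, hN, h1, h2⟩ := hL.exists_inv
  refine LorentzPair.isHIsometry_of_eqOn ⟨hL, hN, h1, h2⟩ fun p _ => ?_
  simp [act, dehomog, Matrix.mulVec_diagonal]

lemma isHReflection_axisX : IsHReflection (fun p => (p.1, -p.2)) axisX := by
  refine ⟨by simpa using isHIsometry_of_diagonal (s := 1) (t := -1) (by norm_num) (by norm_num),
    isHLine_axisX, ?_⟩
  ext p
  refine and_congr_right fun _ => ⟨fun h => ?_, fun h => ?_⟩
  · have := congrArg Prod.snd h; simp only at this; linarith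
  · ext <;> simp [h]

lemma isHReflection_axisZ : IsHReflection (fun p => (-p.1, p.2)) axisZ := by
  refine ⟨by simpa using isHIsometry_of_diagonal (s := -1) (t := 1) (by norm_num) (by norm_num),
    isHLine_axisZ, ?_⟩
  ext p
  refine and_congr_right fun _ => ⟨fun h => ?_, fun h => ?_⟩
  · have := congrArg Prod.fst h; simp only at this; linarith
  · ext <;> simp [h]

lemma isHLine_fst {c : ℝ} (hc : c ^ 2 < 1) : IsHLine {p | p ∈ closedPlane ∧ p.1 = c} := by
  have : IsOrdinary (c, 0) := by simpa [IsOrdinary] using hc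
  exact ⟨1, 0, c, .inl one_ne_zero, by simp, (c, 0), ⟨this.mem, rfl⟩, this⟩

lemma isHLine_snd {c : ℝ} (hc : c ^ 2 < 1) : IsHLine {p | p ∈ closedPlane ∧ p.2 = c} := by
  have : IsOrdinary (0, c) := by simpa [IsOrdinary] using hc
  exact ⟨0, 1, c, .inr one_ne_zero, by simp, (0, c), ⟨this.mem, rfl⟩, this⟩

/-- The reflection is (x, z) ↦ (x, -z), so invariance of the line ax + bz = c gives bz = 0 on it.
Either b = 0, or the line lies in the axis and equals it, which `IsPerp` excludes. -/
lemma isPerp_axisX_iff {m : Set (ℝ × ℝ)} :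
    IsPerp axisX m ↔ ∃ c : ℝ, c ^ 2 < 1 ∧ m = {p | p ∈ closedPlane ∧ p.1 = c} := by
  constructor
  · rintro ⟨hm, hne, f, hf, hfm⟩
    have hfp : ∀ p ∈ closedPlane, f p = (p.1, -p.2) := fun p hp => by
      rw [hf.apply (a := 0) (b := 1) (c := 0) (by simp [axisX]) (by simp) hp]
      ext <;> simp [dehomog]; ring
    have hm2 := hm.subset
    obtain ⟨P, hP, Q, hQ, hPa, hQa, hPQ⟩ := hm.exists_two_asymptotic
    obtain ⟨a, b, c, hab, rfl, q, hq, hqo⟩ := hm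
    have hb : ∀ p ∈ {p : ℝ × ℝ | p ∈ closedPlane ∧ a * p.1 + b * p.2 = c}, b * p.2 = 0 := by
      intro p hp
      have h1 : f p ∈ {p : ℝ × ℝ | p ∈ closedPlane ∧ a * p.1 + b * p.2 = c} := by
        rw [← hfm]; exact ⟨p, hp, rfl⟩
      rw [hfp p hp.1] at h1
      have h2 := h1.2
      have h3 := hp.2
      simp only at h2
      linarith
    have hb0 : b = 0 := by
      by_contra hb0
      have e1 := (mul_eq_zero.1 (hb P hP)).resolve_left hb0
      have e2 := (mul_eq_zero.1 (hb Q hQ)).resolve_left hb0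
      have e3 := hP.2
      have e4 := hQ.2
      rw [e1] at e3
      rw [e2] at e4
      unfold IsAsymptotic at hPa hQa
      have hne1 : P.1 - Q.1 ≠ 0 := fun h => hPQ (Prod.ext (by linarith) (by rw [e1, e2]))
      have ha : a = 0 := by
        apply mul_right_cancel₀ hne1; linarith
      subst ha
      have hc : c = 0 := by linarith
      subst hc
      apply hne
      ext p; simp [axisX, hb0]
    subst hb0
    have ha : a ≠ 0 := hab.resolve_right (by simp)
    have hiff : ∀ p : ℝ × ℝ, a * p.1 + 0 * p.2 = c ↔ p.1 = c / a := by
      intro p; rw [zero_mul, add_zero, eq_div_iff ha, mul_comm]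
    refine ⟨c / a, ?_, by simp only [hiff]⟩
    rw [← (hiff q).1 hq.2]
    unfold IsOrdinary at hqo
    nlinarith [sq_nonneg q.2]
  · rintro ⟨c, hc, rfl⟩
    refine ⟨isHLine_fst hc, ?_, _, isHReflection_axisX, ?_⟩
    · intro h
      have h1 : ((1, 0) : ℝ × ℝ) ∈ axisX := ⟨by simp [mem_closedPlane], rfl⟩
      have h2 : ((0, 0) : ℝ × ℝ) ∈ axisX := ⟨by simp [mem_closedPlane], rfl⟩
      rw [h] at h1 h2
      have := h1.2.trans h2.2.symm
      simp at this
    · ext p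
      constructor
      · rintro ⟨q, hq, rfl⟩; exact ⟨by simpa [mem_closedPlane] using hq.1, hq.2⟩
      · intro hp; exact ⟨(p.1, -p.2), ⟨by simpa [mem_closedPlane] using hp.1, hp.2⟩, by simp⟩

lemma isPerp_axisZ_iff {m : Set (ℝ × ℝ)} :
    IsPerp axisZ m ↔ ∃ c : ℝ, c ^ 2 < 1 ∧ m = {p | p ∈ closedPlane ∧ p.2 = c} := by
  constructor
  · rintro ⟨hm, hne, f, hf, hfm⟩
    have hfp : ∀ p ∈ closedPlane, f p = (-p.1, p.2) := fun p hp => by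
      rw [hf.apply (a := 1) (b := 0) (c := 0) (by simp [axisZ]) (by simp) hp]
      ext <;> simp [dehomog]; ring
    have hm2 := hm.subset
    obtain ⟨P, hP, Q, hQ, hPa, hQa, hPQ⟩ := hm.exists_two_asymptotic
    obtain ⟨a, b, c, hab, rfl, q, hq, hqo⟩ := hm
    have ha : ∀ p ∈ {p : ℝ × ℝ | p ∈ closedPlane ∧ a * p.1 + b * p.2 = c}, a * p.1 = 0 := by
      intro p hp
      have h1 : f p ∈ {p : ℝ × ℝ | p ∈ closedPlane ∧ a * p.1 + b * p.2 = c} := by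
        rw [← hfm]; exact ⟨p, hp, rfl⟩
      rw [hfp p hp.1] at h1
      have h2 := h1.2
      have h3 := hp.2
      simp only at h2
      linarith
    have ha0 : a = 0 := by
      by_contra ha0
      have e1 := (mul_eq_zero.1 (ha P hP)).resolve_left ha0
      have e2 := (mul_eq_zero.1 (ha Q hQ)).resolve_left ha0
      have e3 := hP.2
      have e4 := hQ.2
      rw [e1] at e3
      rw [e2] at e4
      unfold IsAsymptotic at hPa hQa
      have hne1 : P.2 - Q.2 ≠ 0 := fun h => hPQ (Prod.ext (by rw [e1, e2]) (by linarith))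
      have hb : b = 0 := by
        apply mul_right_cancel₀ hne1; linarith
      subst hb
      have hc : c = 0 := by linarith
      subst hc
      apply hne
      ext p; simp [axisZ, ha0]
    subst ha0
    have hb : b ≠ 0 := hab.resolve_left (by simp)
    have hiff : ∀ p : ℝ × ℝ, 0 * p.1 + b * p.2 = c ↔ p.2 = c / b := by
      intro p; rw [zero_mul, zero_add, eq_div_iff hb, mul_comm]
    refine ⟨c / b, ?_, by simp only [hiff]⟩
    rw [← (hiff q).1 hq.2]
    unfold IsOrdinary at hqo
    nlinarith [sq_nonneg q.1]
  · rintro ⟨c, hc, rfl⟩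
    refine ⟨isHLine_snd hc, ?_, _, isHReflection_axisZ, ?_⟩
    · intro h
      have h1 : ((0, 1) : ℝ × ℝ) ∈ axisZ := ⟨by simp [mem_closedPlane], rfl⟩
      have h2 : ((0, 0) : ℝ × ℝ) ∈ axisZ := ⟨by simp [mem_closedPlane], rfl⟩
      rw [h] at h1 h2
      have := h1.2.trans h2.2.symm
      simp at this
    · ext p
      constructor
      · rintro ⟨q, hq, rfl⟩; exact ⟨by simpa [mem_closedPlane] using hq.1, hq.2⟩
      · intro hp; exact ⟨(-p.1, p.2), ⟨by simpa [mem_closedPlane] using hp.1, hp.2⟩, by simp⟩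

/-! ### Axially symmetric ellipses centred at the origin -/

/-- The possibly degenerate elliptical disk with semi-axes `a` and `b`. -/
def centralEllipse (a b : ℝ) : Set (ℝ × ℝ) := (fun p : ℝ × ℝ => (a * p.1, b * p.2)) '' closedPlane

lemma mem_centralEllipse {a b : ℝ} {p : ℝ × ℝ} :
    p ∈ centralEllipse a b ↔ ∃ u v : ℝ, u ^ 2 + v ^ 2 ≤ 1 ∧ p = (a * u, b * v) := by
  constructor
  · rintro ⟨q, hq, rfl⟩; exact ⟨q.1, q.2, hq, rfl⟩
  · rintro ⟨u, v, h, rfl⟩; exact ⟨(u, v), h, rfl⟩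

lemma centralEllipse_le {a b : ℝ} (hb : 0 ≤ b) (hab : b ≤ a) {p : ℝ × ℝ}
    (hp : p ∈ centralEllipse a b) : p.1 ^ 2 + p.2 ^ 2 ≤ a ^ 2 := by
  obtain ⟨u, v, h, rfl⟩ := mem_centralEllipse.1 hp
  have : b ^ 2 ≤ a ^ 2 := by gcongr
  nlinarith [mul_nonneg (sub_nonneg.2 this) (sq_nonneg v), sq_nonneg a]

lemma centralEllipse_subset {a b : ℝ} (hb : 0 ≤ b) (hab : b ≤ a) (ha : a ≤ 1) :
    centralEllipse a b ⊆ closedPlane := by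
  intro p hp
  have := centralEllipse_le hb hab hp
  rw [mem_closedPlane]
  nlinarith

lemma convex_centralEllipse (a b : ℝ) : Convex ℝ (centralEllipse a b) := by
  have : IsLinearMap ℝ (fun p : ℝ × ℝ => (a * p.1, b * p.2)) :=
    ⟨fun x y => by ext <;> simp [mul_add], fun c x => by ext <;> simp [mul_left_comm]⟩
  exact convex_closedPlane.is_linear_image this

lemma left_mem_centralEllipse (a b : ℝ) : (-a, 0) ∈ centralEllipse a b :=
  mem_centralEllipse.2 ⟨-1, 0, by norm_num, by simp⟩

lemma right_mem_centralEllipse (a b : ℝ) : (a, 0) ∈ centralEllipse a b :=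
  mem_centralEllipse.2 ⟨1, 0, by norm_num, by simp⟩

section Bounded

variable {a b : ℝ}

lemma isOrdinary_of_mem_centralEllipse (hb : 0 ≤ b) (hab : b ≤ a) (ha : a < 1) {p : ℝ × ℝ}
    (hp : p ∈ centralEllipse a b) : IsOrdinary p := by
  have := centralEllipse_le hb hab hp
  unfold IsOrdinary; nlinarith

lemma hdist_zero_eq {p : ℝ × ℝ} {a : ℝ} (ha0 : 0 ≤ a) (ha : a < 1) (hp : IsOrdinary p) :
    hdist 0 p = ENNReal.ofReal (Real.artanh a) ↔ p.1 ^ 2 + p.2 ^ 2 = a ^ 2 := by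
  have h0 : 0 ≤ p.1 ^ 2 + p.2 ^ 2 := by positivity
  have ha2 : a ^ 2 < 1 := by nlinarith
  rw [hdist_ordinary isOrdinary_origin hp, coshDist_zero_left, ← arcosh_one_div_sqrt ha0 ha,
    ofReal_arcosh_inj (one_le_one_div_sqrt h0 hp) (one_le_one_div_sqrt (sq_nonneg a) ha2),
    one_div, one_div, inv_inj, Real.sqrt_inj (sub_nonneg.2 hp.le) (by linarith)]
  constructor <;> intro h <;> linarith

lemma hdist_zero_le {p : ℝ × ℝ} {a : ℝ} (ha0 : 0 ≤ a) (ha : a < 1) (hp : IsOrdinary p) :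
    hdist 0 p ≤ ENNReal.ofReal (Real.artanh a) ↔ p.1 ^ 2 + p.2 ^ 2 ≤ a ^ 2 := by
  have h0 : 0 ≤ p.1 ^ 2 + p.2 ^ 2 := by positivity
  have ha2 : a ^ 2 < 1 := by nlinarith
  have hs : 0 < 1 - (p.1 ^ 2 + p.2 ^ 2) := sub_pos.2 hp
  rw [hdist_ordinary isOrdinary_origin hp, coshDist_zero_left, ← arcosh_one_div_sqrt ha0 ha,
    ofReal_arcosh_le (one_le_one_div_sqrt h0 hp) (one_le_one_div_sqrt (sq_nonneg a) ha2),
    one_div_le_one_div (Real.sqrt_pos.2 hs) (Real.sqrt_pos.2 (by linarith)),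
    Real.sqrt_le_sqrt_iff hs.le]
  constructor <;> intro h <;> linarith

/-- A disk containing the end points of the major axis has radius at least `artanh a`, and it is
centred at the origin in case of equality. -/
lemma artanh_le_radius (ha0 : 0 ≤ a) (ha : a < 1) {C : ℝ × ℝ} (hC : IsOrdinary C) {r : ℝ≥0∞}
    (h1 : hdist C (a, 0) ≤ r) (h2 : hdist C (-a, 0) ≤ r) :
    ENNReal.ofReal (Real.artanh a) ≤ r ∧ (r = ENNReal.ofReal (Real.artanh a) → C = 0) := by
  have ha2 : a ^ 2 < 1 := by nlinarith
  have o1 : IsOrdinary (a, 0) := by simpa [IsOrdinary] using ha2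
  have o2 : IsOrdinary (-a, 0) := by simpa [IsOrdinary] using ha2
  rw [hdist_ordinary hC o1] at h1
  rw [hdist_ordinary hC o2] at h2
  have hCs : 0 < 1 - C.1 ^ 2 - C.2 ^ 2 := by unfold IsOrdinary at hC; linarith
  have hs := Real.sqrt_pos.2 hCs
  have hsa : 0 < √(1 - a ^ 2) := Real.sqrt_pos.2 (by linarith)
  have hs1 : √(1 - C.1 ^ 2 - C.2 ^ 2) ≤ 1 := Real.sqrt_le_one.2 (by nlinarith [sq_nonneg C.1, sq_nonneg C.2])
  -- The mean of the two hyperbolic cosines is cosh(artanh a) / √(1 - |C|²). So the larger one is at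
  -- least cosh(artanh a), and both can be at most that only for C = 0.
  have hsum : coshDist C (a, 0) + coshDist C (-a, 0) =
      2 * (1 / √(1 - a ^ 2)) * (1 / √(1 - C.1 ^ 2 - C.2 ^ 2)) := by
    simp only [coshDist, neg_sq]
    norm_num
    field_simp
    ring
  have hge : 1 ≤ 1 / √(1 - C.1 ^ 2 - C.2 ^ 2) := by rwa [le_div_iff₀ hs, one_mul]
  have hk := one_le_one_div_sqrt (sq_nonneg a) ha2
  rw [← arcosh_one_div_sqrt ha0 ha]
  constructor
  · by_contra hlt
    push Not at hlt
    have e1 := h1.trans_lt hlt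
    have e2 := h2.trans_lt hlt
    rw [← not_le, ofReal_arcosh_le hk (one_le_coshDist hC o1), not_le] at e1
    rw [← not_le, ofReal_arcosh_le hk (one_le_coshDist hC o2), not_le] at e2
    nlinarith
  · rintro rfl
    rw [ofReal_arcosh_le (one_le_coshDist hC o1) hk] at h1
    rw [ofReal_arcosh_le (one_le_coshDist hC o2) hk] at h2
    have h3 : 1 / √(1 - C.1 ^ 2 - C.2 ^ 2) ≤ 1 := by
      by_contra hcon
      push Not at hcon
      nlinarith
    rw [div_le_iff₀ hs, one_mul, Real.one_le_sqrt] at h3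
    have e1 : C.1 = 0 := by nlinarith [sq_nonneg C.1, sq_nonneg C.2]
    have e2 : C.2 = 0 := by nlinarith [sq_nonneg C.1, sq_nonneg C.2]
    exact Prod.ext e1 e2

lemma hdist_neg_self_div_two {R : ℝ × ℝ} {u : ℝ} (h0 : 0 ≤ u) (h1 : u < 1)
    (hR : R.1 ^ 2 + R.2 ^ 2 = u ^ 2) : hdist (-R) R / 2 = ENNReal.ofReal (Real.artanh u) := by
  have hu : u ^ 2 < 1 := by nlinarith
  have hRo : IsOrdinary R := by unfold IsOrdinary; linarith
  have hRo' : IsOrdinary (-R) := by simpa [IsOrdinary] using hRo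
  refine hdist_div_two hRo' hRo h0 h1 ?_
  simp only [coshDist, Prod.fst_neg, Prod.snd_neg, neg_sq]
  rw [Real.mul_self_sqrt (by linarith)]
  congr 1 <;> linarith

lemma isMajorAxis_centralEllipse (hb : 0 ≤ b) (hab : b ≤ a) (ha : a < 1) :
    IsMajorAxis (centralEllipse a b) (-a, 0) (a, 0) := by
  have ha0 := hb.trans hab
  have hS := fun p => isOrdinary_of_mem_centralEllipse (p := p) hb hab ha
  refine .bounded _ _ 0 (ENNReal.ofReal (Real.artanh a)) hS isOrdinary_origin ?_ ?_ ?_ ?_ ?_ ?_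
  · intro p hp
    rw [hdist_zero_le ha0 ha (hS p hp)]; exact centralEllipse_le hb hab hp
  · intro C r hC hr
    exact (artanh_le_radius ha0 ha hC (hr _ (right_mem_centralEllipse a b))
      (hr _ (left_mem_centralEllipse a b))).1
  · exact (convex_centralEllipse a b).segment_subset (left_mem_centralEllipse a b)
      (right_mem_centralEllipse a b)
  · rw [hdist_zero_eq ha0 ha (hS _ (left_mem_centralEllipse a b))]; simp
  · rw [hdist_zero_eq ha0 ha (hS _ (right_mem_centralEllipse a b))]; simp
  · have := hdist_neg_self_div_two (R := (a, 0)) ha0 ha (by simp)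
    rw [← this, show -((a, 0) : ℝ × ℝ) = (-a, 0) by simp]
    exact (ENNReal.mul_div_cancel (by norm_num) (by norm_num)).symm

/-- The major axes of a bounded central ellipse are the longest diameters. -/
lemma IsMajorAxis.of_centralEllipse (hb : 0 ≤ b) (hab : b ≤ a) (ha : a < 1) {P Q : ℝ × ℝ}
    (h : IsMajorAxis (centralEllipse a b) P Q) :
    Q = -P ∧ P.1 ^ 2 + P.2 ^ 2 = a ^ 2 ∧ P ∈ centralEllipse a b := by
  have ha0 := hb.trans hab
  have hS := fun p => isOrdinary_of_mem_centralEllipse (p := p) hb hab ha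
  have hPm := h.mem.1
  have hQm := h.mem.2
  have hPo := hS _ hPm
  have hQo := hS _ hQm
  rcases h with ⟨_, C, r, -, hC, hball, hmin, hPQ, hP, hQ, hd⟩ | ⟨_, hP, -, -, hPQ⟩ |
    ⟨_, l, hP, huniq, hne, hl, hPQ⟩ | ⟨hP, -⟩
  · obtain ⟨h1, h2⟩ := artanh_le_radius ha0 ha hC (hball _ (right_mem_centralEllipse a b))
      (hball _ (left_mem_centralEllipse a b))
    have hr : r = ENNReal.ofReal (Real.artanh a) := by
      refine le_antisymm (hmin 0 _ isOrdinary_origin fun p hp => ?_) h1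
      rw [hdist_zero_le ha0 ha (hS p hp)]; exact centralEllipse_le hb hab hp
    obtain rfl := h2 hr
    rw [hr] at hP hQ hd
    rw [hdist_zero_eq ha0 ha hPo] at hP
    rw [hdist_zero_eq ha0 ha hQo] at hQ
    refine ⟨?_, hP, hPm⟩
    have h3 := hdist_neg_self_div_two (R := (a, 0)) ha0 ha (by simp)
    have ha2 : a ^ 2 < 1 := by nlinarith
    rw [hdist_ordinary hPo hQo, ← ENNReal.ofReal_ofNat 2, ← ENNReal.ofReal_mul (by norm_num),
      ← arcosh_double ha0 ha, ofReal_arcosh_inj (one_le_coshDist hPo hQo)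
      (by rw [le_div_iff₀ (by linarith)]; nlinarith), coshDist,
      show 1 - P.1 ^ 2 - P.2 ^ 2 = 1 - a ^ 2 by linarith,
      show 1 - Q.1 ^ 2 - Q.2 ^ 2 = 1 - a ^ 2 by linarith, Real.mul_self_sqrt (by linarith),
      div_left_inj' (by linarith)] at hd
    -- With |P| = |Q| = a, distance 2 artanh a means P·Q = -a², that is, |P + Q|² = 0.
    have e1 : (P.1 + Q.1) ^ 2 + (P.2 + Q.2) ^ 2 = 0 := by linear_combination hP + hQ - 2 * hd
    have e2 : P.1 + Q.1 = 0 := by nlinarith [sq_nonneg (P.1 + Q.1), sq_nonneg (P.2 + Q.2)]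
    have e3 : P.2 + Q.2 = 0 := by nlinarith [sq_nonneg (P.1 + Q.1), sq_nonneg (P.2 + Q.2)]
    ext
    · simp only [Prod.fst_neg]; linarith
    · simp only [Prod.snd_neg]; linarith
  · exact absurd hPo hP.not_isOrdinary
  · exact absurd hPo hP.not_isOrdinary
  · exact absurd hPo hP.not_isOrdinary

lemma isMajorSemiAxisLength_centralEllipse (hb : 0 ≤ b) (hab : b ≤ a) (ha : a < 1) (s : ℝ≥0∞) :
    IsMajorSemiAxisLength (centralEllipse a b) s ↔ s = artanhExt a := by
  rw [artanhExt_of_lt ha]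
  have ha0 := hb.trans hab
  constructor
  · rintro ⟨P, Q, hPQ, rfl⟩
    obtain ⟨rfl, h1, -⟩ := hPQ.of_centralEllipse hb hab ha
    rw [hdist_comm, hdist_neg_self_div_two ha0 ha h1]
  · rintro rfl
    refine ⟨_, _, isMajorAxis_centralEllipse hb hab ha, ?_⟩
    rw [← hdist_neg_self_div_two (R := (a, 0)) ha0 ha (by simp)]
    simp

/-- P and -P are equally far from the origin, so the denominators agree and the bisector is a
Euclidean perpendicular through the centre. -/
lemma hdist_eq_hdist_neg {p P : ℝ × ℝ} (hp : IsOrdinary p) (hP : IsOrdinary P) :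
    hdist p P = hdist p (-P) ↔ p.1 * P.1 + p.2 * P.2 = 0 := by
  have hP' : IsOrdinary (-P) := by simpa [IsOrdinary] using hP
  rw [hdist_ordinary hp hP, hdist_ordinary hp hP', ofReal_arcosh_inj (one_le_coshDist hp hP)
    (one_le_coshDist hp hP')]
  unfold IsOrdinary at hp hP
  have h1 : 0 < √(1 - p.1 ^ 2 - p.2 ^ 2) := Real.sqrt_pos.2 (by linarith)
  have h2 : 0 < √(1 - P.1 ^ 2 - P.2 ^ 2) := Real.sqrt_pos.2 (by linarith)
  simp only [coshDist, Prod.fst_neg, Prod.snd_neg, neg_sq]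
  rw [div_left_inj' (by positivity)]
  constructor <;> intro h <;> linarith

/-- The section of a central ellipse by the perpendicular bisector of a major axis. -/
lemma centralEllipse_inter_bisector (hb : 0 ≤ b) (hab : b ≤ a) (ha : a < 1) {P : ℝ × ℝ}
    (hPm : P ∈ centralEllipse a b) (hP : P.1 ^ 2 + P.2 ^ 2 = a ^ 2) :
    ∃ R : ℝ × ℝ, R.1 ^ 2 + R.2 ^ 2 = b ^ 2 ∧
      centralEllipse a b ∩ {p | IsOrdinary p ∧ hdist p P = hdist p (-P)} = segment ℝ (-R) R := by
  have ha0 := hb.trans hab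
  have hS := fun p => isOrdinary_of_mem_centralEllipse (p := p) hb hab ha
  rcases ha0.eq_or_lt with h | h
  · subst h
    obtain rfl : b = 0 := le_antisymm hab hb
    refine ⟨0, by simp, ?_⟩
    have h0 : centralEllipse 0 0 = {0} := by
      ext p; rw [mem_centralEllipse]
      constructor
      · rintro ⟨u, v, -, rfl⟩; simp
      · rintro rfl; exact ⟨0, 0, by norm_num, by ext <;> simp⟩
    rw [h0] at hPm ⊢
    rw [Set.mem_singleton_iff] at hPm
    subst hPm
    simp [isOrdinary_origin]
  have hPo := hS P hPm
  obtain ⟨u, v, huv, rfl⟩ := mem_centralEllipse.1 hPm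
  simp only at hP
  -- Since |P| = a, either the ellipse is a round disk (a = b) or P is on the first axis (v = 0).
  -- The equation bv = av covers both cases at once.
  have hbv : b * v = a * v := by
    have h1 : (a - b) * (a + b) * v ^ 2 = a ^ 2 * (u ^ 2 + v ^ 2 - 1) := by linear_combination -hP
    have h2 : (a - b) * ((a + b) * v ^ 2) ≤ 0 := by
      rw [← mul_assoc, h1]; exact mul_nonpos_of_nonneg_of_nonpos (sq_nonneg a) (by linarith)
    have h3 : 0 < a + b := by linarith
    have h4 : (a - b) * ((a + b) * v ^ 2) = 0 :=
      le_antisymm h2 (mul_nonneg (by linarith) (mul_nonneg h3.le (sq_nonneg v)))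
    rcases mul_eq_zero.1 h4 with h5 | h5
    · rw [sub_eq_zero.1 h5]
    · have := pow_eq_zero_iff (two_ne_zero) |>.1 ((mul_eq_zero.1 h5).resolve_left h3.ne')
      rw [this]; ring
  have huv1 : u ^ 2 + v ^ 2 = 1 := by
    have : a ^ 2 * (u ^ 2 + v ^ 2 - 1) = 0 := by
      linear_combination hP - (b * v + a * v) * hbv
    have := (mul_eq_zero.1 this).resolve_left (by positivity)
    linarith
  -- R is orthogonal to P = (au, bv) and has length b: it is P turned by a right angle if a = b, and
  -- (0, ±b) if v = 0.
  refine ⟨(-(a * v), b * u), ?_, ?_⟩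
  · simp only
    linear_combination b ^ 2 * huv1 - (b * v + a * v) * hbv
  ext p
  rw [mem_segment_neg]
  constructor
  · rintro ⟨hp, hpo, hpd⟩
    rw [hdist_eq_hdist_neg hpo hPo] at hpd
    obtain ⟨x, y, hxy, rfl⟩ := mem_centralEllipse.1 hp
    simp only at hpd
    have h1 : u * x + v * y = 0 := by
      have : a ^ 2 * (u * x + v * y) = 0 := by linear_combination hpd - (a * y + b * y) * hbv
      exact (mul_eq_zero.1 this).resolve_left (by positivity)
    refine ⟨u * y - v * x, ?_, ?_⟩
    · nlinarith
    · ext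
      · simp only [Prod.smul_fst, smul_eq_mul]
        linear_combination (-a * x) * huv1 + a * u * h1
      · simp only [Prod.smul_snd, smul_eq_mul]
        linear_combination (-b * y) * huv1 + b * v * h1
  · rintro ⟨t, ht, rfl⟩
    have hm : t • ((-(a * v), b * u) : ℝ × ℝ) ∈ centralEllipse a b := by
      refine mem_centralEllipse.2 ⟨t * (-v), t * u, ?_, ?_⟩
      · nlinarith
      · ext <;> simp <;> ring
    refine ⟨hm, hS _ hm, ?_⟩
    rw [hdist_eq_hdist_neg (hS _ hm) hPo]
    simp only [Prod.smul_fst, smul_eq_mul, Prod.smul_snd]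
    linear_combination t * u * (a + b) * hbv

lemma isMinorSemiAxisLength_centralEllipse (hb : 0 ≤ b) (hab : b ≤ a) (ha : a < 1) (s : ℝ≥0∞) :
    IsMinorSemiAxisLength (centralEllipse a b) s ↔ s = artanhExt b := by
  have hb1 := hab.trans_lt ha
  rw [artanhExt_of_lt hb1]
  have hS := fun p => isOrdinary_of_mem_centralEllipse (p := p) hb hab ha
  constructor
  · rintro (⟨P, Q, s, -, hPQ, hs⟩ | ⟨P, Q, m, s, hP, hQ, hne, hPQ, hm, hs⟩ | ⟨⟨P, c, hP, hc, hS'⟩⟩ |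
      ⟨P, Q, l, hP, huniq, hne, -, hl, hPQ⟩ | ⟨P, hP, hS'⟩)
    · obtain ⟨rfl, h1, h2⟩ := hPQ.of_centralEllipse hb hab ha
      obtain ⟨R, hR, hsec⟩ := centralEllipse_inter_bisector hb hab ha h2 h1
      rw [(isHalfSectionLength_iff hsec s).1 hs, hdist_neg_self_div_two hb hb1 hR]
    · exact absurd (hS P hPQ.mem.1) hP.not_isOrdinary
    · refine absurd (hS P ?_) hP.not_isOrdinary
      rw [hS']
      unfold IsAsymptotic at hP
      simp only [Set.mem_ofPred_eq]
      rw [← sq, ← sq, hP]; simp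
    · exact absurd (hS P (hPQ.symm.subset (left_mem_segment ℝ P Q)).1) hP.not_isOrdinary
    · exact absurd (hS P (by rw [hS']; rfl)) hP.not_isOrdinary
  · rintro rfl
    have hPQ := isMajorAxis_centralEllipse hb hab ha
    obtain ⟨h0, h1, h2⟩ := hPQ.of_centralEllipse hb hab ha
    obtain ⟨R, hR, hsec⟩ := centralEllipse_inter_bisector hb hab ha h2 h1
    refine .bounded _ _ _ hS hPQ ?_
    rw [← h0] at hsec
    rw [isHalfSectionLength_iff hsec, hdist_neg_self_div_two hb hb1 hR]

end Bounded

lemma IsHorodisk.asymptotic_unique {S : Set (ℝ × ℝ)} (hS : IsHorodisk S) {p q : ℝ × ℝ}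
    (hp : p ∈ S) (hq : q ∈ S) (hpa : IsAsymptotic p) (hqa : IsAsymptotic q) : p = q := by
  obtain ⟨P, c, hP, hc, rfl⟩ := hS
  have key : ∀ p ∈ {p : ℝ × ℝ | p.1 ^ 2 + p.2 ^ 2 - 1 + c * (1 - (p.1 * P.1 + p.2 * P.2)) ^ 2 ≤ 0},
      IsAsymptotic p → p = P := by
    intro p hp hpa
    have hp' : p.1 ^ 2 + p.2 ^ 2 - 1 + c * (1 - (p.1 * P.1 + p.2 * P.2)) ^ 2 ≤ 0 := hp
    apply eq_of_dot_eq_one hpa.mem hP.mem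
    unfold IsAsymptotic at hpa
    rw [hpa, sub_self, zero_add] at hp'
    have h1 : (1 - (p.1 * P.1 + p.2 * P.2)) ^ 2 = 0 :=
      le_antisymm (nonpos_of_mul_nonpos_right hp' hc) (sq_nonneg _)
    have := pow_eq_zero_iff (two_ne_zero) |>.1 h1
    linarith
  rw [key p hp hpa, key q hq hqa]

lemma horodisk_center_mem {P : ℝ × ℝ} (hP : IsAsymptotic P) (c : ℝ) :
    P ∈ {p : ℝ × ℝ | p.1 ^ 2 + p.2 ^ 2 - 1 + c * (1 - (p.1 * P.1 + p.2 * P.2)) ^ 2 ≤ 0} := by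
  unfold IsAsymptotic at hP
  simp only [Set.mem_ofPred_eq]
  rw [← sq, ← sq, hP]; simp

/-! ### Bands around the first axis -/

section Band

variable {b : ℝ}

lemma mem_band {p : ℝ × ℝ} (hb : 0 ≤ b) :
    p ∈ centralEllipse 1 b ↔ p.1 ^ 2 ≤ 1 ∧ p.2 ^ 2 ≤ b ^ 2 * (1 - p.1 ^ 2) := by
  rw [mem_centralEllipse]
  constructor
  · rintro ⟨u, v, huv, rfl⟩
    simp only [one_mul]
    exact ⟨by nlinarith [sq_nonneg v], by nlinarith [mul_nonneg (sq_nonneg b) (sub_nonneg.2 huv)]⟩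
  · rintro ⟨h1, h2⟩
    rcases hb.eq_or_lt with h | h
    · subst h
      refine ⟨p.1, 0, by linarith, Prod.ext (by simp) ?_⟩
      have : p.2 ^ 2 = 0 := le_antisymm (by linarith) (sq_nonneg _)
      simpa using this
    · refine ⟨p.1, p.2 / b, ?_, Prod.ext (by simp) ?_⟩
      · have h3 : (p.2 / b) ^ 2 ≤ 1 - p.1 ^ 2 := by
          rw [div_pow, div_le_iff₀ (by positivity)]; linarith
        linarith
      · simp only; field_simp

lemma asymptotic_of_mem_band (hb : 0 ≤ b) (hb1 : b < 1) {p : ℝ × ℝ}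
    (hp : p ∈ centralEllipse 1 b) (hpa : IsAsymptotic p) : p = (-1, 0) ∨ p = (1, 0) := by
  obtain ⟨h1, h2⟩ := (mem_band hb).1 hp
  unfold IsAsymptotic at hpa
  have h3 : (1 - b ^ 2) * p.2 ^ 2 ≤ 0 := by nlinarith
  have h4 : 0 < 1 - b ^ 2 := by nlinarith
  have h5 : p.2 ^ 2 = 0 := le_antisymm (nonpos_of_mul_nonpos_right h3 h4) (sq_nonneg _)
  have h6 : p.2 = 0 := by simpa using h5
  rw [h5, add_zero] at hpa
  rcases mul_self_eq_one_iff.1 ((sq p.1).symm.trans hpa) with h | h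
  · right; exact Prod.ext h h6
  · left; exact Prod.ext h h6

lemma isAsymptotic_left : IsAsymptotic (-1, 0) := by norm_num [IsAsymptotic]

lemma isAsymptotic_right : IsAsymptotic (1, 0) := by norm_num [IsAsymptotic]

lemma segment_eq_axisX : segment ℝ ((-1, 0) : ℝ × ℝ) (1, 0) = axisX := by
  ext p
  rw [show ((-1, 0) : ℝ × ℝ) = -(1, 0) by simp, mem_segment_neg]
  constructor
  · rintro ⟨t, ht, rfl⟩
    exact ⟨by simpa [mem_closedPlane] using ht, by simp⟩
  · rintro ⟨h1, h2⟩
    rw [mem_closedPlane, h2] at h1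
    exact ⟨p.1, by linarith, Prod.ext (by simp) (by simp [h2])⟩

lemma segment_of_band_asymptotic (hb : 0 ≤ b) (hb1 : b < 1) {P Q : ℝ × ℝ}
    (hP : P ∈ centralEllipse 1 b) (hQ : Q ∈ centralEllipse 1 b) (hPa : IsAsymptotic P)
    (hQa : IsAsymptotic Q) (hne : P ≠ Q) : segment ℝ P Q = axisX := by
  rcases asymptotic_of_mem_band hb hb1 hP hPa with rfl | rfl <;>
    rcases asymptotic_of_mem_band hb hb1 hQ hQa with rfl | rfl
  · exact absurd rfl hne
  · exact segment_eq_axisX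
  · rw [segment_symm]; exact segment_eq_axisX
  · exact absurd rfl hne

lemma left_ne_right : ((-1, 0) : ℝ × ℝ) ≠ (1, 0) := by
  intro h; have := congrArg Prod.fst h; norm_num at this

lemma isMajorAxis_band (b : ℝ) : IsMajorAxis (centralEllipse 1 b) (-1, 0) (1, 0) :=
  .line _ _ isAsymptotic_left isAsymptotic_right left_ne_right
    ((convex_centralEllipse 1 b).segment_subset (left_mem_centralEllipse 1 b)
      (right_mem_centralEllipse 1 b))

lemma isMajorSemiAxisLength_band (b : ℝ) (s : ℝ≥0∞) :
    IsMajorSemiAxisLength (centralEllipse 1 b) s ↔ s = artanhExt 1 := by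
  rw [artanhExt_one]
  have hl := left_mem_centralEllipse 1 b
  have hr := right_mem_centralEllipse 1 b
  constructor
  · rintro ⟨P, Q, ⟨_, C, r, hS, -, -, -, -, -, -, -⟩ | ⟨_, hP, hQ, hne, hPQ⟩ |
      ⟨_, l, hP, huniq, hne, hl, hPQ⟩ | ⟨hP, hS⟩, rfl⟩
    · exact absurd (hS _ hr) isAsymptotic_right.not_isOrdinary
    · rw [hdist_eq_top_left hP hne, ENNReal_top_div_two]
    · rw [hdist_eq_top_left hP hne, ENNReal_top_div_two]
    · rw [hS] at hl hr
      exact absurd (Eq.trans hl hr.symm) left_ne_right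
  · rintro rfl
    refine ⟨_, _, isMajorAxis_band b, ?_⟩
    rw [hdist_eq_top_left isAsymptotic_left left_ne_right, ENNReal_top_div_two]

lemma mem_segment_horizontal {x₀ k : ℝ} (h0 : 0 ≤ x₀) {p : ℝ × ℝ} :
    p ∈ segment ℝ ((-x₀, k) : ℝ × ℝ) (x₀, k) ↔ p.1 ^ 2 ≤ x₀ ^ 2 ∧ p.2 = k := by
  constructor
  · rintro ⟨a, b, ha, hb, hab, rfl⟩
    obtain rfl : a = 1 - b := by linarith
    simp only [Prod.fst_add, Prod.smul_fst, smul_eq_mul, Prod.snd_add, Prod.smul_snd]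
    exact ⟨by nlinarith [mul_nonneg (mul_nonneg ha hb) (sq_nonneg x₀)], by ring⟩
  · rintro ⟨h1, h2⟩
    have h3 := abs_le.1 (abs_le_of_sq_le_sq h1 h0)
    rcases h0.eq_or_lt with h | h
    · subst h
      have : p = (0, k) := Prod.ext (by simp only; linarith [h3.1, h3.2]) h2
      simp [this]
    · refine ⟨(x₀ - p.1) / (2 * x₀), (x₀ + p.1) / (2 * x₀),
        div_nonneg (by linarith) (by linarith), div_nonneg (by linarith) (by linarith),
        by field_simp; ring, Prod.ext ?_ ?_⟩
      · simp; field_simp; ring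
      · simp; rw [h2]; field_simp; ring

lemma mem_segment_vertical {z₀ k : ℝ} (h0 : 0 ≤ z₀) {p : ℝ × ℝ} :
    p ∈ segment ℝ ((k, -z₀) : ℝ × ℝ) (k, z₀) ↔ p.2 ^ 2 ≤ z₀ ^ 2 ∧ p.1 = k := by
  have := mem_segment_horizontal h0 (k := k) (p := (p.2, p.1))
  simp only at this
  rw [← this]
  constructor <;> rintro ⟨a, b, ha, hb, hab, h⟩ <;> refine ⟨a, b, ha, hb, hab, ?_⟩
  · rw [← h]; simp
  · have h1 := congrArg Prod.fst h
    have h2 := congrArg Prod.snd h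
    exact Prod.ext (by simpa using h2) (by simpa using h1)

/-- The section at abscissa c ends at (c, ±b√(1 - c²)); in the distance formula c cancels, so all
perpendicular sections have the same length. -/
lemma isHalfSectionLength_band (hb : 0 ≤ b) (hb1 : b < 1) {c : ℝ} (hc : c ^ 2 < 1) (s : ℝ≥0∞) :
    IsHalfSectionLength (centralEllipse 1 b) {p | p ∈ closedPlane ∧ p.1 = c} s ↔
      s = ENNReal.ofReal (Real.artanh b) := by
  have hb2 : b ^ 2 < 1 := by nlinarith
  have hs0 : 0 ≤ b * √(1 - c ^ 2) := by positivity
  have hs2 : (b * √(1 - c ^ 2)) ^ 2 = b ^ 2 * (1 - c ^ 2) := by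
    rw [mul_pow, Real.sq_sqrt (by linarith)]
  have hsec : centralEllipse 1 b ∩ {p | p ∈ closedPlane ∧ p.1 = c} =
      segment ℝ (c, -(b * √(1 - c ^ 2))) (c, b * √(1 - c ^ 2)) := by
    ext p
    rw [mem_segment_vertical hs0, hs2]
    constructor
    · rintro ⟨h1, -, h2⟩
      rw [mem_band hb, h2] at h1
      exact ⟨h1.2, h2⟩
    · rintro ⟨h1, h2⟩
      have h3 : p ∈ centralEllipse 1 b := by rw [mem_band hb, h2]; exact ⟨hc.le, h1⟩
      exact ⟨h3, centralEllipse_subset hb hb1.le le_rfl h3, h2⟩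
  have hlt : c ^ 2 + b ^ 2 * (1 - c ^ 2) < 1 := by nlinarith
  have o1 : IsOrdinary (c, -(b * √(1 - c ^ 2))) := by
    simp only [IsOrdinary, neg_sq, hs2]; exact hlt
  have o2 : IsOrdinary (c, b * √(1 - c ^ 2)) := by
    simp only [IsOrdinary, hs2]; exact hlt
  rw [isHalfSectionLength_iff hsec, hdist_div_two o1 o2 hb hb1]
  simp only [coshDist, neg_sq, hs2]
  rw [Real.mul_self_sqrt (by linarith), div_eq_div_iff (by linarith) (by linarith)]
  linear_combination (1 - b ^ 2) * hs2

lemma isMinorSemiAxisLength_band (hb : 0 ≤ b) (hb1 : b < 1) (s : ℝ≥0∞) :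
    IsMinorSemiAxisLength (centralEllipse 1 b) s ↔ s = artanhExt b := by
  rw [artanhExt_of_lt hb1]
  have hl := left_mem_centralEllipse 1 b
  have hr := right_mem_centralEllipse 1 b
  constructor
  · rintro (⟨P, Q, s, hS, -, -⟩ | ⟨P, Q, m, s, hP, hQ, hne, hPQ, hm, hs⟩ | ⟨hS⟩ |
      ⟨P, Q, l, hP, huniq, hne, -, -, -⟩ | ⟨P, hP, hS⟩)
    · exact absurd (hS _ hr) isAsymptotic_right.not_isOrdinary
    · rw [segment_of_band_asymptotic hb hb1 hPQ.mem.1 hPQ.mem.2 hP hQ hne] at hm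
      obtain ⟨c, hc, rfl⟩ := isPerp_axisX_iff.1 hm
      exact (isHalfSectionLength_band hb hb1 hc s).1 hs
    · exact absurd (hS.asymptotic_unique hl hr isAsymptotic_left isAsymptotic_right) left_ne_right
    · exact absurd ((huniq _ hl isAsymptotic_left).trans (huniq _ hr isAsymptotic_right).symm)
        left_ne_right
    · rw [hS] at hl hr
      exact absurd (Eq.trans hl hr.symm) left_ne_right
  · rintro rfl
    refine .line _ _ {p | p ∈ closedPlane ∧ p.1 = 0} _ isAsymptotic_left isAsymptotic_right
      left_ne_right (isMajorAxis_band b) ?_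
      ((isHalfSectionLength_band hb hb1 (c := 0) (by norm_num) _).2 rfl)
    rw [segment_eq_axisX]
    exact isPerp_axisX_iff.2 ⟨0, by norm_num, rfl⟩

/-- The foot of the perpendicular from (x, z) to the axis is (x, 0), at a distance with hyperbolic
cosine √(1 - x²)/√(1 - x² - z²). Bounding this by cosh(artanh b) is the inequality z² ≤ b²(1 - x²).
-/
lemma isDistanceBand_band (hb : 0 ≤ b) (hb1 : b < 1) : IsDistanceBand (centralEllipse 1 b) := by
  refine ⟨axisX, (Real.artanh b).toNNReal, isHLine_axisX, ?_⟩
  have hb2 : b ^ 2 < 1 := by nlinarith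
  have hk := one_le_one_div_sqrt (sq_nonneg b) hb2
  ext p
  simp only [distanceBand, Set.mem_ofPred_eq]
  change _ ↔ p ∈ closedPlane ∧ _ ≤ ENNReal.ofReal (Real.artanh b)
  rw [← arcosh_one_div_sqrt hb hb1]
  have hsb : 0 < √(1 - b ^ 2) := Real.sqrt_pos.2 (by linarith)
  constructor
  · intro hp
    have hpc := centralEllipse_subset hb hb1.le le_rfl hp
    refine ⟨hpc, ?_⟩
    rcases isOrdinary_or_isAsymptotic hpc with ho | ha
    · refine (iInf₂_le (p.1, 0) ⟨?_, rfl⟩).trans ?_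
      swap
      · rw [mem_closedPlane] at hpc ⊢; simp only; nlinarith [sq_nonneg p.2]
      have ho1 : IsOrdinary (p.1, 0) := by
        unfold IsOrdinary at ho ⊢; simp only; nlinarith [sq_nonneg p.2]
      rw [hdist_ordinary ho ho1, ofReal_arcosh_le (one_le_coshDist ho ho1) hk]
      have h1 := ((mem_band hb).1 hp).2
      unfold IsOrdinary at ho ho1
      simp only [ne_eq, OfNat.ofNat_ne_zero, not_false_eq_true, zero_pow, add_zero] at ho1
      have hs1 : 0 < √(1 - p.1 ^ 2) := Real.sqrt_pos.2 (by linarith)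
      have hs2 : 0 < √(1 - p.1 ^ 2 - p.2 ^ 2) := Real.sqrt_pos.2 (by linarith)
      have e1 := Real.sq_sqrt (show 0 ≤ 1 - p.1 ^ 2 by linarith)
      have e : coshDist p (p.1, 0) = √(1 - p.1 ^ 2) / √(1 - p.1 ^ 2 - p.2 ^ 2) := by
        simp only [coshDist]
        norm_num
        rw [div_eq_div_iff (by positivity) (by positivity)]
        linear_combination -√(1 - p.1 ^ 2 - p.2 ^ 2) * e1
      rw [e, div_le_div_iff₀ hs2 hsb, one_mul, ← Real.sqrt_mul (by linarith)]
      apply Real.sqrt_le_sqrt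
      linarith
    · have hmem : p ∈ axisX := by
        rcases asymptotic_of_mem_band hb hb1 hp ha with rfl | rfl
        · exact ⟨hpc, rfl⟩
        · exact ⟨hpc, rfl⟩
      exact (iInf₂_le p hmem).trans (by rw [hdist_self]; exact zero_le)
  · rintro ⟨hpc, hinf⟩
    rw [mem_band hb]
    have hp1 : p.1 ^ 2 ≤ 1 := by rw [mem_closedPlane] at hpc; nlinarith [sq_nonneg p.2]
    refine ⟨hp1, ?_⟩
    rcases isOrdinary_or_isAsymptotic hpc with ho | ha
    · by_contra hcon
      push Not at hcon
      -- No point (q, 0) of the axis is closer than the foot, because √(1 - x²)√(1 - q²) ≤ 1 - xq.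
      have hlow : ENNReal.ofReal (Real.arcosh (√(1 - p.1 ^ 2) / √(1 - p.1 ^ 2 - p.2 ^ 2))) ≤
          ⨅ q ∈ axisX, hdist p q := by
        refine le_iInf₂ fun q hq => ?_
        rcases isOrdinary_or_isAsymptotic hq.1 with hqo | hqa
        · rw [hdist_ordinary ho hqo]
          apply ENNReal.ofReal_le_ofReal
          have ho' := ho
          have hdot := dot_lt_one ho hqo.mem
          unfold IsOrdinary at ho hqo
          rw [hq.2] at hqo hdot
          have hs2 : 0 < √(1 - p.1 ^ 2 - p.2 ^ 2) := Real.sqrt_pos.2 (by linarith)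
          have hsq : 0 < √(1 - q.1 ^ 2) := Real.sqrt_pos.2 (by linarith)
          have hs1 : 0 < √(1 - p.1 ^ 2) := Real.sqrt_pos.2 (by nlinarith [sq_nonneg p.2])
          rw [Real.arcosh_le_arcosh (by positivity) (by
            have := one_le_coshDist ho' (hq.1.lt_or_eq.elim id fun h => by
              rw [hq.2] at h; exfalso; linarith)
            linarith)]
          simp only [coshDist, hq.2]
          norm_num
          rw [div_le_div_iff₀ hs2 (by positivity)]
          have : √(1 - p.1 ^ 2) * √(1 - q.1 ^ 2) ≤ 1 - p.1 * q.1 := by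
            rw [← Real.sqrt_mul (by linarith), Real.sqrt_le_iff]
            exact ⟨by linarith, by nlinarith [sq_nonneg (p.1 - q.1)]⟩
          calc √(1 - p.1 ^ 2) * (√(1 - p.1 ^ 2 - p.2 ^ 2) * √(1 - q.1 ^ 2))
              = (√(1 - p.1 ^ 2) * √(1 - q.1 ^ 2)) * √(1 - p.1 ^ 2 - p.2 ^ 2) := by ring
            _ ≤ _ := by gcongr
        · rw [hdist_eq_top_right hqa]
          · exact le_top
          · rintro rfl; exact hqa.not_isOrdinary ho
      unfold IsOrdinary at ho
      have hs2 : 0 < √(1 - p.1 ^ 2 - p.2 ^ 2) := Real.sqrt_pos.2 (by linarith)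
      have hge : 1 ≤ √(1 - p.1 ^ 2) / √(1 - p.1 ^ 2 - p.2 ^ 2) := by
        rw [le_div_iff₀ hs2, one_mul]
        exact Real.sqrt_le_sqrt (by nlinarith [sq_nonneg p.2])
      have h1 := hlow.trans hinf
      rw [ofReal_arcosh_le hge hk, div_le_div_iff₀ hs2 hsb, one_mul,
        ← Real.sqrt_mul (by linarith), Real.sqrt_le_sqrt_iff (by linarith)] at h1
      linarith
    · by_cases hpl : p ∈ axisX
      · rw [hpl.2]
        have := mul_nonneg (sq_nonneg b) (sub_nonneg.2 hp1)
        linarith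
      -- An asymptotic point off the axis has infinite distance from each of its points, and the
      -- radius is finite.
      · exfalso
        have : (⊤ : ℝ≥0∞) ≤ ⨅ q ∈ axisX, hdist p q := by
          refine le_iInf₂ fun q hq => ?_
          rw [hdist_eq_top_left ha (by rintro rfl; exact hpl hq)]
        exact absurd (this.trans hinf) (by simp)

end Band

/-! ### Parabolic disks with asymptotic point `(0, -1)` -/

/-- The possibly degenerate elliptical disk with vertical axis from `(0, -1)` to the origin. -/
def parabolicDisk (κ : ℝ) : Set (ℝ × ℝ) :=
  (fun p : ℝ × ℝ => (κ / √2 * p.1 + 0 * p.2 + 0, 0 * p.1 + 1 / 2 * p.2 + -1 / 2)) '' closedPlane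

lemma sqrt_two_sq : √2 ^ 2 = (2 : ℝ) := Real.sq_sqrt (by norm_num)

section Parabolic

variable {κ : ℝ}

lemma mem_parabolicDisk {p : ℝ × ℝ} :
    p ∈ parabolicDisk κ ↔ p.1 ^ 2 ≤ -2 * κ ^ 2 * (p.2 * (1 + p.2)) ∧ -1 ≤ p.2 ∧ p.2 ≤ 0 := by
  have h2 := sqrt_two_sq
  have h20 : 0 < √2 := by positivity
  constructor
  · rintro ⟨q, hq, rfl⟩
    rw [mem_closedPlane] at hq
    have h3 := abs_le.1 ((sq_le_one_iff_abs_le_one q.2).1 (by nlinarith [sq_nonneg q.1]))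
    have h4 : (κ / √2 * q.1) ^ 2 = κ ^ 2 / 2 * q.1 ^ 2 := by rw [mul_pow, div_pow, h2]
    simp only
    refine ⟨?_, by linarith [h3.1], by linarith [h3.2]⟩
    rw [zero_mul, add_zero, add_zero, h4]
    nlinarith [mul_nonneg (sq_nonneg κ) (sub_nonneg.2 hq)]
  · rintro ⟨h1, h3, h4⟩
    by_cases hκ : κ = 0
    · subst hκ
      refine ⟨(0, 2 * p.2 + 1), ?_, Prod.ext ?_ ?_⟩
      · rw [mem_closedPlane]; simp only; nlinarith
      · have : p.1 ^ 2 = 0 := le_antisymm (by linarith) (sq_nonneg _)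
        simpa using (pow_eq_zero_iff (two_ne_zero) |>.1 this).symm
      · simp only; ring
    · have hκ2 : 0 < κ ^ 2 := by positivity
      refine ⟨(√2 * p.1 / κ, 2 * p.2 + 1), ?_, Prod.ext ?_ ?_⟩
      · rw [mem_closedPlane]
        have h5 : (√2 * p.1 / κ) ^ 2 ≤ -4 * (p.2 * (1 + p.2)) := by
          rw [div_pow, mul_pow, h2, div_le_iff₀ hκ2]; linarith
        simp only
        nlinarith
      · simp only; field_simp; ring
      · simp only; ring

lemma parabolicDisk_subset (h0 : 0 ≤ κ) (h1 : κ ≤ 1) : parabolicDisk κ ⊆ closedPlane := by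
  intro p hp
  obtain ⟨h2, h3, h4⟩ := mem_parabolicDisk.1 hp
  rw [mem_closedPlane]
  have h5 : κ ^ 2 ≤ 1 := by nlinarith
  nlinarith [mul_nonneg (mul_nonneg (neg_nonneg.2 h4) (by linarith : 0 ≤ 1 + p.2))
    (sub_nonneg.2 h5)]

lemma isAsymptotic_bot : IsAsymptotic (0, -1) := by norm_num [IsAsymptotic]

lemma bot_mem_parabolicDisk (κ : ℝ) : (0, -1) ∈ parabolicDisk κ := by
  rw [mem_parabolicDisk]; norm_num

lemma zero_mem_parabolicDisk (κ : ℝ) : (0, 0) ∈ parabolicDisk κ := by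
  rw [mem_parabolicDisk]; norm_num

lemma asymptotic_of_mem_parabolicDisk (h0 : 0 ≤ κ) (h1 : κ ≤ 1) {p : ℝ × ℝ}
    (hp : p ∈ parabolicDisk κ) (hpa : IsAsymptotic p) : p = (0, -1) := by
  obtain ⟨h2, h3, h4⟩ := mem_parabolicDisk.1 hp
  unfold IsAsymptotic at hpa
  have h5 : κ ^ 2 ≤ 1 := by nlinarith
  have h6 : (1 + p.2) ^ 2 ≤ 0 := by
    nlinarith [mul_nonneg (mul_nonneg (neg_nonneg.2 h4) (by linarith : 0 ≤ 1 + p.2))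
      (sub_nonneg.2 h5)]
  have h7 : 1 + p.2 = 0 := pow_eq_zero_iff (two_ne_zero) |>.1 (le_antisymm h6 (sq_nonneg _))
  have h8 : p.2 = -1 := by linarith
  rw [h8] at hpa
  have h9 : p.1 = 0 := pow_eq_zero_iff (two_ne_zero) |>.1 (by linarith : p.1 ^ 2 = 0)
  exact Prod.ext h9 h8

lemma parabolicDisk_inter_axisZ (h0 : 0 ≤ κ) (h1 : κ ≤ 1) :
    parabolicDisk κ ∩ axisZ = segment ℝ ((0, -1) : ℝ × ℝ) (0, 0) := by
  ext p
  constructor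
  · rintro ⟨hp, -, hp0⟩
    obtain ⟨-, h3, h4⟩ := mem_parabolicDisk.1 hp
    exact ⟨-p.2, 1 + p.2, by linarith, by linarith, by ring, Prod.ext (by simp [hp0]) (by simp)⟩
  · rintro ⟨a, b, ha, hb, hab, rfl⟩
    have : a • ((0, -1) : ℝ × ℝ) + b • (0, 0) ∈ parabolicDisk κ := by
      rw [mem_parabolicDisk]
      obtain rfl : b = 1 - a := by linarith
      simp
      exact ⟨by nlinarith [mul_nonneg (sq_nonneg κ) (mul_nonneg ha hb)], by linarith, ha⟩
    exact ⟨this, parabolicDisk_subset h0 h1 this, by simp⟩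

lemma isSymmetryAxis_parabolicDisk (κ : ℝ) : IsSymmetryAxis (parabolicDisk κ) axisZ := by
  refine ⟨_, isHReflection_axisZ, ?_⟩
  have key : ∀ p ∈ parabolicDisk κ, (-p.1, p.2) ∈ parabolicDisk κ := fun p hp => by
    rw [mem_parabolicDisk] at hp ⊢; simpa using hp
  ext p
  constructor
  · rintro ⟨q, hq, rfl⟩; exact key q hq
  · intro hp; exact ⟨_, key p hp, by simp⟩

lemma bot_ne_zero : ((0, -1) : ℝ × ℝ) ≠ (0, 0) := by
  intro h; have := congrArg Prod.snd h; norm_num at this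

lemma isMajorAxis_parabolicDisk (h0 : 0 ≤ κ) (h1 : κ ≤ 1) :
    IsMajorAxis (parabolicDisk κ) (0, -1) (0, 0) :=
  .halfLine _ _ axisZ isAsymptotic_bot (fun _ => asymptotic_of_mem_parabolicDisk h0 h1)
    bot_ne_zero (isSymmetryAxis_parabolicDisk κ) (parabolicDisk_inter_axisZ h0 h1)

lemma isMajorSemiAxisLength_parabolicDisk (h0 : 0 ≤ κ) (h1 : κ ≤ 1) (s : ℝ≥0∞) :
    IsMajorSemiAxisLength (parabolicDisk κ) s ↔ s = artanhExt 1 := by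
  rw [artanhExt_one]
  have hb := bot_mem_parabolicDisk κ
  have hz := zero_mem_parabolicDisk κ
  constructor
  · rintro ⟨P, Q, ⟨_, C, r, hS, -, -, -, -, -, -, -⟩ | ⟨_, hP, hQ, hne, hPQ⟩ |
      ⟨_, l, hP, huniq, hne, hl, hPQ⟩ | ⟨hP, hS⟩, rfl⟩
    · exact absurd (hS _ hb) isAsymptotic_bot.not_isOrdinary
    · rw [hdist_eq_top_left hP hne, ENNReal_top_div_two]
    · rw [hdist_eq_top_left hP hne, ENNReal_top_div_two]
    · rw [hS] at hb hz
      exact absurd (Eq.trans hb hz.symm) bot_ne_zero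
  · rintro rfl
    refine ⟨_, _, isMajorAxis_parabolicDisk h0 h1, ?_⟩
    rw [hdist_eq_top_left isAsymptotic_bot bot_ne_zero, ENNReal_top_div_two]

/-- With centre (0, -1) and c = 1 the horodisk inequality becomes x² + 2z(1 + z) ≤ 0. -/
lemma isHorodisk_parabolicDisk_one : IsHorodisk (parabolicDisk 1) := by
  refine ⟨(0, -1), 1, isAsymptotic_bot, one_pos, ?_⟩
  ext p
  rw [mem_parabolicDisk, Set.mem_ofPred_eq]
  simp only
  constructor
  · rintro ⟨h1, -, -⟩; linarith
  · intro h1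
    refine ⟨by linarith, ?_, ?_⟩ <;> nlinarith [sq_nonneg p.1]

lemma not_isHorodisk_parabolicDisk (h0 : 0 ≤ κ) (h1 : κ < 1) : ¬ IsHorodisk (parabolicDisk κ) := by
  rintro ⟨P, c, hP, hc, hS⟩
  have hPm : P ∈ parabolicDisk κ := by rw [hS]; exact horodisk_center_mem hP c
  obtain rfl := asymptotic_of_mem_parabolicDisk h0 h1.le hPm hP
  have hz := zero_mem_parabolicDisk κ
  have hiff : ∀ p : ℝ × ℝ, p ∈ parabolicDisk κ ↔
      p.1 ^ 2 + p.2 ^ 2 - 1 + c * (1 + p.2) ^ 2 ≤ 0 := by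
    intro p; rw [hS, Set.mem_ofPred_eq]; simp
  have hc1 : c ≤ 1 := by have := (hiff _).1 hz; norm_num at this; exact this
  -- A horodisk at (0, -1) containing the origin has c ≤ 1, so it contains this point, an end of the
  -- horizontal axis of the horodisk with c = 1. At height -1/2 the disk `parabolicDisk κ` only
  -- allows x² ≤ κ²/2.
  have h2 : (√(1 / 2), -1 / 2) ∈ parabolicDisk κ := by
    rw [hiff]
    simp only
    rw [Real.sq_sqrt (by norm_num)]
    linarith
  have h3 := (mem_parabolicDisk.1 h2).1
  simp only at h3
  rw [Real.sq_sqrt (by norm_num)] at h3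
  nlinarith

/-- The symmetry axis of a parabolic disk that is no horodisk is unique. -/
lemma IsSymmetryAxis.eq_axisZ (h0 : 0 ≤ κ) (h1 : κ < 1) {l : Set (ℝ × ℝ)}
    (hl : IsSymmetryAxis (parabolicDisk κ) l) : l = axisZ := by
  obtain ⟨f, hf, hfS⟩ := hl
  have hmaps : ∀ p ∈ parabolicDisk κ, f p ∈ parabolicDisk κ := fun p hp => by
    rw [← hfS]; exact ⟨p, hp, rfl⟩
  have hfix := hf.2.2
  obtain ⟨a, b, c, hab, hlabc, -⟩ := hf.2.1
  -- The reflection preserves the only asymptotic point of the disk, so the axis passes through it.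
  have hbot : ((0, -1) : ℝ × ℝ) ∈ l := by
    obtain ⟨M, N, hM, hfM⟩ := hf.1.exists_lorentzPair
    have h2 := hmaps _ (bot_mem_parabolicDisk κ)
    rw [← hfix]
    refine ⟨isAsymptotic_bot.mem, asymptotic_of_mem_parabolicDisk h0 h1.le h2 ?_⟩
    rw [hfM isAsymptotic_bot.mem, hM.left.isAsymptotic isAsymptotic_bot.mem]
    exact isAsymptotic_bot
  have hc : c = -b := by
    rw [hlabc] at hbot
    have := hbot.2
    simp at this
    exact this.symm
  subst hc
  have hz := hmaps _ (zero_mem_parabolicDisk κ)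
  have ha : a ≠ 0 := by
    rintro rfl
    obtain ⟨A, B, C, hAB, rfl, q, hq, hqo⟩ := hf.2.1
    have hb := hab.resolve_left (by simp)
    have hqm := hq
    rw [hlabc] at hqm
    have h2 := hqm.2
    have h3 : q.2 = -1 := mul_left_cancel₀ hb (by linarith)
    unfold IsOrdinary at hqo
    rw [h3] at hqo
    nlinarith [sq_nonneg q.1]
  rw [hf.apply hlabc hab (show ((0, 0) : ℝ × ℝ) ∈ closedPlane from isOrdinary_origin.mem)] at hz
  -- The image of the origin must stay in the disk. Computing it explicitly gives a²b²(1 - κ²) ≤ 0,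
  -- so a symmetry axis through (0, -1) is vertical.
  have hb : b = 0 := by
    have e : dehomog (homog ((0, 0) : ℝ × ℝ) - (2 * (a * ((0, 0) : ℝ × ℝ).1 +
        b * ((0, 0) : ℝ × ℝ).2 - -b) / (a ^ 2 + b ^ 2 - (-b) ^ 2)) • ![a, b, -b]) =
        (-2 * a * b / (a ^ 2 + 2 * b ^ 2), -2 * b ^ 2 / (a ^ 2 + 2 * b ^ 2)) := by
      have hpos : a ^ 2 + 2 * b ^ 2 ≠ 0 := by positivity
      have hw : 1 + 2 * b / a ^ 2 * b = (a ^ 2 + 2 * b ^ 2) / a ^ 2 := by field_simp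
      ext <;> simp [dehomog, hw] <;> field_simp
    rw [e, mem_parabolicDisk] at hz
    have h2 := hz.1
    simp only at h2
    have hpos : 0 < a ^ 2 + 2 * b ^ 2 := by positivity
    rw [show 1 + -2 * b ^ 2 / (a ^ 2 + 2 * b ^ 2) = a ^ 2 / (a ^ 2 + 2 * b ^ 2) by field_simp; ring,
      div_mul_div_comm, ← sq, div_pow, ← mul_div_assoc, div_le_div_iff_of_pos_right (by positivity)]
      at h2
    have h3 : a ^ 2 * b ^ 2 * (1 - κ ^ 2) ≤ 0 := by linarith
    have h4 : 0 < 1 - κ ^ 2 := by nlinarith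
    have h5 : a ^ 2 * b ^ 2 ≤ 0 := nonpos_of_mul_nonpos_left h3 h4
    have h6 : b ^ 2 ≤ 0 := nonpos_of_mul_nonpos_right h5 (by positivity)
    exact pow_eq_zero_iff (two_ne_zero) |>.1 (le_antisymm h6 (sq_nonneg b))
  subst hb
  rw [hlabc]
  ext p
  simp [axisZ, ha]

/-- A symmetric horizontal chord at height k with Euclidean half-width x has hyperbolic half-length
artanh(x/√(1 - k²)); here x² = -2κ²k(1 + k), and the factor 1 + k cancels. -/
lemma isHalfSectionLength_parabolicDisk (h0 : 0 ≤ κ) (h1 : κ < 1) {k : ℝ} (hk : -1 < k)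
    (hk0 : k ≤ 0) (s : ℝ≥0∞) :
    IsHalfSectionLength (parabolicDisk κ) {p | p ∈ closedPlane ∧ p.2 = k} s ↔
      s = ENNReal.ofReal (Real.artanh (κ * √(-2 * k / (1 - k)))) := by
  have hq0 : 0 ≤ -2 * k / (1 - k) := div_nonneg (by linarith) (by linarith)
  have hq1 : -2 * k / (1 - k) ≤ 1 := by rw [div_le_one (by linarith)]; linarith
  have hu0 : 0 ≤ κ * √(-2 * k / (1 - k)) := by positivity
  have hu1 : κ * √(-2 * k / (1 - k)) < 1 :=
    lt_of_le_of_lt (mul_le_of_le_one_right h0 (Real.sqrt_le_one.2 hq1)) h1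
  have hx : 0 ≤ -2 * (k * (1 + k)) := by nlinarith
  have hx0 : 0 ≤ κ * √(-2 * (k * (1 + k))) := by positivity
  have hx2 : (κ * √(-2 * (k * (1 + k)))) ^ 2 = -2 * κ ^ 2 * (k * (1 + k)) := by
    rw [mul_pow, Real.sq_sqrt hx]; ring
  have hu2 : (κ * √(-2 * k / (1 - k))) ^ 2 = κ ^ 2 * (-2 * k / (1 - k)) := by
    rw [mul_pow, Real.sq_sqrt hq0]
  have hsec : parabolicDisk κ ∩ {p | p ∈ closedPlane ∧ p.2 = k} =
      segment ℝ (-(κ * √(-2 * (k * (1 + k)))), k) (κ * √(-2 * (k * (1 + k))), k) := by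
    ext p
    rw [mem_segment_horizontal hx0, hx2]
    constructor
    · rintro ⟨hp, -, h2⟩
      rw [mem_parabolicDisk, h2] at hp
      exact ⟨hp.1, h2⟩
    · rintro ⟨hp, h2⟩
      have h3 : p ∈ parabolicDisk κ := by rw [mem_parabolicDisk, h2]; exact ⟨hp, hk.le, hk0⟩
      exact ⟨h3, parabolicDisk_subset h0 h1.le h3, h2⟩
  have hκ2 : κ ^ 2 ≤ 1 := by nlinarith
  have hlt : -2 * κ ^ 2 * (k * (1 + k)) + k ^ 2 < 1 := by
    have : 0 ≤ (1 - κ ^ 2) * (-k * (1 + k)) :=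
      mul_nonneg (by linarith) (mul_nonneg (by linarith) (by linarith))
    nlinarith
  have o1 : IsOrdinary (-(κ * √(-2 * (k * (1 + k)))), k) := by
    simp only [IsOrdinary, neg_sq, hx2]; exact hlt
  have o2 : IsOrdinary (κ * √(-2 * (k * (1 + k))), k) := by
    simp only [IsOrdinary, hx2]; exact hlt
  rw [isHalfSectionLength_iff hsec, hdist_div_two o1 o2 hu0 hu1]
  have hul : (κ * √(-2 * k / (1 - k))) ^ 2 < 1 := by nlinarith
  simp only [coshDist, neg_sq, hx2]
  rw [Real.mul_self_sqrt (by linarith), div_eq_div_iff (by linarith) (by linarith), hu2]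
  have h1k : 1 - k ≠ 0 := by linarith
  have e : 1 - -(κ * √(-2 * (k * (1 + k)))) * (κ * √(-2 * (k * (1 + k)))) - k * k =
      1 - 2 * κ ^ 2 * (k * (1 + k)) - k ^ 2 := by linear_combination hx2
  rw [e]
  field_simp
  ring

/-- As k decreases to -1 the quantity -2k/(1 - k) increases to 1, so the half-lengths approach
artanh κ. -/
lemma sSup_halfSectionLength_parabolicDisk (h0 : 0 ≤ κ) (h1 : κ < 1) :
    sSup {h | ∃ m, IsPerp axisZ m ∧ IsHalfSectionLength (parabolicDisk κ) m h} =
      ENNReal.ofReal (Real.artanh κ) := by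
  apply le_antisymm
  · apply sSup_le
    rintro h ⟨m, hm, hh⟩
    obtain ⟨k, hk, rfl⟩ := isPerp_axisZ_iff.1 hm
    have hk1 := abs_lt.1 ((sq_lt_one_iff_abs_lt_one k).1 hk)
    -- A segment is non-empty, so only lines that meet the disk contribute to the supremum.
    have hk0 : k ≤ 0 := by
      obtain ⟨A, B, hAB, -⟩ := hh
      have hA := hAB.symm.subset (left_mem_segment ℝ A B)
      rw [← hA.2.2]; exact (mem_parabolicDisk.1 hA.1).2.2
    rw [(isHalfSectionLength_parabolicDisk h0 h1 hk1.1 hk0 h).1 hh]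
    apply ENNReal.ofReal_le_ofReal
    have hq0 : 0 ≤ -2 * k / (1 - k) := div_nonneg (by linarith) (by linarith)
    have hq1 : -2 * k / (1 - k) ≤ 1 := by rw [div_le_one (by linarith)]; linarith
    have hu0 : 0 ≤ κ * √(-2 * k / (1 - k)) := by positivity
    exact Real.artanh_le_artanh (by linarith) h1
      (mul_le_of_le_one_right h0 (Real.sqrt_le_one.2 hq1))
  · apply le_of_forall_lt
    intro y hy
    have hy' : y ≠ ⊤ := hy.ne_top
    lift y to NNReal using hy'
    have hyκ : (y : ℝ) < Real.artanh κ := by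
      rw [← ENNReal.ofReal_coe_nnreal] at hy
      exact (ENNReal.ofReal_lt_ofReal_iff_of_nonneg y.2).1 hy
    obtain ⟨w, hw1, hw2⟩ := exists_between hyκ
    have hw0 : 0 < w := lt_of_le_of_lt y.2 hw1
    set u := Real.tanh w with hu
    have huw : Real.artanh u = w := Real.artanh_tanh w
    have hu0 : 0 ≤ u := by
      by_contra hneg
      push Not at hneg
      have := Real.artanh_nonpos hneg.le
      linarith
    have hu1 : u < 1 := Real.tanh_lt_one w
    have huκ : u < κ := by
      by_contra hcon
      push Not at hcon
      have := Real.artanh_le_artanh (by linarith) hu1 hcon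
      linarith
    have hκ0 : 0 < κ := by linarith
    have hq0 : 0 ≤ (u / κ) ^ 2 := by positivity
    have hq1 : (u / κ) ^ 2 < 1 := by
      rw [sq_lt_one_iff₀ (by positivity)]; exact (div_lt_one hκ0).2 huκ
    set q := (u / κ) ^ 2 with hq
    -- The height k = -q/(2 - q) solves -2k/(1 - k) = q = (u/κ)², which makes the section have
    -- half-length artanh u exactly.
    have hk : -1 < -q / (2 - q) := by rw [lt_div_iff₀ (by linarith)]; linarith
    have hk0 : -q / (2 - q) ≤ 0 := div_nonpos_of_nonpos_of_nonneg (by linarith) (by linarith)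
    have he : -2 * (-q / (2 - q)) / (1 - -q / (2 - q)) = q := by
      have : 2 - q ≠ 0 := by linarith
      have h2 : 1 - -q / (2 - q) = 2 / (2 - q) := by field_simp; ring
      rw [h2]; field_simp
    have hlen : κ * √(-2 * (-q / (2 - q)) / (1 - -q / (2 - q))) = u := by
      rw [he, hq, Real.sqrt_sq (by positivity)]; field_simp
    have hsec := (isHalfSectionLength_parabolicDisk h0 h1 hk hk0 _).2 rfl
    rw [hlen, huw] at hsec
    refine lt_of_lt_of_le ?_ (le_sSup ⟨_, isPerp_axisZ_iff.2 ⟨_, ?_, rfl⟩, hsec⟩)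
    · rw [← ENNReal.ofReal_coe_nnreal]
      exact (ENNReal.ofReal_lt_ofReal_iff_of_nonneg y.2).2 hw1
    · nlinarith

lemma isMinorSemiAxisLength_parabolicDisk (h0 : 0 ≤ κ) (h1 : κ < 1) (s : ℝ≥0∞) :
    IsMinorSemiAxisLength (parabolicDisk κ) s ↔ s = artanhExt κ := by
  rw [artanhExt_of_lt h1]
  have hb := bot_mem_parabolicDisk κ
  have hz := zero_mem_parabolicDisk κ
  constructor
  · rintro (⟨P, Q, s, hS, -, -⟩ | ⟨P, Q, m, s, hP, hQ, hne, hPQ, -, -⟩ | ⟨hS⟩ |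
      ⟨P, Q, l, hP, huniq, hne, -, hl, hPQ⟩ | ⟨P, hP, hS⟩)
    · exact absurd (hS _ hb) isAsymptotic_bot.not_isOrdinary
    · exact absurd ((asymptotic_of_mem_parabolicDisk h0 h1.le hPQ.mem.1 hP).trans
        (asymptotic_of_mem_parabolicDisk h0 h1.le hPQ.mem.2 hQ).symm) hne
    · exact absurd hS (not_isHorodisk_parabolicDisk h0 h1)
    · rw [hl.eq_axisZ h0 h1, sSup_halfSectionLength_parabolicDisk h0 h1]
    · rw [hS] at hb hz
      exact absurd (Eq.trans hb hz.symm) bot_ne_zero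
  · rintro rfl
    rw [← sSup_halfSectionLength_parabolicDisk h0 h1]
    exact .halfLine _ _ axisZ isAsymptotic_bot (fun _ => asymptotic_of_mem_parabolicDisk h0 h1.le)
      bot_ne_zero (not_isHorodisk_parabolicDisk h0 h1) (isSymmetryAxis_parabolicDisk κ)
      (parabolicDisk_inter_axisZ h0 h1.le)

lemma isMinorSemiAxisLength_horodisk {S : Set (ℝ × ℝ)} (hS : IsHorodisk S) (s : ℝ≥0∞) :
    IsMinorSemiAxisLength S s ↔ s = artanhExt 1 := by
  rw [artanhExt_one]
  constructor
  · have hS' := hS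
    obtain ⟨A, c, hA, hc, hSA⟩ := hS'
    have hAS : A ∈ S := by rw [hSA]; exact horodisk_center_mem hA c
    rintro (⟨P, Q, s, hSo, -, -⟩ | ⟨P, Q, m, s, hP, hQ, hne, hPQ, -, -⟩ | ⟨-⟩ |
      ⟨P, Q, l, -, -, -, hS', -, -⟩ | ⟨P, hP, hSP⟩)
    · exact absurd (hSo _ hAS) hA.not_isOrdinary
    · exact absurd (hS.asymptotic_unique hPQ.mem.1 hPQ.mem.2 hP hQ) hne
    · rfl
    · exact absurd hS hS'
    · exfalso
      rw [hSP] at hAS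
      obtain rfl : A = P := hAS
      have hA1 : A.1 ^ 2 + A.2 ^ 2 = 1 := hA
      -- The Euclidean centre of the horodisk: its diameter on the ray of A runs from ((c - 1)/(c +
      -- 1))A to A. Hence a horodisk is not a single point.
      have hmem : (c / (1 + c)) • A ∈ S := by
        rw [hSA, Set.mem_ofPred_eq]
        simp only [Prod.smul_fst, Prod.smul_snd, smul_eq_mul]
        have e1 : (c / (1 + c) * A.1) ^ 2 + (c / (1 + c) * A.2) ^ 2 = (c / (1 + c)) ^ 2 := by
          linear_combination (c / (1 + c)) ^ 2 * hA1
        have e2 : c / (1 + c) * A.1 * A.1 + c / (1 + c) * A.2 * A.2 = c / (1 + c) := by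
          linear_combination (c / (1 + c)) * hA1
        rw [e1, e2]
        have : (c / (1 + c)) ^ 2 - 1 + c * (1 - c / (1 + c)) ^ 2 = - (1 + c) / (1 + c) ^ 2 := by
          field_simp; ring
        rw [this]
        exact div_nonpos_of_nonpos_of_nonneg (by linarith) (by positivity)
      rw [hSP] at hmem
      have h2 : (c / (1 + c)) • A = A := hmem
      have e1 := congrArg Prod.fst h2
      have e2 := congrArg Prod.snd h2
      simp only [Prod.smul_fst, Prod.smul_snd, smul_eq_mul] at e1 e2
      have h3 : c / (1 + c) = 1 := by
        linear_combination A.1 * e1 + A.2 * e2 - (c / (1 + c) - 1) * hA1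
      rw [div_eq_one_iff_eq (by positivity)] at h3
      linarith
  · rintro rfl; exact .horodisk hS

lemma isEllipticParabolicDisk_parabolicDisk (h0 : 0 ≤ κ) (h1 : κ < 1) :
    IsEllipticParabolicDisk (parabolicDisk κ) := by
  rcases h0.eq_or_lt with h | h
  · subst h
    refine .inr ⟨(0, -1), (0, 0), isAsymptotic_bot, isOrdinary_origin, ?_⟩
    rw [← parabolicDisk_inter_axisZ le_rfl h1.le, Set.inter_eq_left.2]
    intro p hp
    refine ⟨parabolicDisk_subset le_rfl h1.le hp, ?_⟩
    have := (mem_parabolicDisk.1 hp).1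
    exact pow_eq_zero_iff (two_ne_zero) |>.1 (le_antisymm (by linarith) (sq_nonneg p.1))
  · refine .inl ⟨⟨κ / √2, 0, 0, 1 / 2, 0, -1 / 2, ?_, rfl⟩, parabolicDisk_subset h0 h1.le,
      ⟨(0, -1), ⟨bot_mem_parabolicDisk κ, isAsymptotic_bot⟩,
        fun p hp => asymptotic_of_mem_parabolicDisk h0 h1.le hp.1 hp.2⟩,
      not_isHorodisk_parabolicDisk h0 h1⟩
    have : 0 < κ / √2 * (1 / 2) := by positivity
    simpa using this.ne'

end Parabolic

/-! ### Asymptotic points -/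

lemma isMajorSemiAxisLength_singleton {P : ℝ × ℝ} (hP : IsAsymptotic P) (s : ℝ≥0∞) :
    IsMajorSemiAxisLength {P} s ↔ s = artanhExt 0 := by
  rw [artanhExt_zero]
  constructor
  · rintro ⟨A, B, h, rfl⟩
    obtain ⟨h1, h2⟩ := h.mem
    obtain rfl : A = P := h1
    obtain rfl : B = A := h2
    simp [hdist_self]
  · rintro rfl; exact ⟨P, P, .asymptoticPoint P hP rfl, by simp [hdist_self]⟩

lemma isMinorSemiAxisLength_singleton {P : ℝ × ℝ} (hP : IsAsymptotic P) (s : ℝ≥0∞) :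
    IsMinorSemiAxisLength {P} s ↔ s = artanhExt 0 := by
  rw [artanhExt_zero]
  constructor
  · intro hs
    -- If a point were a horodisk, its length 0 would have to be infinite by the uniqueness of the
    -- length for horodisks.
    have hnot : ¬ IsHorodisk {P} := fun hS => by
      have h1 := IsMinorSemiAxisLength.asymptoticPoint (S := {P}) P hP rfl
      rw [isMinorSemiAxisLength_horodisk hS, artanhExt_one] at h1
      exact absurd h1 (by simp)
    rcases hs with ⟨A, B, s, hSo, -, -⟩ | ⟨A, B, m, s, hA, hB, hne, hAB, -, -⟩ | ⟨hS⟩ |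
      ⟨A, B, l, -, -, hne, -, -, hAB⟩ | ⟨A, hA, hS⟩
    · exact absurd (hSo P rfl) hP.not_isOrdinary
    · exact absurd ((show A = P from hAB.mem.1).trans (show B = P from hAB.mem.2).symm) hne
    · exact absurd hS hnot
    · have h1 := (hAB.symm.subset (left_mem_segment ℝ A B)).1
      have h2 := (hAB.symm.subset (right_mem_segment ℝ A B)).1
      exact absurd ((show A = P from h1).trans (show B = P from h2).symm) hne
    · rfl
  · rintro rfl; exact .asymptoticPoint P hP rfl

/-! ### The conformal range in homogeneous coordinates -/

/-- Homogeneous coordinates of the point of the conformal range determined by `y = A x`. -/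
def rangeVec (y x : Fin 2 → ℂ) : Fin 3 → ℝ :=
  ![2 * (star y ⬝ᵥ x).re, (star y ⬝ᵥ y).re - (star x ⬝ᵥ x).re,
    (star y ⬝ᵥ y).re + (star x ⬝ᵥ x).re]

lemma re_star_dotProduct (y x : Fin 2 → ℂ) : (star y ⬝ᵥ x).re =
    (y 0).re * (x 0).re + (y 0).im * (x 0).im + ((y 1).re * (x 1).re + (y 1).im * (x 1).im) := by
  simp [dotProduct, Fin.sum_univ_two]

lemma re_star_dotProduct_pos {x : Fin 2 → ℂ} (hx : x ≠ 0) : 0 < (star x ⬝ᵥ x).re := by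
  rw [re_star_dotProduct]
  by_contra hcon
  push Not at hcon
  apply hx
  have e : ∀ z : ℂ, z.re ^ 2 = 0 → z.im ^ 2 = 0 → z = 0 := fun z h1 h2 =>
    Complex.ext (by simpa using h1) (by simpa using h2)
  have s1 := sq_nonneg (x 0).re
  have s2 := sq_nonneg (x 0).im
  have s3 := sq_nonneg (x 1).re
  have s4 := sq_nonneg (x 1).im
  ext i
  fin_cases i
  · change x 0 = 0
    exact e _ (by nlinarith) (by nlinarith)
  · change x 1 = 0
    exact e _ (by nlinarith) (by nlinarith)

lemma re_star_dotProduct_nonneg (x : Fin 2 → ℂ) : 0 ≤ (star x ⬝ᵥ x).re := by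
  rcases eq_or_ne x 0 with rfl | h
  · simp
  · exact (re_star_dotProduct_pos h).le

lemma rangeVec_two_pos {x : Fin 2 → ℂ} (hx : x ≠ 0) (y : Fin 2 → ℂ) : 0 < rangeVec y x 2 :=
  add_pos_of_nonneg_of_pos (re_star_dotProduct_nonneg y) (re_star_dotProduct_pos hx)

lemma mem_conformalRange {A : Matrix (Fin 2) (Fin 2) ℂ} {p : ℝ × ℝ} :
    p ∈ conformalRange A ↔ ∃ x : Fin 2 → ℂ, x ≠ 0 ∧ p = dehomog (rangeVec (A *ᵥ x) x) := by
  have hn : ∀ x : EuclideanSpace ℂ (Fin 2), ‖x‖ ^ 2 = (star x.ofLp ⬝ᵥ x.ofLp).re := by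
    intro x
    rw [← inner_self_eq_norm_sq (𝕜 := ℂ), EuclideanSpace.inner_eq_star_dotProduct,
      dotProduct_comm]; rfl
  have hi : ∀ x y : EuclideanSpace ℂ (Fin 2), (inner ℂ y x).re = (star y.ofLp ⬝ᵥ x.ofLp).re := by
    intro x y
    rw [EuclideanSpace.inner_eq_star_dotProduct, dotProduct_comm]
  constructor
  · rintro ⟨x, y, hx, rfl, rfl⟩
    refine ⟨x.ofLp, fun h => hx (by ext i; simp [h]), ?_⟩
    rw [hn, hn, hi]
    rfl
  · rintro ⟨x, hx, rfl⟩
    refine ⟨WithLp.toLp 2 x, _, fun h => hx (by simpa using h), rfl, ?_⟩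
    rw [hn, hn, hi]
    rfl

/-- The Lorentz form on the range vector is 4((Re⟨y, x⟩)² - |y|²|x|²), so this is the Cauchy–Schwarz
inequality. -/
lemma conformalRange_subset (A : Matrix (Fin 2) (Fin 2) ℂ) : conformalRange A ⊆ closedPlane := by
  intro p hp
  obtain ⟨x, hx, rfl⟩ := mem_conformalRange.1 hp
  rw [dehomog_mem_closedPlane (rangeVec_two_pos hx _).ne']
  simp only [hform, rangeVec, Matrix.cons_val_zero, Matrix.cons_val_one, Matrix.cons_val]
  have : (star (A *ᵥ x) ⬝ᵥ x).re ^ 2 ≤ (star (A *ᵥ x) ⬝ᵥ (A *ᵥ x)).re * (star x ⬝ᵥ x).re := by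
    simp only [re_star_dotProduct]
    generalize A *ᵥ x = y
    have cs := fun a b c d a' b' c' d' : ℝ => show
        (a * a' + b * b' + (c * c' + d * d')) ^ 2 ≤
          (a * a + b * b + (c * c + d * d)) * (a' * a' + b' * b' + (c' * c' + d' * d')) by
      nlinarith [sq_nonneg (a * b' - b * a'), sq_nonneg (a * c' - c * a'),
        sq_nonneg (a * d' - d * a'), sq_nonneg (b * c' - c * b'), sq_nonneg (b * d' - d * b'),
        sq_nonneg (c * d' - d * c')]
    exact cs _ _ _ _ _ _ _ _
  nlinarith

/-- The action of a real Möbius transformation on homogeneous coordinates. -/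
def mobiusMat (a b c d : ℝ) : Matrix (Fin 3) (Fin 3) ℝ :=
  !![a * d + b * c, a * c - b * d, a * c + b * d;
     a * b - c * d, (a ^ 2 - c ^ 2 - b ^ 2 + d ^ 2) / 2, (a ^ 2 - c ^ 2 + b ^ 2 - d ^ 2) / 2;
     a * b + c * d, (a ^ 2 + c ^ 2 - b ^ 2 - d ^ 2) / 2, (a ^ 2 + b ^ 2 + c ^ 2 + d ^ 2) / 2]

/-- The coordinates are linear in |y|², Re⟨y, x⟩, |x|², and a real substitution of (y, x) acts on
these as on the quadratic monomials, that is, by the symmetric square. -/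
lemma rangeVec_mobius (a b c d : ℝ) (y x : Fin 2 → ℂ) :
    rangeVec ((a : ℂ) • y + (b : ℂ) • x) ((c : ℂ) • y + (d : ℂ) • x) =
      mobiusMat a b c d *ᵥ rangeVec y x := by
  ext i
  fin_cases i <;>
  · simp [rangeVec, mobiusMat, Matrix.mulVec, dotProduct, Fin.sum_univ_two, Fin.sum_univ_three]
    ring

lemma hform_mobiusMat (a b c d : ℝ) (v w : Fin 3 → ℝ) :
    hform (mobiusMat a b c d *ᵥ v) (mobiusMat a b c d *ᵥ w) = (a * d - b * c) ^ 2 * hform v w := by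
  simp [hform, mobiusMat, Matrix.mulVec, dotProduct, Fin.sum_univ_three]
  ring

lemma exists_lorentzPair_mobiusMat {a b c d : ℝ} (h : a * d - b * c ≠ 0) :
    ∃ M N, LorentzPair M N ∧ ∀ v, dehomog (M *ᵥ v) = dehomog (mobiusMat a b c d *ᵥ v) := by
  have hk : |a * d - b * c|⁻¹ ≠ 0 := inv_ne_zero (abs_ne_zero.2 h)
  have hL : IsLorentz (|a * d - b * c|⁻¹ • mobiusMat a b c d) := by
    refine ⟨fun v w => ?_, fun p hp => ?_⟩
    · rw [Matrix.smul_mulVec, Matrix.smul_mulVec, hform_smul_smul, hform_mobiusMat, ← sq_abs]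
      have := abs_ne_zero.2 h
      field_simp
    · rw [Matrix.smul_mulVec, Pi.smul_apply, smul_eq_mul]
      refine mul_pos (by positivity) ?_
      have hd : 0 < (a * d - b * c) ^ 2 := by positivity
      have hw : 0 < (a ^ 2 + b ^ 2 + c ^ 2 + d ^ 2) / 2 := by
        rcases eq_or_ne (a ^ 2 + b ^ 2 + c ^ 2 + d ^ 2) 0 with h0 | h0
        · exfalso
          have ha : a = 0 := by nlinarith [sq_nonneg a, sq_nonneg b, sq_nonneg c, sq_nonneg d]
          have hb : b = 0 := by nlinarith [sq_nonneg a, sq_nonneg b, sq_nonneg c, sq_nonneg d]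
          apply h; rw [ha, hb]; ring
        · positivity
      have := add_pos_of_timelike (x := a * b + c * d) (y := (a ^ 2 + c ^ 2 - b ^ 2 - d ^ 2) / 2)
        hw (by nlinarith) hp
      simpa [mobiusMat, Matrix.mulVec, dotProduct, Fin.sum_univ_three] using this
  obtain ⟨N, hN, h1, h2⟩ := hL.exists_inv
  exact ⟨_, N, ⟨hL, hN, h1, h2⟩, fun v => by rw [Matrix.smul_mulVec, dehomog_smul hk]⟩

lemma act_dehomog (M : Matrix (Fin 3) (Fin 3) ℝ) {v : Fin 3 → ℝ} (hv : v 2 ≠ 0) :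
    act M (dehomog v) = dehomog (M *ᵥ v) := by
  conv_rhs => rw [← smul_homog_dehomog hv, Matrix.mulVec_smul, dehomog_smul hv]
  rfl

lemma rangeVec_unitary {V : Matrix (Fin 2) (Fin 2) ℂ} (hV : V ∈ Matrix.unitaryGroup (Fin 2) ℂ)
    (y x : Fin 2 → ℂ) : rangeVec (V *ᵥ y) (V *ᵥ x) = rangeVec y x := by
  have h : ∀ y x : Fin 2 → ℂ, star (V *ᵥ y) ⬝ᵥ (V *ᵥ x) = star y ⬝ᵥ x := fun y x => by
    rw [Matrix.star_mulVec, Matrix.dotProduct_mulVec, Matrix.vecMul_vecMul,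
      ← Matrix.star_eq_conjTranspose, Matrix.mem_unitaryGroup_iff'.1 hV, Matrix.vecMul_one]
  simp only [rangeVec, h]

/-- Equivalent matrices have congruent conformal ranges. -/
theorem RealMobiusEquiv.hCongruent {A B : Matrix (Fin 2) (Fin 2) ℂ} (h : RealMobiusEquiv A B) :
    HCongruent (conformalRange A) (conformalRange B) := by
  obtain ⟨a, b, c, d, habcd, hdet, V, hV, rfl⟩ := h
  obtain ⟨M, N, hM, hMm⟩ := exists_lorentzPair_mobiusMat habcd
  rw [hCongruent_iff (conformalRange_subset A)]
  refine ⟨M, N, hM, ?_⟩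
  set C := (c : ℂ) • A + (d : ℂ) • (1 : Matrix (Fin 2) (Fin 2) ℂ) with hC
  have hCu : IsUnit C.det := isUnit_iff_ne_zero.2 hdet
  have hVV : star V * V = 1 := Matrix.mem_unitaryGroup_iff'.1 hV
  have hVV' : V * star V = 1 := Matrix.mem_unitaryGroup_iff.1 hV
  -- With N = cA + d, the substitution x ↦ VNx is a bijection of non-zero vectors. It clears the
  -- inverse in the transformed matrix and turns the pair (Ax, x) into a real linear substitution of
  -- itself, up to V.
  have key : ∀ x, rangeVec ((V * (((a : ℂ) • A + (b : ℂ) • 1) * C⁻¹) * star V) *ᵥ ((V * C) *ᵥ x))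
      ((V * C) *ᵥ x) = mobiusMat a b c d *ᵥ rangeVec (A *ᵥ x) x := by
    intro x
    have e1 : (V * (((a : ℂ) • A + (b : ℂ) • 1) * C⁻¹) * star V) * (V * C) =
        V * ((a : ℂ) • A + (b : ℂ) • 1) := by
      calc _ = V * ((a : ℂ) • A + (b : ℂ) • 1) * (C⁻¹ * (star V * V) * C) := by
            simp only [Matrix.mul_assoc]
        _ = _ := by rw [hVV, Matrix.mul_one, Matrix.nonsing_inv_mul C hCu, Matrix.mul_one]
    rw [Matrix.mulVec_mulVec, e1, ← Matrix.mulVec_mulVec, ← Matrix.mulVec_mulVec,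
      rangeVec_unitary hV, ← rangeVec_mobius]
    have h1 : ∀ e f : ℂ, (e • A + f • (1 : Matrix (Fin 2) (Fin 2) ℂ)) *ᵥ x =
        e • (A *ᵥ x) + f • x := by
      intros; rw [Matrix.add_mulVec, Matrix.smul_mulVec, Matrix.smul_mulVec, Matrix.one_mulVec]
    rw [hC, h1, h1]
  ext p
  rw [mem_conformalRange]
  constructor
  · rintro ⟨q, hq, rfl⟩
    obtain ⟨x, hx, rfl⟩ := mem_conformalRange.1 hq
    refine ⟨(V * C) *ᵥ x, fun h0 => hx ?_, ?_⟩
    · have : (C⁻¹ * star V) *ᵥ ((V * C) *ᵥ x) = x := by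
        rw [Matrix.mulVec_mulVec, Matrix.mul_assoc, ← Matrix.mul_assoc (star V), hVV,
          Matrix.one_mul, Matrix.nonsing_inv_mul C hCu, Matrix.one_mulVec]
      rw [← this, h0, Matrix.mulVec_zero]
    · rw [key, act_dehomog M (rangeVec_two_pos hx _).ne', hMm]
  · rintro ⟨x, hx, rfl⟩
    have hxe : (V * C) *ᵥ ((C⁻¹ * star V) *ᵥ x) = x := by
      rw [Matrix.mulVec_mulVec, Matrix.mul_assoc, ← Matrix.mul_assoc C,
        Matrix.mul_nonsing_inv C hCu, Matrix.one_mul, hVV', Matrix.one_mulVec]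
    have hx0 : (C⁻¹ * star V) *ᵥ x ≠ 0 := fun h0 => hx (by rw [← hxe, h0, Matrix.mulVec_zero])
    refine ⟨_, mem_conformalRange.2 ⟨_, hx0, rfl⟩, ?_⟩
    rw [act_dehomog M (rangeVec_two_pos hx0 _).ne', hMm, ← key, hxe]

/-! ### The conformal range of the canonical representatives -/

/-- Surjectivity of the Hopf map from unit vectors of ℂ² to the sphere. The phase is chosen so that
x₀ > 0, which fails only at the pole p = -1. -/
lemma exists_blochVector {p q r : ℝ} (h : p ^ 2 + q ^ 2 + r ^ 2 = 1) :
    ∃ x : Fin 2 → ℂ, x ≠ 0 ∧ Complex.normSq (x 0) + Complex.normSq (x 1) = 1 ∧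
      Complex.normSq (x 0) - Complex.normSq (x 1) = p ∧
      2 * ((x 0).re * (x 1).re + (x 0).im * (x 1).im) = q ∧
      2 * ((x 0).re * (x 1).im - (x 0).im * (x 1).re) = r := by
  have hne : ∀ x : Fin 2 → ℂ, Complex.normSq (x 0) + Complex.normSq (x 1) = 1 → x ≠ 0 := by
    rintro x hx rfl; simp at hx
  by_cases hp : p = -1
  · subst hp
    have hq : q = 0 := by nlinarith [sq_nonneg q, sq_nonneg r]
    have hr : r = 0 := by nlinarith [sq_nonneg q, sq_nonneg r]
    subst hq hr
    exact ⟨![0, 1], hne _ (by simp), by simp, by simp, by simp, by simp⟩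
  · have hp1 : -1 ≤ p := by nlinarith [sq_nonneg q, sq_nonneg r]
    have hp2 : 0 < (1 + p) / 2 := by
      have := lt_of_le_of_ne hp1 (Ne.symm hp); linarith
    set s := √((1 + p) / 2) with hs
    have hs0 : 0 < s := Real.sqrt_pos.2 hp2
    have hs2 : s ^ 2 = (1 + p) / 2 := Real.sq_sqrt hp2.le
    have h1 : Complex.normSq ((![(⟨s, 0⟩ : ℂ), ⟨q / (2 * s), r / (2 * s)⟩] : Fin 2 → ℂ) 0) =
        (1 + p) / 2 := by
      simp [Complex.normSq_apply]; linarith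
    have h2 : Complex.normSq ((![(⟨s, 0⟩ : ℂ), ⟨q / (2 * s), r / (2 * s)⟩] : Fin 2 → ℂ) 1) =
        (1 - p) / 2 := by
      simp only [Matrix.cons_val_one, Complex.normSq_apply, Matrix.cons_val_fin_one]
      have : q / (2 * s) * (q / (2 * s)) + r / (2 * s) * (r / (2 * s)) =
          (q ^ 2 + r ^ 2) / (4 * s ^ 2) := by field_simp; ring
      rw [this, hs2, div_eq_iff (by linarith)]
      linear_combination h
    refine ⟨![⟨s, 0⟩, ⟨q / (2 * s), r / (2 * s)⟩], hne _ (by rw [h1, h2]; ring),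
      by rw [h1, h2]; ring, by rw [h1, h2]; ring, ?_, ?_⟩
    · simp; field_simp
    · simp; field_simp

lemma blochVector_identity (z w : ℂ) :
    (Complex.normSq z - Complex.normSq w) ^ 2 + (2 * (z.re * w.re + z.im * w.im)) ^ 2 +
      (2 * (z.re * w.im - z.im * w.re)) ^ 2 = (Complex.normSq z + Complex.normSq w) ^ 2 := by
  simp only [Complex.normSq_apply]; ring

lemma normSq_add_pos {x : Fin 2 → ℂ} (hx : x ≠ 0) :
    0 < Complex.normSq (x 0) + Complex.normSq (x 1) := by
  have := re_star_dotProduct_pos hx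
  rw [re_star_dotProduct] at this
  simp only [Complex.normSq_apply]; linarith

/-- The range vector is linear in |x|² and the Bloch vector (p, q, r), so the conformal range is a
projective image of the sphere; the sign ε drops out. -/
lemma rangeVec_matL (α t ε : ℝ) (hε : ε = 1 ∨ ε = -1) (x : Fin 2 → ℂ) {n p q r : ℝ}
    (hn : Complex.normSq (x 0) + Complex.normSq (x 1) = n)
    (hp : Complex.normSq (x 0) - Complex.normSq (x 1) = p)
    (hq : 2 * ((x 0).re * (x 1).re + (x 0).im * (x 1).im) = q)
    (hr : 2 * ((x 0).re * (x 1).im - (x 0).im * (x 1).re) = r) :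
    rangeVec (matL α t ε *ᵥ x) x =
      ![2 * Real.cos α * p + 2 * t * q,
        2 * t ^ 2 * (n - p) + 2 * t * (q * Real.cos α + r * Real.sin α),
        2 * n + 2 * t ^ 2 * (n - p) + 2 * t * (q * Real.cos α + r * Real.sin α)] := by
  have hcs := Real.sin_sq_add_cos_sq α
  have hε2 : ε ^ 2 = 1 := by rcases hε with rfl | rfl <;> norm_num
  subst hn hp hq hr
  have e0 : ((matL α t ε *ᵥ x) 0) = ((Real.cos α : ℂ) + Complex.I * (Real.sin α : ℂ)) * x 0 +
      2 * (t : ℂ) * x 1 := by simp [matL, Matrix.mulVec, dotProduct, Fin.sum_univ_two]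
  have e1 : ((matL α t ε *ᵥ x) 1) =
      (-(Real.cos α : ℂ) + (ε : ℂ) * (Complex.I * (Real.sin α : ℂ))) * x 1 := by
    simp [matL, Matrix.mulVec, dotProduct, Fin.sum_univ_two]
  generalize Real.cos α = c at *
  generalize Real.sin α = s at *
  have r0 : ((matL α t ε *ᵥ x) 0).re = c * (x 0).re - s * (x 0).im + 2 * t * (x 1).re := by
    rw [e0]; simp
  have i0 : ((matL α t ε *ᵥ x) 0).im = c * (x 0).im + s * (x 0).re + 2 * t * (x 1).im := by
    rw [e0]; simp
  have r1 : ((matL α t ε *ᵥ x) 1).re = -c * (x 1).re - ε * s * (x 1).im := by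
    rw [e1]; simp
  have i1 : ((matL α t ε *ᵥ x) 1).im = -c * (x 1).im + ε * s * (x 1).re := by
    rw [e1]; simp
  have hy : (star (matL α t ε *ᵥ x) ⬝ᵥ (matL α t ε *ᵥ x)).re = (x 0).re ^ 2 + (x 0).im ^ 2 +
      ((x 1).re ^ 2 + (x 1).im ^ 2) + 4 * t ^ 2 * ((x 1).re ^ 2 + (x 1).im ^ 2) +
      4 * t * (c * ((x 0).re * (x 1).re + (x 0).im * (x 1).im) +
        s * ((x 0).re * (x 1).im - (x 0).im * (x 1).re)) := by
    rw [re_star_dotProduct, r0, i0, r1, i1]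
    linear_combination ((x 0).re ^ 2 + (x 0).im ^ 2 + ((x 1).re ^ 2 + (x 1).im ^ 2)) * hcs +
      s ^ 2 * ((x 1).re ^ 2 + (x 1).im ^ 2) * hε2
  ext i
  fin_cases i
  · simp only [rangeVec, Fin.zero_eta, Matrix.cons_val_zero]
    rw [re_star_dotProduct, r0, i0, r1, i1]
    simp only [Complex.normSq_apply]; ring
  · simp only [rangeVec, Fin.mk_one, Matrix.cons_val_one, Matrix.cons_val_zero]
    rw [hy, re_star_dotProduct]
    simp only [Complex.normSq_apply]; ring
  · simp only [rangeVec, Fin.reduceFinMk, Matrix.cons_val]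
    rw [hy, re_star_dotProduct]
    simp only [Complex.normSq_apply]; ring

/-- Polar coordinates for (c, t), with an arbitrary direction in the case of the origin. -/
lemma exists_unit_pair (c t : ℝ) :
    ∃ c' t' : ℝ, c' ^ 2 + t' ^ 2 = 1 ∧ c = √(c ^ 2 + t ^ 2) * c' ∧ t = √(c ^ 2 + t ^ 2) * t' := by
  rcases eq_or_ne (c ^ 2 + t ^ 2) 0 with h | h
  · have hc : c = 0 := by nlinarith [sq_nonneg c, sq_nonneg t]
    have ht : t = 0 := by nlinarith [sq_nonneg c, sq_nonneg t]
    exact ⟨1, 0, by norm_num, by simp [hc, ht], by simp [hc, ht]⟩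
  · have hpos : 0 < c ^ 2 + t ^ 2 := lt_of_le_of_ne (by positivity) h.symm
    have hs := Real.sqrt_pos.2 hpos
    refine ⟨c / √(c ^ 2 + t ^ 2), t / √(c ^ 2 + t ^ 2), ?_, by field_simp, by field_simp⟩
    rw [div_pow, div_pow, ← add_div, Real.sq_sqrt hpos.le, div_self h]

/-- Let E and F be the components of the Bloch vector along the orthonormal vectors (-t, c, s)/T and
(c', t', 0), where T² = 1 + t². The homogeneous coordinates become 2ρF, 2t(tn + TE), 2T(nT + tE).
The map (E, F)/n ↦ (F, tn + TE)/(nT + tE) is a boost followed by a swap of the axes, hence a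
bijection of the unit disk, and what remains is scaling by ρ/T and t/T. -/
theorem conformalRange_matL {α t ε : ℝ} (ht : 0 ≤ t) (hε : ε = 1 ∨ ε = -1) :
    conformalRange (matL α t ε) =
      centralEllipse (√(Real.cos α ^ 2 + t ^ 2) / √(1 + t ^ 2)) (t / √(1 + t ^ 2)) := by
  obtain ⟨c', t', hct, hc, ht'⟩ := exists_unit_pair (Real.cos α) t
  have hcs := Real.sin_sq_add_cos_sq α
  have hL := fun x n p q r => rangeVec_matL α t ε hε x (n := n) (p := p) (q := q) (r := r)
  have hρ2 := Real.sq_sqrt (show 0 ≤ Real.cos α ^ 2 + t ^ 2 by positivity)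
  have hT2 := Real.sq_sqrt (show 0 ≤ 1 + t ^ 2 by positivity)
  have hT : 0 < √(1 + t ^ 2) := Real.sqrt_pos.2 (by positivity)
  set ρ := √(Real.cos α ^ 2 + t ^ 2) with hρ
  set T := √(1 + t ^ 2)
  generalize Real.cos α = c at *
  generalize Real.sin α = s at *
  ext P
  rw [mem_conformalRange, mem_centralEllipse]
  constructor
  · rintro ⟨x, hx, rfl⟩
    have hW := rangeVec_two_pos hx (matL α t ε *ᵥ x)
    have hn0 := normSq_add_pos hx
    have hid := blochVector_identity (x 0) (x 1)
    rw [hL x _ _ _ _ rfl rfl rfl rfl] at hW ⊢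
    generalize Complex.normSq (x 0) + Complex.normSq (x 1) = n at *
    generalize Complex.normSq (x 0) - Complex.normSq (x 1) = p at *
    generalize 2 * ((x 0).re * (x 1).re + (x 0).im * (x 1).im) = q at *
    generalize 2 * ((x 0).re * (x 1).im - (x 0).im * (x 1).re) = r at *
    set E := (-t * p + c * q + s * r) / T with hE
    have hE' : T * E = -t * p + c * q + s * r := by rw [hE]; field_simp
    set F := c' * p + t' * q with hF
    -- The right-hand side is the square of the third component of the Bloch vector in this
    -- orthonormal frame, so E² + F² ≤ n².
    have hG : n ^ 2 - E ^ 2 - F ^ 2 = ((s * (c' * q - t' * p) - ρ * r) / T) ^ 2 := by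
      have h1 : T ^ 2 * (n ^ 2 - E ^ 2 - F ^ 2) = (s * (c' * q - t' * p) - ρ * r) ^ 2 := by
        have h2 : T ^ 2 * E ^ 2 = (ρ * (c' * q - t' * p) + s * r) ^ 2 := by
          rw [← mul_pow, hE']; congr 1; linear_combination q * hc - p * ht'
        have h3 : T ^ 2 = ρ ^ 2 + s ^ 2 := by linear_combination hT2 - hρ2 - hcs
        have h4 : T ^ 2 * (n ^ 2 - E ^ 2 - F ^ 2) = T ^ 2 * (n ^ 2 - F ^ 2) - T ^ 2 * E ^ 2 := by
          ring
        rw [h4, h2, h3, hF]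
        linear_combination (-(ρ ^ 2 + s ^ 2)) * hid - (ρ ^ 2 + s ^ 2) * (p ^ 2 + q ^ 2) * hct
      have h5 : ((s * (c' * q - t' * p) - ρ * r) / T) ^ 2 =
          (s * (c' * q - t' * p) - ρ * r) ^ 2 / T ^ 2 := div_pow _ _ _
      rw [h5, eq_div_iff (by positivity), mul_comm]; exact h1
    have hGn : 0 ≤ n ^ 2 - E ^ 2 - F ^ 2 := by rw [hG]; positivity
    have hW' : 2 * n + 2 * t ^ 2 * (n - p) + 2 * t * (q * c + r * s) = 2 * T * (n * T + t * E) := by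
      linear_combination -2 * n * hT2 - 2 * t * hE'
    have hWpos : 0 < n * T + t * E := by
      simp only [Matrix.cons_val] at hW
      rw [hW'] at hW
      exact pos_of_mul_pos_right hW (by positivity)
    refine ⟨F / (n * T + t * E), (t * n + T * E) / (n * T + t * E), ?_, ?_⟩
    · rw [div_pow, div_pow, ← add_div, div_le_one (by positivity)]
      nlinarith
    · simp only [dehomog, Matrix.cons_val_zero, Matrix.cons_val_one, Matrix.cons_val]
      rw [hW', div_mul_div_comm, div_mul_div_comm]
      ext
      · simp only
        rw [div_eq_div_iff (by positivity) (by positivity), hF]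
        linear_combination (2 * T * (n * T + t * E)) * (p * hc + q * ht')
      · simp only
        rw [div_eq_div_iff (by positivity) (by positivity)]
        linear_combination (-2 * t * T * (n * T + t * E)) * hE'
  · rintro ⟨u, v, huv, rfl⟩
    have hTt : 0 < T - t * v := by
      have h1 : v ≤ 1 := by nlinarith [sq_nonneg u]
      have h2 : t < T := by nlinarith
      nlinarith
    -- The inverse boost applied to (u, v).
    set E := (T * v - t) / (T - t * v) with hE
    set F := u / (T - t * v) with hF
    have hEF : 0 ≤ 1 - E ^ 2 - F ^ 2 := by
      rw [hE, hF, div_pow, div_pow, sub_sub, ← add_div, sub_nonneg, div_le_one (by positivity)]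
      nlinarith
    set G := √(1 - E ^ 2 - F ^ 2)
    have hG : G ^ 2 = 1 - E ^ 2 - F ^ 2 := Real.sq_sqrt hEF
    have h3 : T ^ 2 = ρ ^ 2 + s ^ 2 := by linear_combination hT2 - hρ2 - hcs
    have hT0 := hT.ne'
    -- The Bloch vector with components E, F, G in the orthonormal frame.
    set p := (-(ρ * t') * E - s * t' * G) / T + F * c' with hp
    set q := (ρ * c' * E + s * c' * G) / T + F * t' with hq
    set r := (s * E - ρ * G) / T with hr
    have hpTq : c' * p + t' * q = F := by
      rw [hp, hq]; field_simp
      linear_combination T * F * hct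
    have hqp : T * (c' * q - t' * p) = ρ * E + s * G := by
      rw [hp, hq]; field_simp
      linear_combination (ρ * E + s * G) * hct
    have hrT : T * r = s * E - ρ * G := by rw [hr]; field_simp
    have hsph : p ^ 2 + q ^ 2 + r ^ 2 = 1 := by
      have e1 : T ^ 2 * (p ^ 2 + q ^ 2 + r ^ 2) = T ^ 2 * (c' * p + t' * q) ^ 2 +
          (T * (c' * q - t' * p)) ^ 2 + (T * r) ^ 2 := by
        linear_combination (-T ^ 2 * (p ^ 2 + q ^ 2)) * hct
      rw [hpTq, hqp, hrT] at e1
      have e2 : T ^ 2 * (p ^ 2 + q ^ 2 + r ^ 2 - 1) = 0 := by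
        linear_combination e1 + T ^ 2 * hG - (E ^ 2 + G ^ 2) * h3
      have := (mul_eq_zero.1 e2).resolve_left (by positivity)
      linarith
    obtain ⟨x, hx, h1, h2, h4, h5⟩ := exists_blochVector hsph
    refine ⟨x, hx, ?_⟩
    rw [hL x 1 p q r h1 h2 h4 h5]
    have hTE : -t * p + c * q + s * r = T * E := by
      have : T * (-t * p + c * q + s * r - T * E) = 0 := by
        linear_combination (T * q) * hc - (T * p) * ht' + ρ * hqp + s * hrT - E * h3
      linarith [(mul_eq_zero.1 this).resolve_left hT0]
    have hW' : 2 * 1 + 2 * t ^ 2 * (1 - p) + 2 * t * (q * c + r * s) = 2 * T / (T - t * v) := by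
      have : 2 * 1 + 2 * t ^ 2 * (1 - p) + 2 * t * (q * c + r * s) = 2 * T * (T + t * E) := by
        linear_combination -2 * hT2 + 2 * t * hTE
      rw [this, hE]; field_simp; linear_combination hT2
    have hF' : F * (T - t * v) = u := by rw [hF]; field_simp
    have hE' : E * (T - t * v) = T * v - t := by
      rw [hE, div_mul_cancel₀ _ hTt.ne']
    simp only [dehomog, Matrix.cons_val_zero, Matrix.cons_val_one, Matrix.cons_val]
    rw [hW']
    ext
    · simp only
      rw [show 2 * c * p + 2 * t * q = 2 * ρ * F by
        rw [← hpTq]; linear_combination 2 * p * hc + 2 * q * ht']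
      field_simp; linear_combination -ρ * hF'
    · simp only
      rw [show 2 * t ^ 2 * (1 - p) + 2 * t * (q * c + r * s) = 2 * t * (t + T * E) by
        linear_combination 2 * t * hTE]
      rw [div_div_eq_mul_div, div_mul_eq_mul_div, div_eq_div_iff hT0 (by positivity)]
      linear_combination (-2 * t * T ^ 2) * hE' - 2 * t * T * v * hT2

/-- Only |x₀|², |x₁|² and q = 2 Re(x̄₀x₁) enter. Their values are restricted exactly by q² ≤
4|x₀|²|x₁|², which is the inequality of `mem_parabolicDisk`. -/
theorem conformalRange_matS (β : ℝ) : conformalRange (matS β) = parabolicDisk (Real.cos β) := by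
  have hcs := Real.sin_sq_add_cos_sq β
  have hS : ∀ x : Fin 2 → ℂ, rangeVec (matS β *ᵥ x) x =
      ![Real.cos β * (2 * ((x 0).re * (x 1).re + (x 0).im * (x 1).im)),
        -Complex.normSq (x 0), Complex.normSq (x 0) + 2 * Complex.normSq (x 1)] := by
    intro x
    have e0 : (matS β *ᵥ x) 0 = (Real.cos β : ℂ) * x 1 := by
      simp [matS, Matrix.mulVec, dotProduct, Fin.sum_univ_two]
    have e1 : (matS β *ᵥ x) 1 = Complex.I * (Real.sin β : ℂ) * x 1 := by
      simp [matS, Matrix.mulVec, dotProduct, Fin.sum_univ_two]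
    generalize Real.cos β = c at *
    generalize Real.sin β = s at *
    have r0 : ((matS β *ᵥ x) 0).re = c * (x 1).re := by rw [e0]; simp
    have i0 : ((matS β *ᵥ x) 0).im = c * (x 1).im := by rw [e0]; simp
    have r1 : ((matS β *ᵥ x) 1).re = -(s * (x 1).im) := by rw [e1]; simp
    have i1 : ((matS β *ᵥ x) 1).im = s * (x 1).re := by rw [e1]; simp
    ext i
    fin_cases i <;>
      simp only [rangeVec, Fin.zero_eta, Matrix.cons_val_zero, Fin.mk_one, Matrix.cons_val_one,
        Fin.reduceFinMk, Matrix.cons_val, re_star_dotProduct, r0, i0, r1, i1, Complex.normSq_apply]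
    · ring
    · linear_combination ((x 1).re ^ 2 + (x 1).im ^ 2) * hcs
    · linear_combination ((x 1).re ^ 2 + (x 1).im ^ 2) * hcs
  generalize Real.cos β = c at *
  ext P
  rw [mem_conformalRange]
  constructor
  · rintro ⟨x, hx, rfl⟩
    rw [hS, mem_parabolicDisk]
    have hid := blochVector_identity (x 0) (x 1)
    have hn0 := normSq_add_pos hx
    have h0 := Complex.normSq_nonneg (x 0)
    have h1 := Complex.normSq_nonneg (x 1)
    simp only [dehomog, Matrix.cons_val_zero, Matrix.cons_val_one, Matrix.cons_val]
    generalize Complex.normSq (x 0) = n at *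
    generalize Complex.normSq (x 1) = m at *
    generalize 2 * ((x 0).re * (x 1).re + (x 0).im * (x 1).im) = q at *
    have hq : q ^ 2 ≤ 4 * n * m := by
      nlinarith [sq_nonneg (2 * ((x 0).re * (x 1).im - (x 0).im * (x 1).re))]
    have hW : 0 < n + 2 * m := by linarith
    refine ⟨?_, ?_, ?_⟩
    · have e : -2 * c ^ 2 * (-n / (n + 2 * m) * (1 + -n / (n + 2 * m))) =
          c ^ 2 * (4 * n * m) / (n + 2 * m) ^ 2 := by field_simp; ring
      rw [e, div_pow, mul_pow]
      gcongr
    · rw [le_div_iff₀ hW]; linarith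
    · exact div_nonpos_of_nonpos_of_nonneg (by linarith) hW.le
  · rintro ⟨⟨u, v⟩, huv, rfl⟩
    have h2 := sqrt_two_sq
    have h20 : 0 < √2 := by positivity
    rw [mem_closedPlane] at huv
    simp only at huv
    have hv : v ≤ 1 := by nlinarith [sq_nonneg u]
    have h3 : 0 < 3 - v := by linarith
    have hr : 0 ≤ 1 - ((1 - 3 * v) / (3 - v)) ^ 2 - (2 * √2 * u / (3 - v)) ^ 2 := by
      rw [div_pow, div_pow, sub_sub, ← add_div, sub_nonneg, div_le_one (by positivity), mul_pow,
        mul_pow, h2]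
      nlinarith
    -- Obtained by solving the two coordinate equations for |x₀|² and q under |x| = 1; r then
    -- completes the vector to unit length.
    obtain ⟨x, hx, e1, e2, e3, -⟩ := exists_blochVector
      (p := (1 - 3 * v) / (3 - v)) (q := 2 * √2 * u / (3 - v))
      (r := √(1 - ((1 - 3 * v) / (3 - v)) ^ 2 - (2 * √2 * u / (3 - v)) ^ 2))
      (by rw [Real.sq_sqrt hr]; ring)
    refine ⟨x, hx, ?_⟩
    have f0 : Complex.normSq (x 0) = (2 - 2 * v) / (3 - v) := by
      have : 2 * Complex.normSq (x 0) = 1 + (1 - 3 * v) / (3 - v) := by linarith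
      have h4 : 1 + (1 - 3 * v) / (3 - v) = 2 * ((2 - 2 * v) / (3 - v)) := by field_simp; ring
      linarith
    have f1 : Complex.normSq (x 0) + 2 * Complex.normSq (x 1) = 4 / (3 - v) := by
      have : Complex.normSq (x 0) + 2 * Complex.normSq (x 1) =
        2 - (2 - 2 * v) / (3 - v) := by linarith
      rw [this]; field_simp; ring
    rw [hS, e3, f1, f0]
    simp only [dehomog, Matrix.cons_val_zero, Matrix.cons_val_one, Matrix.cons_val]
    ext
    · simp only; field_simp; rw [h2]; ring
    · simp only; field_simp; ring

theorem conformalRange_zero : conformalRange 0 = {(0, -1)} := by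
  ext p
  rw [mem_conformalRange, Set.mem_singleton_iff]
  have key : ∀ x : Fin 2 → ℂ, x ≠ 0 →
      dehomog (rangeVec ((0 : Matrix (Fin 2) (Fin 2) ℂ) *ᵥ x) x) = (0, -1) := by
    intro x hx
    have := (re_star_dotProduct_pos hx).ne'
    simp only [rangeVec, Matrix.zero_mulVec, star_zero, zero_dotProduct, Complex.zero_re]
    generalize (star x ⬝ᵥ x).re = n at *
    simp [dehomog, this]
  constructor
  · rintro ⟨x, hx, rfl⟩; exact key x hx
  · rintro rfl
    have hx : (![1, 0] : Fin 2 → ℂ) ≠ 0 := fun h => by simpa using congrFun h 0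
    exact ⟨_, hx, (key _ hx).symm⟩

/-! ### Real Möbius equivalence and triangular forms -/

theorem realMobiusEquiv_iff {A B : Matrix (Fin 2) (Fin 2) ℂ} :
    RealMobiusEquiv A B ↔ ∃ a b c d : ℝ, a * d - b * c ≠ 0 ∧
      ((c : ℂ) • A + (d : ℂ) • (1 : Matrix (Fin 2) (Fin 2) ℂ)).det ≠ 0 ∧
      ∃ V ∈ Matrix.unitaryGroup (Fin 2) ℂ,
        B * V * ((c : ℂ) • A + (d : ℂ) • 1) = V * ((a : ℂ) • A + (b : ℂ) • 1) := by
  refine exists_congr fun a => exists_congr fun b => exists_congr fun c => exists_congr fun d =>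
    and_congr_right fun _ => and_congr_right fun hdet => exists_congr fun V =>
    and_congr_right fun hV => ?_
  set N := (c : ℂ) • A + (d : ℂ) • (1 : Matrix (Fin 2) (Fin 2) ℂ)
  set M := (a : ℂ) • A + (b : ℂ) • (1 : Matrix (Fin 2) (Fin 2) ℂ)
  have hN : IsUnit N.det := isUnit_iff_ne_zero.2 hdet
  have hVV : star V * V = 1 := Matrix.mem_unitaryGroup_iff'.1 hV
  have hVV' : V * star V = 1 := Matrix.mem_unitaryGroup_iff.1 hV
  constructor
  · rintro rfl
    calc V * (M * N⁻¹) * star V * V * N = V * M * (N⁻¹ * (star V * V) * N) := by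
          simp only [Matrix.mul_assoc]
      _ = V * M := by rw [hVV, Matrix.mul_one, Matrix.nonsing_inv_mul N hN, Matrix.mul_one]
  · intro h
    calc B = B * V * (N * N⁻¹) * star V := by
          rw [Matrix.mul_nonsing_inv N hN, Matrix.mul_one, Matrix.mul_assoc, hVV', Matrix.mul_one]
      _ = B * V * N * N⁻¹ * star V := by simp only [Matrix.mul_assoc]
      _ = V * (M * N⁻¹) * star V := by rw [h]; simp only [Matrix.mul_assoc]

lemma det_ne_zero_of_mem_unitaryGroup {V : Matrix (Fin 2) (Fin 2) ℂ}
    (hV : V ∈ Matrix.unitaryGroup (Fin 2) ℂ) : V.det ≠ 0 := by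
  have := congrArg Matrix.det (Matrix.mem_unitaryGroup_iff.1 hV)
  rw [Matrix.det_mul, Matrix.det_one] at this
  exact left_ne_zero_of_mul_eq_one this

theorem RealMobiusEquiv.trans {A B C : Matrix (Fin 2) (Fin 2) ℂ} (h : RealMobiusEquiv A B)
    (h' : RealMobiusEquiv B C) : RealMobiusEquiv A C := by
  rw [realMobiusEquiv_iff] at *
  obtain ⟨a, b, c, d, h1, h2, V, hV, h3⟩ := h
  obtain ⟨a', b', c', d', h1', h2', V', hV', h3'⟩ := h'
  set N := (c : ℂ) • A + (d : ℂ) • (1 : Matrix (Fin 2) (Fin 2) ℂ) with hN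
  set M := (a : ℂ) • A + (b : ℂ) • (1 : Matrix (Fin 2) (Fin 2) ℂ) with hM
  have e1 : ∀ x y : ℝ, (((x * a + y * c : ℝ) : ℂ) • A + ((x * b + y * d : ℝ) : ℂ) •
      (1 : Matrix (Fin 2) (Fin 2) ℂ)) = (x : ℂ) • M + (y : ℂ) • N := by
    intro x y; rw [hM, hN]; push_cast; module
  have e2 : ∀ x y : ℝ, V * ((x : ℂ) • M + (y : ℂ) • N) = ((x : ℂ) • B + (y : ℂ) • 1) * V * N := by
    intro x y
    simp only [Matrix.mul_add, Matrix.add_mul, Matrix.mul_smul, Matrix.smul_mul, Matrix.one_mul, h3]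
  refine ⟨a' * a + b' * c, a' * b + b' * d, c' * a + d' * c, c' * b + d' * d, ?_, ?_, V' * V,
    mul_mem hV' hV, ?_⟩
  · have := mul_ne_zero h1 h1'
    convert this using 1; ring
  · rw [e1]
    intro h0
    have := congrArg Matrix.det (e2 c' d')
    rw [Matrix.det_mul, Matrix.det_mul, Matrix.det_mul, h0, mul_zero] at this
    exact mul_ne_zero (mul_ne_zero h2' (det_ne_zero_of_mem_unitaryGroup hV)) h2 this.symm
  · rw [e1, e1, ← Matrix.mul_assoc, Matrix.mul_assoc _ V, e2, Matrix.mul_assoc V' V, e2,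
      ← Matrix.mul_assoc, ← Matrix.mul_assoc, h3', ← Matrix.mul_assoc, ← Matrix.mul_assoc]

lemma RealMobiusEquiv.of_unitary {A B V : Matrix (Fin 2) (Fin 2) ℂ}
    (hV : V ∈ Matrix.unitaryGroup (Fin 2) ℂ) (h : B * V = V * A) : RealMobiusEquiv A B :=
  realMobiusEquiv_iff.2 ⟨1, 0, 0, 1, by simp, by simp, V, hV, by simpa using h⟩

/-- The upper triangular matrix with diagonal entries `l`, `m` and off-diagonal entry `s`. -/
def upperTri (l s m : ℂ) : Matrix (Fin 2) (Fin 2) ℂ := !![l, s; 0, m]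

lemma smul_upperTri_add (x y : ℝ) (l s m : ℂ) :
    (x : ℂ) • upperTri l s m + (y : ℂ) • 1 = upperTri (x * l + y) (x * s) (x * m + y) := by
  ext i j; fin_cases i <;> fin_cases j <;> simp [upperTri]

lemma upperTri_mul (l s m l' s' m' : ℂ) :
    upperTri l s m * upperTri l' s' m' = upperTri (l * l') (l * s' + s * m') (m * m') := by
  simp [upperTri]

lemma det_upperTri (l s m : ℂ) : (upperTri l s m).det = l * m := by
  simp [upperTri, Matrix.det_fin_two]

/-- The off-diagonal entry of f(A) is s times the divided difference of f at l and m, which for f(λ)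
= (aλ + b)/(cλ + d) is (ad - bc)/((cl + d)(cm + d)). The formula also covers l = m. -/
lemma upperTri_mobius {a b c d : ℝ} {l s m l' m' : ℂ} (hl : c * l + d ≠ 0) (hm : c * m + d ≠ 0)
    (hl' : l' * (c * l + d) = a * l + b) (hm' : m' * (c * m + d) = a * m + b) :
    upperTri l' ((a * d - b * c) * s / ((c * l + d) * (c * m + d))) m' *
      ((c : ℂ) • upperTri l s m + (d : ℂ) • 1) = (a : ℂ) • upperTri l s m + (b : ℂ) • 1 := by
  rw [smul_upperTri_add, smul_upperTri_add, upperTri_mul, hl', hm']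
  congr 1
  rw [← mul_left_inj' hl]
  field_simp
  linear_combination (c * s) * hl'

lemma realMobiusEquiv_upperTri {a b c d : ℝ} {l s m l' m' : ℂ} (h : a * d - b * c ≠ 0)
    (hl : c * l + d ≠ 0) (hm : c * m + d ≠ 0) (hl' : l' * (c * l + d) = a * l + b)
    (hm' : m' * (c * m + d) = a * m + b) :
    RealMobiusEquiv (upperTri l s m)
      (upperTri l' ((a * d - b * c) * s / ((c * l + d) * (c * m + d))) m') := by
  refine realMobiusEquiv_iff.2 ⟨a, b, c, d, h, ?_, 1, one_mem _, ?_⟩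
  · rw [smul_upperTri_add, det_upperTri]; exact mul_ne_zero hl hm
  · rw [Matrix.mul_one, Matrix.one_mul, upperTri_mobius hl hm hl' hm']

/-- Schur triangularization with a prescribed first eigenvalue. -/
theorem exists_schur {A : Matrix (Fin 2) (Fin 2) ℂ} {l m : ℂ} (htr : A.trace = l + m)
    (hdet : A.det = l * m) :
    ∃ s : ℂ, ∃ V ∈ Matrix.unitaryGroup (Fin 2) ℂ, upperTri l s m * V = V * A := by
  have h0 : (A - l • 1).det = 0 := by
    rw [Matrix.det_fin_two] at *
    rw [Matrix.trace_fin_two] at htr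
    simp only [Matrix.sub_apply, Matrix.smul_apply, Matrix.one_apply_eq, smul_eq_mul, mul_one,
      ne_eq, zero_ne_one, one_ne_zero, not_false_eq_true, Matrix.one_apply_ne, mul_zero, sub_zero]
    linear_combination hdet - l * htr
  obtain ⟨x, hx, hAx⟩ := Matrix.exists_mulVec_eq_zero_iff.2 h0
  rw [Matrix.sub_mulVec, Matrix.smul_mulVec, Matrix.one_mulVec, sub_eq_zero] at hAx
  have hpos := re_star_dotProduct_pos hx
  rw [re_star_dotProduct] at hpos
  set n := √(Complex.normSq (x 0) + Complex.normSq (x 1)) with hn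
  have hn2 : n ^ 2 = Complex.normSq (x 0) + Complex.normSq (x 1) := Real.sq_sqrt hpos.le
  have hn0 : 0 < n := Real.sqrt_pos.2 hpos
  have hnc : (n : ℂ) ≠ 0 := by exact_mod_cast hn0.ne'
  have a0 : A 0 0 * x 0 + A 0 1 * x 1 = l * x 0 := by
    simpa [Matrix.mulVec, dotProduct, Fin.sum_univ_two] using congrFun hAx 0
  have a1 : A 1 0 * x 0 + A 1 1 * x 1 = l * x 1 := by
    simpa [Matrix.mulVec, dotProduct, Fin.sum_univ_two] using congrFun hAx 1
  obtain ⟨u, hu⟩ : ∃ u, x 0 = n * u := ⟨x 0 / n, by field_simp⟩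
  obtain ⟨v, hv⟩ : ∃ v, x 1 = n * v := ⟨x 1 / n, by field_simp⟩
  rw [hu, hv] at a0 a1
  have b0 : A 0 0 * u + A 0 1 * v = l * u := mul_left_cancel₀ hnc (by linear_combination a0)
  have b1 : A 1 0 * u + A 1 1 * v = l * v := mul_left_cancel₀ hnc (by linear_combination a1)
  have huv : u * star u + v * star v = 1 := by
    have : Complex.normSq u + Complex.normSq v = 1 := by
      rw [hu, hv, map_mul, map_mul, Complex.normSq_ofReal] at hn2
      have : n ^ 2 * (Complex.normSq u + Complex.normSq v - 1) = 0 := by linear_combination -hn2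
      linarith [(mul_eq_zero.1 this).resolve_left (by positivity)]
    rw [Complex.star_def, Complex.mul_conj, Complex.mul_conj]
    exact_mod_cast this
  rw [Matrix.trace_fin_two] at htr
  -- V maps the unit eigenvector (u, v) to the first basis vector.
  set V : Matrix (Fin 2) (Fin 2) ℂ := !![star u, star v; -v, u] with hV
  have hVs : star V = !![u, -star v; v, star u] := by
    ext i j; fin_cases i <;> fin_cases j <;> simp [hV, Matrix.star_apply]
  have hVV : V * star V = 1 := by
    rw [hVs, hV, Matrix.mul_fin_two, Matrix.one_fin_two]
    rw [Complex.star_def] at *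
    ext i j; fin_cases i <;> fin_cases j <;> simp <;> first | linear_combination huv | ring
  have hVm : V ∈ Matrix.unitaryGroup (Fin 2) ℂ := Matrix.mem_unitaryGroup_iff.2 hVV
  have hVV' : star V * V = 1 := Matrix.mem_unitaryGroup_iff'.1 hVm
  have key : V * A * star V = upperTri l ((V * A * star V) 0 1) m := by
    have e : V * A * star V = !![(V * A * star V) 0 0, (V * A * star V) 0 1;
      (V * A * star V) 1 0, (V * A * star V) 1 1] := Matrix.eta_fin_two _
    have k0 : (V * A * star V) 0 0 = l := by
      rw [hVs, hV]; simp [Matrix.mul_apply, Matrix.vecMul, dotProduct, Fin.sum_univ_two]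
      simp only [Complex.star_def] at huv
      linear_combination (starRingEnd ℂ u) * b0 + (starRingEnd ℂ v) * b1 + l * huv
    have k1 : (V * A * star V) 1 0 = 0 := by
      rw [hVs, hV]; simp [Matrix.mul_apply, Matrix.vecMul, dotProduct, Fin.sum_univ_two]
      linear_combination -v * b0 + u * b1
    have k2 : (V * A * star V) 1 1 = m := by
      have : (V * A * star V).trace = A.trace := by
        rw [Matrix.trace_mul_comm, ← Matrix.mul_assoc, hVV', Matrix.one_mul]
      rw [Matrix.trace_fin_two, Matrix.trace_fin_two, htr, k0] at this
      exact add_left_cancel this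
    rw [k0, k1, k2] at e
    exact e
  refine ⟨(V * A * star V) 0 1, V, hVm, ?_⟩
  rw [← key, Matrix.mul_assoc, hVV', Matrix.mul_one]

lemma exists_eigenvalues (A : Matrix (Fin 2) (Fin 2) ℂ) :
    ∃ l m : ℂ, A.trace = l + m ∧ A.det = l * m := by
  obtain ⟨w, hw⟩ := IsAlgClosed.exists_pow_nat_eq (A.trace ^ 2 - 4 * A.det) two_pos
  exact ⟨(A.trace + w) / 2, (A.trace - w) / 2, by ring, by linear_combination hw / 4⟩

/-! ### The invariants of a triangular matrix -/

lemma DA_upperTri (l s m : ℂ) : DA (upperTri l s m) = -(l - m) ^ 2 / 4 := by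
  simp [DA, upperTri, Matrix.det_fin_two, Matrix.trace_fin_two]; ring

lemma norm_DA_upperTri (l s m : ℂ) : ‖DA (upperTri l s m)‖ = Complex.normSq (l - m) / 4 := by
  rw [DA_upperTri, norm_div, norm_neg, norm_pow, Complex.sq_norm]; norm_num

/-- This is |l - m̄|²/4, the value of |D| with m replaced by its conjugate: the roles of |D| and E
are exchanged by reflecting one eigenvalue. -/
lemma EA_upperTri (l s m : ℂ) :
    EA (upperTri l s m) = ((l.re - m.re) ^ 2 + (l.im + m.im) ^ 2) / 4 := by
  rw [EA, norm_DA_upperTri, DA_upperTri]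
  have : (-(l - m) ^ 2 / 4).re = -((l.re - m.re) ^ 2 - (l.im - m.im) ^ 2) / 4 := by
    rw [show (4 : ℂ) = ((4 : ℝ) : ℂ) by norm_num, Complex.div_ofReal_re]
    simp [pow_two]
  rw [this]
  simp [upperTri, Matrix.trace_fin_two, Complex.normSq_apply]
  ring

lemma UA_upperTri (l s m : ℂ) :
    UA (upperTri l s m) = Complex.normSq s / 2 + Complex.normSq (l - m) / 4 := by
  rw [UA, Complex.sq_norm]
  simp [upperTri, Matrix.trace_fin_two, Complex.normSq_apply, Matrix.mul_apply, Fin.sum_univ_two]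
  ring

lemma invariants_of_unitary {A B V : Matrix (Fin 2) (Fin 2) ℂ}
    (hV : V ∈ Matrix.unitaryGroup (Fin 2) ℂ) (h : B * V = V * A) :
    B.trace = A.trace ∧ B.det = A.det ∧ UA B = UA A ∧ DA B = DA A ∧ EA B = EA A := by
  have hVV : star V * V = 1 := Matrix.mem_unitaryGroup_iff'.1 hV
  have hVV' : V * star V = 1 := Matrix.mem_unitaryGroup_iff.1 hV
  have hB : B = V * A * star V := by rw [← h, Matrix.mul_assoc, hVV', Matrix.mul_one]
  have h1 : ∀ C : Matrix (Fin 2) (Fin 2) ℂ, (V * C * star V).trace = C.trace := fun C => by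
    rw [Matrix.trace_mul_comm, ← Matrix.mul_assoc, hVV, Matrix.one_mul]
  have h2 : B.trace = A.trace := by rw [hB, h1]
  have h3 : B.det = A.det := by
    have := congrArg Matrix.det h
    rw [Matrix.det_mul, Matrix.det_mul, mul_comm] at this
    exact mul_left_cancel₀ (det_ne_zero_of_mem_unitaryGroup hV) this
  have h4 : (Bᴴ * B).trace = (Aᴴ * A).trace := by
    rw [← h1 (Aᴴ * A), hB, ← Matrix.star_eq_conjTranspose, star_mul, star_mul, star_star]
    congr 1
    calc V * (star A * star V) * (V * A * star V) = V * star A * (star V * V) * A * star V := by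
          simp only [Matrix.mul_assoc]
      _ = _ := by rw [hVV, Matrix.mul_one, Matrix.star_eq_conjTranspose A]; simp only [Matrix.mul_assoc]
  have h5 : DA B = DA A := by rw [DA, DA, h2, h3]
  exact ⟨h2, h3, by rw [UA, UA, h2, h4], h5, by rw [EA, EA, h2, h5]⟩

/-- Real Möbius transformations and unitary conjugations scale the invariants `U`, `|D|`, `E` by a
common positive factor. -/
theorem exists_scale_of_realMobiusEquiv {A B : Matrix (Fin 2) (Fin 2) ℂ} (h : RealMobiusEquiv A B) :
    ∃ k : ℝ, 0 < k ∧ UA B = k * UA A ∧ ‖DA B‖ = k * ‖DA A‖ ∧ EA B = k * EA A := by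
  obtain ⟨l, m, htr, hdet⟩ := exists_eigenvalues A
  obtain ⟨s, W, hW, hWA⟩ := exists_schur htr hdet
  have hW' : star W ∈ Matrix.unitaryGroup (Fin 2) ℂ := Unitary.star_mem hW
  have hAT : A * star W = star W * upperTri l s m := by
    have h1 : star W * W = 1 := Matrix.mem_unitaryGroup_iff'.1 hW
    have h2 : W * star W = 1 := Matrix.mem_unitaryGroup_iff.1 hW
    calc A * star W = star W * (W * A) * star W := by rw [← Matrix.mul_assoc, h1, Matrix.one_mul]
      _ = star W * upperTri l s m * (W * star W) := by rw [← hWA]; simp only [Matrix.mul_assoc]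
      _ = _ := by rw [h2, Matrix.mul_one]
  obtain ⟨-, -, hU, hD, hE⟩ := invariants_of_unitary hW' hAT
  obtain ⟨a, b, c, d, h1, h2, V, hV, h3⟩ := realMobiusEquiv_iff.1
    ((RealMobiusEquiv.of_unitary hW' hAT).trans h)
  have h2' := h2
  rw [smul_upperTri_add, det_upperTri] at h2'
  have hl := left_ne_zero_of_mul h2'
  have hm := right_ne_zero_of_mul h2'
  have hT := upperTri_mobius (s := s) hl hm (div_mul_cancel₀ ((a : ℂ) * l + b) hl)
    (div_mul_cancel₀ ((a : ℂ) * m + b) hm)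
  set l' := ((a : ℂ) * l + b) / (c * l + d) with hl'
  set m' := ((a : ℂ) * m + b) / (c * m + d) with hm'
  set s' := ((a : ℂ) * d - b * c) * s / ((c * l + d) * (c * m + d)) with hs'
  have hBV : B * V = V * upperTri l' s' m' := by
    rw [← hT, ← Matrix.mul_assoc] at h3
    have hu := isUnit_iff_ne_zero.2 h2
    have := congrArg (· * ((c : ℂ) • upperTri l s m + (d : ℂ) • 1)⁻¹) h3
    rwa [Matrix.mul_assoc, Matrix.mul_nonsing_inv _ hu, Matrix.mul_one, Matrix.mul_assoc,
      Matrix.mul_nonsing_inv _ hu, Matrix.mul_one] at this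
  obtain ⟨-, -, hU', hD', hE'⟩ := invariants_of_unitary hV hBV
  rw [hU', hD', hE', hU, hD, hE, UA_upperTri, UA_upperTri, norm_DA_upperTri, norm_DA_upperTri,
    EA_upperTri, EA_upperTri]
  set k := (a * d - b * c) ^ 2 / (Complex.normSq (c * l + d) * Complex.normSq (c * m + d)) with hk
  have p1 : 0 < Complex.normSq (c * l + d) := Complex.normSq_pos.2 hl
  have p2 : 0 < Complex.normSq (c * m + d) := Complex.normSq_pos.2 hm
  have hns : ∀ x : ℂ, Complex.normSq ((a * d - b * c) * x) = (a * d - b * c) ^ 2 * Complex.normSq x := by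
    intro x
    rw [map_mul, show ((a : ℂ) * d - b * c) = ((a * d - b * c : ℝ) : ℂ) by push_cast; ring,
      Complex.normSq_ofReal, pow_two]
  have f1 : Complex.normSq s' = k * Complex.normSq s := by
    rw [hs', map_div₀, hns, map_mul, hk]; ring
  have f2 : Complex.normSq (l' - m') = k * Complex.normSq (l - m) := by
    rw [show l' - m' = (a * d - b * c) * (l - m) / ((c * l + d) * (c * m + d)) by
      rw [hl', hm', div_sub_div _ _ hl hm]; congr 1; ring, map_div₀, hns, map_mul, hk]; ring
  have g : ∀ x y : ℂ, (x.re - y.re) ^ 2 + (x.im + y.im) ^ 2 =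
      Complex.normSq (x - starRingEnd ℂ y) := by
    intro x y; simp [Complex.normSq_apply]; ring
  have hm0 : (c : ℂ) * starRingEnd ℂ m + d ≠ 0 := by
    have := (map_ne_zero (starRingEnd ℂ)).2 hm
    simpa using this
  have hmn : Complex.normSq (c * starRingEnd ℂ m + d) = Complex.normSq (c * m + d) := by
    rw [← Complex.normSq_conj]; simp
  -- A real Möbius map commutes with conjugation, and |c m̄ + d| = |cm + d|; so the scale factor is
  -- the same as for l - m.
  have f3 : Complex.normSq (l' - starRingEnd ℂ m') = k * Complex.normSq (l - starRingEnd ℂ m) := by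
    rw [show l' - starRingEnd ℂ m' = (a * d - b * c) * (l - starRingEnd ℂ m) /
      ((c * l + d) * (c * starRingEnd ℂ m + d)) by
        rw [hl', hm']; simp only [map_div₀, map_add, map_mul, Complex.conj_ofReal]
        rw [div_sub_div _ _ hl hm0]; congr 1; ring, map_div₀, hns, map_mul, hk, hmn]; ring
  refine ⟨k, by positivity, ?_, ?_, ?_⟩
  · rw [f1, f2]; ring
  · rw [f2]; ring
  · rw [g, g, f3]; ring

/-! ### Existence of canonical representatives -/

/-- `A` is equivalent to an upper triangular matrix with diagonal `l`, `m`. -/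
def HasEigenpair (A : Matrix (Fin 2) (Fin 2) ℂ) (l m : ℂ) : Prop :=
  ∃ s, RealMobiusEquiv A (upperTri l s m)

lemma HasEigenpair.mobius {A : Matrix (Fin 2) (Fin 2) ℂ} {l m l' m' : ℂ} (h : HasEigenpair A l m)
    {a b c d : ℝ} (hd : a * d - b * c ≠ 0) (hl : c * l + d ≠ 0) (hm : c * m + d ≠ 0)
    (hl' : l' * (c * l + d) = a * l + b) (hm' : m' * (c * m + d) = a * m + b) :
    HasEigenpair A l' m' :=
  let ⟨_, hs⟩ := h
  ⟨_, hs.trans (realMobiusEquiv_upperTri hd hl hm hl' hm')⟩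

lemma HasEigenpair.affine {A : Matrix (Fin 2) (Fin 2) ℂ} {l m : ℂ} (h : HasEigenpair A l m)
    {a b : ℝ} (ha : a ≠ 0) : HasEigenpair A (a * l + b) (a * m + b) :=
  h.mobius (a := a) (b := b) (c := 0) (d := 1) (by simpa using ha) (by simp) (by simp) (by simp)
    (by simp)

/-- Conjugation by a unitary diagonal matrix diag(1, u) removes the phase of the off-diagonal entry.
-/
lemma HasEigenpair.exists_nonneg {A : Matrix (Fin 2) (Fin 2) ℂ} {l m : ℂ}
    (h : HasEigenpair A l m) : ∃ s : ℝ, 0 ≤ s ∧ RealMobiusEquiv A (upperTri l s m) := by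
  obtain ⟨s, hs⟩ := h
  obtain ⟨u, hu, hus⟩ : ∃ u : ℂ, ‖u‖ = 1 ∧ ‖s‖ * u = s := by
    rcases eq_or_ne s 0 with rfl | h0
    · exact ⟨1, by simp, by simp⟩
    · have : (‖s‖ : ℂ) ≠ 0 := by simpa using h0
      exact ⟨s / ‖s‖, by simp [h0], by field_simp⟩
  refine ⟨‖s‖, norm_nonneg s, hs.trans (.of_unitary (V := upperTri 1 0 u) ?_ ?_)⟩
  · have huu : u * starRingEnd ℂ u = 1 := by rw [Complex.mul_conj, ← Complex.sq_norm, hu]; simp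
    rw [Matrix.mem_unitaryGroup_iff, Matrix.one_fin_two]
    have : star (upperTri 1 0 u) = upperTri 1 0 (starRingEnd ℂ u) := by
      ext i j; fin_cases i <;> fin_cases j <;> simp [upperTri, Matrix.star_apply]
    rw [this, upperTri_mul, huu]
    simp [upperTri]
  · rw [upperTri_mul, upperTri_mul, hus, mul_comm m]; simp

/-- Both orders are provided so that a real eigenvalue can always be placed first. -/
lemma exists_hasEigenpair (A : Matrix (Fin 2) (Fin 2) ℂ) :
    ∃ l m, HasEigenpair A l m ∧ HasEigenpair A m l := by
  obtain ⟨l, m, htr, hdet⟩ := exists_eigenvalues A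
  obtain ⟨s, V, hV, h⟩ := exists_schur htr hdet
  obtain ⟨s', V', hV', h'⟩ := exists_schur (htr.trans (add_comm _ _)) (hdet.trans (mul_comm _ _))
  exact ⟨l, m, ⟨s, .of_unitary hV h⟩, ⟨s', .of_unitary hV' h'⟩⟩

lemma upperTri_smul_equiv {A : Matrix (Fin 2) (Fin 2) ℂ} {l s m : ℂ} {a : ℝ}
    (h : RealMobiusEquiv A (upperTri l s m)) (ha : a ≠ 0) :
    RealMobiusEquiv A (upperTri (a * l) (a * s) (a * m)) := by
  refine h.trans ?_
  have := realMobiusEquiv_upperTri (a := a) (b := 0) (c := 0) (d := 1) (l := l) (s := s) (m := m)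
    (l' := a * l) (m' := a * m) (by simpa using ha) (by simp) (by simp) (by simp) (by simp)
  simpa using this

/-- After translation to a double eigenvalue 0, scaling leaves the zero matrix or S₀. -/
lemma exists_BCKValues_of_eq_real {A : Matrix (Fin 2) (Fin 2) ℂ} {x : ℝ}
    (h : HasEigenpair A x x) : ∃ p m e, HasBCKValues A p m e := by
  have h0 := h.affine (a := 1) (b := -x) one_ne_zero
  simp only [Complex.ofReal_one, one_mul, Complex.ofReal_neg, add_neg_cancel] at h0
  obtain ⟨s, hs, hA⟩ := h0.exists_nonneg
  rcases hs.eq_or_lt with rfl | hs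
  · refine ⟨0, 0, 0, 0, ?_, .zero⟩
    convert hA
    ext i j; fin_cases i <;> fin_cases j <;> simp [upperTri]
  · refine ⟨_, _, _, matS 0, ?_, .S 0 le_rfl (by positivity)⟩
    have := upperTri_smul_equiv hA (inv_ne_zero hs.ne')
    have hsc : (s : ℂ) ≠ 0 := by exact_mod_cast hs.ne'
    convert this
    simp [matS, upperTri, hsc]

/-- An affine map sends the eigenvalues to ±1, and the result is some L_{0,t}. -/
lemma exists_BCKValues_of_ne_real {A : Matrix (Fin 2) (Fin 2) ℂ} {x y : ℝ} (hxy : x ≠ y)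
    (h : HasEigenpair A x y) : ∃ p m e, HasBCKValues A p m e := by
  have hd : x - y ≠ 0 := sub_ne_zero.2 hxy
  have hdc : (x : ℂ) - y ≠ 0 := by exact_mod_cast hd
  have h0 := h.affine (a := 2 / (x - y)) (b := -(x + y) / (x - y)) (div_ne_zero two_ne_zero hd)
  obtain ⟨s, hs, hA⟩ := h0.exists_nonneg
  refine ⟨_, _, _, matL 0 (s / 2) 1, ?_, .L 0 (s / 2) 1 le_rfl (by positivity) (by positivity)
    (.inl rfl)⟩
  convert hA using 1
  have e1 : ((2 / (x - y) : ℝ) : ℂ) * x + ((-(x + y) / (x - y) : ℝ) : ℂ) = 1 := by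
    push_cast; field_simp; ring
  have e2 : ((2 / (x - y) : ℝ) : ℂ) * y + ((-(x + y) / (x - y) : ℝ) : ℂ) = -1 := by
    push_cast; field_simp; ring
  rw [e1, e2, matL, upperTri]
  simp
  ring

lemma exists_BCKValues_of_real_of_nonreal {A : Matrix (Fin 2) (Fin 2) ℂ} {x : ℝ} {w : ℂ}
    (hw : w.im ≠ 0) (h : HasEigenpair A x w) : ∃ p m e, HasBCKValues A p m e := by
  have h0 := h.affine (a := 1) (b := -x) one_ne_zero
  simp only [Complex.ofReal_one, one_mul, Complex.ofReal_neg, add_neg_cancel] at h0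
  obtain ⟨u, v, hv, hw'⟩ : ∃ u v : ℝ, v ≠ 0 ∧ w + -x = u + v * Complex.I :=
    ⟨w.re - x, w.im, hw, by apply Complex.ext <;> simp [sub_eq_add_neg]⟩
  rw [hw'] at h0
  have hvc : (v : ℂ) ≠ 0 := by exact_mod_cast hv
  have hn : 0 < u ^ 2 + v ^ 2 := by positivity
  have hden : ((-u / v : ℝ) : ℂ) * (u + v * Complex.I) + ((u ^ 2 + v ^ 2) / v : ℝ) =
      v - u * Complex.I := by
    push_cast; field_simp; ring
  have h1 : HasEigenpair A 0 Complex.I := by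
    -- The map λ/(cλ + d) fixes 0. It sends λ = u + iv to i precisely if cλ + d = -iλ = v - iu,
    -- which determines c and d.
    refine h0.mobius (a := 1) (b := 0) (c := -u / v) (d := (u ^ 2 + v ^ 2) / v) ?_ ?_ ?_ ?_ ?_
    · simp; exact ⟨hn.ne', hv⟩
    · have : ((u ^ 2 + v ^ 2) / v : ℝ) ≠ 0 := div_ne_zero hn.ne' hv
      rw [mul_zero, zero_add]; exact_mod_cast this
    · rw [hden]; intro hc
      exact hv (by simpa using congrArg Complex.re hc)
    · simp
    · rw [hden]; push_cast; linear_combination -u * Complex.I_sq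
  obtain ⟨s, hs, hA⟩ := h1.exists_nonneg
  have hT : 0 < √(1 + s ^ 2) := Real.sqrt_pos.2 (by positivity)
  have hT2 : √(1 + s ^ 2) ^ 2 = 1 + s ^ 2 := Real.sq_sqrt (by positivity)
  set T := √(1 + s ^ 2)
  have hle : s / T ≤ 1 := (div_le_one hT).2 (Real.le_sqrt_of_sq_le (by linarith))
  have h0' : 0 ≤ s / T := by positivity
  -- Scaling by 1/T puts (s, 1) on the unit circle, as (cos β, sin β).
  refine ⟨_, _, _, matS (Real.arccos (s / T)), ?_, .S _ (Real.arccos_nonneg _)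
    (Real.arccos_le_pi_div_two.2 h0')⟩
  have hcos : Real.cos (Real.arccos (s / T)) = s / T := Real.cos_arccos (by linarith) hle
  have hsin : Real.sin (Real.arccos (s / T)) = T⁻¹ := by
    rw [Real.sin_arccos, ← Real.sqrt_sq (inv_pos.2 hT).le]
    congr 1
    field_simp
    linarith
  have := upperTri_smul_equiv hA (inv_ne_zero hT.ne')
  convert this using 1
  rw [matS, hcos, hsin, upperTri]
  push_cast
  congr 3 <;> simp <;> ring

/-- The map (λ - k)/(λ + k) takes the imaginary axis to the unit circle, and with k² = |y| it sends
i and iy to points with opposite real parts. For k ≥ 1 the map (-λ - k)/(λ - k) is used, which keeps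
the first real part non-negative. -/
lemma exists_circle_eigenpair {A : Matrix (Fin 2) (Fin 2) ℂ} {y : ℝ} (hy : y ≠ 0)
    (h : HasEigenpair A Complex.I (y * Complex.I)) :
    ∃ c s ε : ℝ, 0 ≤ c ∧ 0 ≤ s ∧ c ^ 2 + s ^ 2 = 1 ∧ (ε = 1 ∨ ε = -1) ∧
      HasEigenpair A (c + Complex.I * s) (-c + ε * (Complex.I * s)) := by
  obtain ⟨k, ε, hk, hε, hyk⟩ : ∃ k ε : ℝ, 0 < k ∧ (ε = 1 ∨ ε = -1) ∧ y = ε * k ^ 2 := by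
    have hk2 : √|y| ^ 2 = |y| := Real.sq_sqrt (abs_nonneg y)
    rcases hy.lt_or_gt with h0 | h0
    · exact ⟨√|y|, -1, Real.sqrt_pos.2 (abs_pos.2 hy), .inr rfl, by
        rw [hk2, abs_of_neg h0]; ring⟩
    · exact ⟨√|y|, 1, Real.sqrt_pos.2 (abs_pos.2 hy), .inl rfl, by rw [hk2, abs_of_pos h0]; ring⟩
  have hε2 : (ε : ℂ) ^ 2 = 1 := by rcases hε with rfl | rfl <;> simp
  have hI := Complex.I_sq
  have hK : (1 + (k : ℂ) ^ 2) ≠ 0 := by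
    have : 0 < 1 + k ^ 2 := by positivity
    exact_mod_cast this.ne'
  have hre : ∀ z : ℂ, z.re ≠ 0 → z ≠ 0 := fun z hz h0 => hz (by rw [h0]; rfl)
  rcases le_total k 1 with h1 | h1
  · refine ⟨(1 - k ^ 2) / (1 + k ^ 2), 2 * k / (1 + k ^ 2), ε,
      div_nonneg (by nlinarith) (by positivity), by positivity, by field_simp; ring, hε,
      h.mobius (a := 1) (b := -k) (c := 1) (d := k) (by linarith) (hre _ (by simpa using hk.ne'))
        (hre _ (by simpa using hk.ne')) ?_ ?_⟩
    · push_cast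
      field_simp
      linear_combination 2 * k * hI
    · rw [hyk]; push_cast
      field_simp
      linear_combination (2 * k ^ 3) * (ε ^ 2 * hI - hε2)
  · refine ⟨(k ^ 2 - 1) / (1 + k ^ 2), 2 * k / (1 + k ^ 2), ε,
      div_nonneg (by nlinarith) (by positivity), by positivity, by field_simp; ring, hε,
      h.mobius (a := -1) (b := -k) (c := 1) (d := -k) (by linarith) (hre _ (by simpa using hk.ne'))
        (hre _ (by simpa using hk.ne')) ?_ ?_⟩
    · push_cast
      field_simp
      linear_combination 2 * k * hI
    · rw [hyk]; push_cast
      field_simp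
      linear_combination (2 * k ^ 3) * (ε ^ 2 * hI - hε2)

/-- An affine map moves z to i. The rotation (λ + τ)/(1 - τλ) fixes i, and τ is chosen so that the
other eigenvalue lands on the imaginary axis. -/
lemma exists_BCKValues_of_nonreal {A : Matrix (Fin 2) (Fin 2) ℂ} {z w : ℂ} (hz : z.im ≠ 0)
    (hw : w.im ≠ 0) (h : HasEigenpair A z w) : ∃ p m e, HasBCKValues A p m e := by
  have h0 := h.affine (a := 1 / z.im) (b := -z.re / z.im) (one_div_ne_zero hz)
  have hzc : (z.im : ℂ) ≠ 0 := by exact_mod_cast hz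
  have e1 : ((1 / z.im : ℝ) : ℂ) * z + ((-z.re / z.im : ℝ) : ℂ) = Complex.I := by
    nth_rewrite 2 [← Complex.re_add_im z]
    push_cast; field_simp; ring
  obtain ⟨u, v, hv, e2⟩ : ∃ u v : ℝ, v ≠ 0 ∧
      ((1 / z.im : ℝ) : ℂ) * w + ((-z.re / z.im : ℝ) : ℂ) = u + v * Complex.I := by
    refine ⟨(w.re - z.re) / z.im, w.im / z.im, div_ne_zero hw hz, ?_⟩
    nth_rewrite 1 [← Complex.re_add_im w]
    push_cast; field_simp; ring
  rw [e1, e2] at h0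
  -- The equation says that the real part of the image of u + iv vanishes. Its discriminant b² + 4u²
  -- is non-negative.
  obtain ⟨τ, hτ⟩ : ∃ τ : ℝ, u * τ ^ 2 + (u ^ 2 + v ^ 2 - 1) * τ - u = 0 := by
    rcases eq_or_ne u 0 with rfl | hu
    · exact ⟨0, by simp⟩
    · set b := u ^ 2 + v ^ 2 - 1
      obtain ⟨r, hs⟩ : ∃ r, r ^ 2 = b ^ 2 + 4 * u ^ 2 := ⟨_, Real.sq_sqrt (by positivity)⟩
      refine ⟨(-b + r) / (2 * u), ?_⟩
      field_simp
      linear_combination hs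
  have hne : 1 - τ * u ≠ 0 := by
    intro h1
    have h2 : τ * v ^ 2 = 0 := by linear_combination hτ + (u + τ) * h1
    have h3 : τ = 0 := (mul_eq_zero.1 h2).resolve_right (by positivity)
    simp [h3] at h1
  have hre : ∀ z : ℂ, z.re ≠ 0 → z ≠ 0 := fun z hz h0 => hz (by rw [h0]; rfl)
  have hnec : (1 : ℂ) - τ * u ≠ 0 := by exact_mod_cast hne
  have hτc : (u : ℂ) * τ ^ 2 + (u ^ 2 + v ^ 2 - 1) * τ - u = 0 := by exact_mod_cast hτ
  have h1 : HasEigenpair A Complex.I ((v / (1 - τ * u) : ℝ) * Complex.I) := by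
    refine h0.mobius (a := 1) (b := τ) (c := -τ) (d := 1) (by nlinarith [sq_nonneg τ])
      (hre _ (by simp)) (hre _ ?_) ?_ ?_
    · simpa [sub_eq_add_neg, add_comm] using hne
    · push_cast; linear_combination -τ * Complex.I_sq
    · push_cast; field_simp
      linear_combination -τ * v ^ 2 * Complex.I_sq + hτc
  obtain ⟨c, s, ε, hc, hs, hcs, hε, h2⟩ := exists_circle_eigenpair (div_ne_zero hv hne) h1
  obtain ⟨t, ht, hA⟩ := h2.exists_nonneg
  have hcos : Real.cos (Real.arccos c) = c := Real.cos_arccos (by linarith) (by nlinarith)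
  have hsin : Real.sin (Real.arccos c) = s := by
    rw [Real.sin_arccos, ← hcs, add_sub_cancel_left, Real.sqrt_sq hs]
  refine ⟨_, _, _, matL (Real.arccos c) (t / 2) ε, ?_, .L _ (t / 2) ε (Real.arccos_nonneg _)
    (Real.arccos_le_pi_div_two.2 hc) (by positivity) hε⟩
  convert hA using 1
  rw [matL, hcos, hsin, upperTri]
  push_cast
  rw [mul_div_cancel₀ _ (two_ne_zero)]

theorem exists_hasBCKValues (A : Matrix (Fin 2) (Fin 2) ℂ) : ∃ p m e, HasBCKValues A p m e := by
  obtain ⟨l, m, h, h'⟩ := exists_hasEigenpair A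
  have hr : ∀ z : ℂ, z.im = 0 → z = (z.re : ℂ) := fun z hz => Complex.ext (by simp) (by simp [hz])
  by_cases hl : l.im = 0
  · rw [hr l hl] at h h'
    by_cases hm : m.im = 0
    · rw [hr m hm] at h h'
      rcases eq_or_ne l.re m.re with he | he
      · rw [he] at h; exact exists_BCKValues_of_eq_real h
      · exact exists_BCKValues_of_ne_real he h
    · exact exists_BCKValues_of_real_of_nonreal hm h
  · by_cases hm : m.im = 0
    · rw [hr m hm] at h h'
      exact exists_BCKValues_of_real_of_nonreal hl h'
    · exact exists_BCKValues_of_nonreal hl hm h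

/-! ### Unordered ratios -/

lemma SameRatio.refl (s : Multiset ℝ) : SameRatio s s := ⟨1, one_ne_zero, by simp⟩

lemma SameRatio.symm {s t : Multiset ℝ} (h : SameRatio s t) : SameRatio t s := by
  obtain ⟨c, hc, rfl⟩ := h
  exact ⟨c⁻¹, inv_ne_zero hc, by simp [Multiset.map_map, hc]⟩

lemma SameRatio.trans {s t u : Multiset ℝ} (h : SameRatio s t) (h' : SameRatio t u) :
    SameRatio s u := by
  obtain ⟨c, hc, rfl⟩ := h
  obtain ⟨d, hd, rfl⟩ := h'
  exact ⟨d * c, mul_ne_zero hd hc, by simp [Multiset.map_map, mul_assoc]⟩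

lemma triple_eq_of_sorted {a b c x y z : ℝ} (hab : a ≤ b) (hbc : b ≤ c) (hxy : x ≤ y)
    (hyz : y ≤ z) (h : ({a, b, c} : Multiset ℝ) = {x, y, z}) : a = x ∧ b = y ∧ c = z := by
  have h1 : [a, b, c].Perm [x, y, z] := Multiset.coe_eq_coe.1 h
  have := h1.eq_of_pairwise (le := (· ≤ ·)) (fun _ _ _ _ => le_antisymm)
    (by simp; exact ⟨⟨hab, hab.trans hbc⟩, hbc⟩) (by simp; exact ⟨⟨hxy, hxy.trans hyz⟩, hyz⟩)
  simpa using this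

/-- A negative scalar between non-negative triples forces both to vanish and may then be replaced by
1; a positive scalar respects the order. -/
lemma SameRatio.exists_pos {a b c x y z : ℝ} (ha : 0 ≤ a) (hab : a ≤ b) (hbc : b ≤ c) (hx : 0 ≤ x)
    (hxy : x ≤ y) (hyz : y ≤ z) (h : SameRatio {a, b, c} {x, y, z}) :
    ∃ k : ℝ, 0 < k ∧ x = k * a ∧ y = k * b ∧ z = k * c := by
  obtain ⟨k, hk, h⟩ := h
  simp only [Multiset.insert_eq_cons, Multiset.map_cons, Multiset.map_singleton] at h
  rcases hk.lt_or_gt with hk | hk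
  · have hs : k * a + (k * b + k * c) = x + (y + z) := by
      simpa using congrArg Multiset.sum h
    have h0 : 0 ≤ (-k) * a := mul_nonneg (by linarith) ha
    have h1 : 0 ≤ (-k) * b := mul_nonneg (by linarith) (by linarith)
    have h2 : 0 ≤ (-k) * c := mul_nonneg (by linarith) (by linarith)
    have e : ∀ u, k * u = 0 → u = 0 := fun u hu => (mul_eq_zero.1 hu).resolve_left hk.ne
    have ha0 := e a (by linarith)
    have hb0 := e b (by linarith)
    have hc0 := e c (by linarith)
    exact ⟨1, one_pos, by linarith, by linarith, by linarith⟩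
  · obtain ⟨h1, h2, h3⟩ := triple_eq_of_sorted (mul_le_mul_of_nonneg_left hab hk.le)
      (mul_le_mul_of_nonneg_left hbc hk.le) hxy hyz h
    exact ⟨k, hk, h1.symm, h2.symm, h3.symm⟩

lemma RealMobiusEquiv.sameRatio {A B : Matrix (Fin 2) (Fin 2) ℂ} (h : RealMobiusEquiv A B) :
    SameRatio (ratioEntries A) (ratioEntries B) := by
  obtain ⟨k, hk, h1, h2, h3⟩ := exists_scale_of_realMobiusEquiv h
  refine ⟨k, hk.ne', ?_⟩
  simp only [ratioEntries, Multiset.insert_eq_cons, Multiset.map_cons, Multiset.map_singleton, h1,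
    h2, h3]
  congr 1
  · ring
  congr 1
  · ring
  congr 1
  ring

/-! ### The canonical representatives -/

lemma invariants_matS (β : ℝ) : UA (matS β) = Real.cos β ^ 2 / 2 + Real.sin β ^ 2 / 4 ∧
    ‖DA (matS β)‖ = Real.sin β ^ 2 / 4 ∧ EA (matS β) = Real.sin β ^ 2 / 4 := by
  have : matS β = upperTri 0 (Real.cos β) (Complex.I * Real.sin β) := rfl
  rw [this, UA_upperTri, norm_DA_upperTri, EA_upperTri]
  refine ⟨?_, ?_, ?_⟩ <;>
  · simp only [Complex.normSq_apply, Complex.ofReal_re, Complex.ofReal_im, Complex.sub_re,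
      Complex.sub_im, Complex.zero_re, Complex.zero_im, Complex.mul_re, Complex.mul_im,
      Complex.I_re, Complex.I_im]
    ring

/-- The sign ε exchanges |D| and E, which merely permutes the entries of the ratio. -/
lemma invariants_matL {α t ε : ℝ} (hε : ε = 1 ∨ ε = -1) :
    UA (matL α t ε) - ‖DA (matL α t ε)‖ = 2 * t ^ 2 ∧
    (‖DA (matL α t ε)‖ = Real.cos α ^ 2 ∧ EA (matL α t ε) = 1 ∨
      ‖DA (matL α t ε)‖ = 1 ∧ EA (matL α t ε) = Real.cos α ^ 2) := by
  have h1 : matL α t ε = upperTri (Real.cos α + Complex.I * Real.sin α) (2 * t)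
    (-Real.cos α + ε * (Complex.I * Real.sin α)) := rfl
  have hcs := Real.sin_sq_add_cos_sq α
  rw [h1, UA_upperTri, norm_DA_upperTri, EA_upperTri]
  refine ⟨?_, ?_⟩
  · simp [Complex.normSq_apply]; ring
  · simp only [Complex.normSq_apply, Complex.ofReal_re, Complex.ofReal_im, Complex.sub_re,
      Complex.sub_im, Complex.mul_re, Complex.mul_im, Complex.add_re, Complex.add_im,
      Complex.I_re, Complex.I_im, Complex.neg_re, Complex.neg_im]
    rcases hε with rfl | rfl
    · left; constructor <;> first | ring1 | linear_combination hcs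
    · right; constructor <;> first | ring1 | linear_combination hcs

/-- The semi-axes of the conformal range of `L_{α,t}`. -/
lemma semiAxes_matL {c t : ℝ} (hc : c ^ 2 ≤ 1) (ht : 0 ≤ t) :
    0 ≤ t / √(1 + t ^ 2) ∧ t / √(1 + t ^ 2) < 1 ∧
    t / √(1 + t ^ 2) ≤ √(c ^ 2 + t ^ 2) / √(1 + t ^ 2) ∧
    √(c ^ 2 + t ^ 2) / √(1 + t ^ 2) ≤ 1 ∧ (t / √(1 + t ^ 2)) ^ 2 = t ^ 2 / (1 + t ^ 2) ∧
    (√(c ^ 2 + t ^ 2) / √(1 + t ^ 2)) ^ 2 = (c ^ 2 + t ^ 2) / (1 + t ^ 2) := by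
  have hT : 0 < √(1 + t ^ 2) := Real.sqrt_pos.2 (by positivity)
  have h1 : √(1 + t ^ 2) ^ 2 = 1 + t ^ 2 := Real.sq_sqrt (by positivity)
  refine ⟨by positivity, ?_, ?_, ?_, ?_, ?_⟩
  · rw [div_lt_one hT]; exact Real.lt_sqrt_of_sq_lt (by linarith)
  · gcongr; exact Real.le_sqrt_of_sq_le (by nlinarith)
  · rw [div_le_one hT]; gcongr
  · rw [div_pow, h1]
  · rw [div_pow, h1, Real.sq_sqrt (by positivity)]

/-- The canonical representatives: their ratios. -/
theorem CanonicalBCKValues.sameRatio {C : Matrix (Fin 2) (Fin 2) ℂ} {p m e : ℝ}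
    (h : CanonicalBCKValues C p m e) :
    (C = 0 ∧ p = 0 ∧ m = 0 ∧ e = 0) ∨
    (0 ≤ m ∧ m ≤ p ∧ p ≤ 1 ∧ e = √((p ^ 2 - m ^ 2) / (1 - m ^ 2)) ∧
      SameRatio (ratioEntries C) {m ^ 2, p ^ 2, 1}) := by
  rcases h with _ | ⟨β, h0, h1⟩ | ⟨α, t, ε, h0, h1, ht, hε⟩
  · exact .inl ⟨rfl, rfl, rfl, rfl⟩
  · right
    have hcs := Real.sin_sq_add_cos_sq β
    refine ⟨Real.cos_nonneg_of_mem_Icc ⟨by linarith [Real.pi_pos], h1⟩, Real.cos_le_one β, le_rfl,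
      ?_, ?_⟩
    · rw [one_pow, show 1 - Real.cos β ^ 2 = Real.sin β ^ 2 by linarith]
      rcases h0.eq_or_lt with rfl | h0
      · simp
      · have : 0 < Real.sin β := Real.sin_pos_of_pos_of_lt_pi h0 (by linarith [Real.pi_pos])
        rw [Real.sign_of_pos h0, div_self (by positivity), Real.sqrt_one]
    · obtain ⟨e1, e2, e3⟩ := invariants_matS β
      refine ⟨2, two_ne_zero, ?_⟩
      simp only [ratioEntries, Multiset.insert_eq_cons, Multiset.map_cons, Multiset.map_singleton,
        e1, e2, e3]
      congr 1
      · ring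
      congr 1
      · linear_combination hcs
      congr 1
      linear_combination hcs
  · right
    obtain ⟨k1, k2, k3, k4, k5, k6⟩ := semiAxes_matL (Real.cos_sq_le_one α) ht
    have hc : 0 ≤ Real.cos α := Real.cos_nonneg_of_mem_Icc ⟨by linarith [Real.pi_pos], h1⟩
    refine ⟨k1, k3, k4, ?_, ?_⟩
    · rw [k5, k6, ← sub_div, add_sub_cancel_right, one_sub_div (by positivity),
        add_sub_cancel_right, div_div_div_cancel_right₀ (by positivity), div_one, Real.sqrt_sq hc]
    · obtain ⟨e1, e2⟩ := invariants_matL (α := α) (t := t) hε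
      have e3 : UA (matL α t ε) + ‖DA (matL α t ε)‖ = 2 * t ^ 2 + 2 * ‖DA (matL α t ε)‖ := by
        linarith
      refine ⟨(2 * (1 + t ^ 2))⁻¹, by positivity, ?_⟩
      simp only [ratioEntries, Multiset.insert_eq_cons, Multiset.map_cons, Multiset.map_singleton,
        e3, e1, k5, k6]
      have f1 : (2 * (1 + t ^ 2))⁻¹ * (2 * t ^ 2) = t ^ 2 / (1 + t ^ 2) := by field_simp
      have f2 : (2 * (1 + t ^ 2))⁻¹ * (2 * t ^ 2 + 2 * Real.cos α ^ 2) =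
        (Real.cos α ^ 2 + t ^ 2) / (1 + t ^ 2) := by field_simp; ring
      have f3 : (2 * (1 + t ^ 2))⁻¹ * (2 * t ^ 2 + 2 * 1) = 1 := by field_simp; ring
      rcases e2 with ⟨g1, g2⟩ | ⟨g1, g2⟩
      · rw [g1, g2, f1, f2, f3]
      · rw [g1, g2, f1, f2, f3]
        congr 1
        exact Multiset.cons_swap _ _ 0

lemma ratioEntries_zero : ratioEntries 0 = {0, 0, 0} := by
  simp [ratioEntries, UA, DA, EA]

theorem CanonicalBCKValues.exists_sorted {C : Matrix (Fin 2) (Fin 2) ℂ} {p m e : ℝ}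
    (h : CanonicalBCKValues C p m e) : ∃ x y z : ℝ, 0 ≤ x ∧ x ≤ y ∧ y ≤ z ∧
      SameRatio (ratioEntries C) {x, y, z} ∧ p = √(y / z) ∧ m = √(x / z) ∧
      e = √((y - x) / (z - x)) := by
  rcases h.sameRatio with ⟨rfl, rfl, rfl, rfl⟩ | ⟨h1, h2, h3, h4, h5⟩
  · exact ⟨0, 0, 0, le_rfl, le_rfl, le_rfl, ratioEntries_zero ▸ .refl _, by simp⟩
  · refine ⟨_, _, _, sq_nonneg m, ?_, ?_, h5, ?_, ?_, h4⟩
    · gcongr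
    · exact pow_le_one₀ (h1.trans h2) h3
    · rw [div_one, Real.sqrt_sq (h1.trans h2)]
    · rw [div_one, Real.sqrt_sq h1]

/-- The sorted triple of the representative differs from the given one by a positive factor, which
cancels in the quotients; hence the values are unique. -/
theorem HasBCKValues.eq_sqrt {A : Matrix (Fin 2) (Fin 2) ℂ} {p m e x y z : ℝ}
    (h : HasBCKValues A p m e) (hx : 0 ≤ x) (hxy : x ≤ y) (hyz : y ≤ z)
    (hr : SameRatio (ratioEntries A) {x, y, z}) :
    p = √(y / z) ∧ m = √(x / z) ∧ e = √((y - x) / (z - x)) := by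
  obtain ⟨C, hAC, hC⟩ := h
  obtain ⟨x', y', z', h1, h2, h3, h4, rfl, rfl, rfl⟩ := hC.exists_sorted
  obtain ⟨k, hk, rfl, rfl, rfl⟩ :=
    (h4.symm.trans (hAC.sameRatio.symm.trans hr)).exists_pos h1 h2 h3 hx hxy hyz
  simp only [← mul_sub, mul_div_mul_left _ _ hk.ne', and_self]

theorem CanonicalBCKValues.mem_Icc {C : Matrix (Fin 2) (Fin 2) ℂ} {p m e : ℝ}
    (h : CanonicalBCKValues C p m e) :
    p ∈ Set.Icc (0 : ℝ) 1 ∧ m ∈ Set.Icc (0 : ℝ) 1 ∧ e ∈ Set.Icc (0 : ℝ) 1 := by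
  obtain ⟨x, y, z, h1, h2, h3, -, rfl, rfl, rfl⟩ := h.exists_sorted
  have key : ∀ u v : ℝ, 0 ≤ v → u ≤ v → √(u / v) ∈ Set.Icc (0 : ℝ) 1 := fun u v hv huv =>
    ⟨Real.sqrt_nonneg _, Real.sqrt_le_one.2 (div_le_one_of_le₀ huv hv)⟩
  exact ⟨key _ _ (by linarith) h3, key _ _ (by linarith) (by linarith),
    key _ _ (by linarith) (by linarith)⟩

theorem CanonicalBCKValues.semiAxisLength {C : Matrix (Fin 2) (Fin 2) ℂ} {p m e : ℝ}
    (h : CanonicalBCKValues C p m e) (s : ℝ≥0∞) :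
    (IsMajorSemiAxisLength (conformalRange C) s ↔ s = artanhExt p) ∧
      (IsMinorSemiAxisLength (conformalRange C) s ↔ s = artanhExt m) := by
  rcases h with _ | ⟨β, h0, h1⟩ | ⟨α, t, ε, h0, h1, ht, hε⟩
  · rw [conformalRange_zero]
    exact ⟨isMajorSemiAxisLength_singleton isAsymptotic_bot s,
      isMinorSemiAxisLength_singleton isAsymptotic_bot s⟩
  · have hc : 0 ≤ Real.cos β := Real.cos_nonneg_of_mem_Icc ⟨by linarith [Real.pi_pos], h1⟩
    rw [conformalRange_matS]
    refine ⟨isMajorSemiAxisLength_parabolicDisk hc (Real.cos_le_one β) s, ?_⟩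
    rcases (Real.cos_le_one β).lt_or_eq with h | h
    · exact isMinorSemiAxisLength_parabolicDisk hc h s
    · rw [h]; exact isMinorSemiAxisLength_horodisk isHorodisk_parabolicDisk_one s
  · obtain ⟨k1, k2, k3, k4, -, -⟩ := semiAxes_matL (Real.cos_sq_le_one α) ht
    rw [conformalRange_matL ht hε]
    rcases k4.lt_or_eq with h | h
    · exact ⟨isMajorSemiAxisLength_centralEllipse k1 k3 h s,
        isMinorSemiAxisLength_centralEllipse k1 k3 h s⟩
    · rw [h]
      exact ⟨isMajorSemiAxisLength_band _ s, isMinorSemiAxisLength_band k1 k2 s⟩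

/-! ### The half eigendistance -/

lemma one_sub_eigenpoint (z : ℂ) : 1 - (eigenpoint z).1 ^ 2 - (eigenpoint z).2 ^ 2 =
    (2 * |z.im| / (z.re ^ 2 + z.im ^ 2 + 1)) ^ 2 := by
  simp only [eigenpoint, Complex.sq_norm, Complex.normSq_apply]
  have : z.re * z.re + z.im * z.im + 1 ≠ 0 := (add_pos_of_nonneg_of_pos
    (add_nonneg (mul_self_nonneg _) (mul_self_nonneg _)) one_pos).ne'
  have h2 : z.re ^ 2 + z.im ^ 2 + 1 ≠ 0 := by positivity
  rw [div_pow, div_pow, div_pow, mul_pow 2 |z.im|, sq_abs]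
  field_simp
  ring

lemma isOrdinary_eigenpoint {z : ℂ} (hz : z.im ≠ 0) : IsOrdinary (eigenpoint z) := by
  have h := one_sub_eigenpoint z
  have : 0 < (2 * |z.im| / (z.re ^ 2 + z.im ^ 2 + 1)) ^ 2 := by positivity
  rw [IsOrdinary]; linarith

lemma isAsymptotic_eigenpoint {z : ℂ} (hz : z.im = 0) : IsAsymptotic (eigenpoint z) := by
  have h := one_sub_eigenpoint z
  rw [hz] at h
  simp only [abs_zero, mul_zero, zero_div] at h
  rw [IsAsymptotic]; linarith

/-- The map ι identifies exactly the complex conjugates. -/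
lemma eigenpoint_eq_iff {z w : ℂ} :
    eigenpoint z = eigenpoint w ↔ z.re = w.re ∧ z.im ^ 2 = w.im ^ 2 := by
  simp only [eigenpoint, Complex.sq_norm, Complex.normSq_apply, Prod.mk.injEq]
  have h1 : z.re * z.re + z.im * z.im + 1 ≠ 0 := (add_pos_of_nonneg_of_pos
    (add_nonneg (mul_self_nonneg _) (mul_self_nonneg _)) one_pos).ne'
  have h2 : w.re * w.re + w.im * w.im + 1 ≠ 0 := (add_pos_of_nonneg_of_pos
    (add_nonneg (mul_self_nonneg _) (mul_self_nonneg _)) one_pos).ne'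
  rw [div_eq_div_iff h1 h2, div_eq_div_iff h1 h2]
  constructor
  · rintro ⟨e1, e2⟩
    have e3 : z.re * z.re + z.im * z.im = w.re * w.re + w.im * w.im := by linarith
    rw [e3] at e1
    have e4 : z.re = w.re := by
      have := mul_right_cancel₀ h2 e1
      linarith
    rw [e4] at e3
    exact ⟨e4, by linarith⟩
  · rintro ⟨e1, e2⟩
    rw [pow_two, pow_two] at e2
    rw [e1, e2]; exact ⟨rfl, rfl⟩

lemma coshDist_eigenpoint {z w : ℂ} (hz : z.im ≠ 0) (hw : w.im ≠ 0) :
    coshDist (eigenpoint z) (eigenpoint w) =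
      (Complex.normSq (z - w) + ((z.re - w.re) ^ 2 + (z.im + w.im) ^ 2)) / (4 * |z.im * w.im|) := by
  rw [coshDist, one_sub_eigenpoint, one_sub_eigenpoint, Real.sqrt_sq (by positivity),
    Real.sqrt_sq (by positivity), abs_mul]
  have h1 : z.re ^ 2 + z.im ^ 2 + 1 ≠ 0 := by positivity
  have h2 : w.re ^ 2 + w.im ^ 2 + 1 ≠ 0 := by positivity
  have h3 : |z.im| ≠ 0 := abs_ne_zero.2 hz
  have h4 : |w.im| ≠ 0 := abs_ne_zero.2 hw
  simp only [eigenpoint, Complex.sq_norm, Complex.normSq_apply, Complex.sub_re, Complex.sub_im,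
    ← pow_two]
  field_simp
  ring

/-- Put x = |z - w|² and y = |z - w̄|². Since y - x = 4 Im z Im w, the hyperbolic cosine is (x +
y)/|y - x|, which is (1 + e²)/(1 - e²) as soon as one of x, y is e² times the other. The hypothesis
`h0` encodes the convention 0/0 = 0. -/
theorem hdist_eigenpoint_div_two {z w : ℂ} {e : ℝ} (he : e ∈ Set.Icc (0 : ℝ) 1)
    (h : Complex.normSq (z - w) = e ^ 2 * ((z.re - w.re) ^ 2 + (z.im + w.im) ^ 2) ∨
      (z.re - w.re) ^ 2 + (z.im + w.im) ^ 2 = e ^ 2 * Complex.normSq (z - w))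
    (h0 : Complex.normSq (z - w) = 0 → (z.re - w.re) ^ 2 + (z.im + w.im) ^ 2 = 0 → e = 0) :
    hdist (eigenpoint z) (eigenpoint w) / 2 = artanhExt e := by
  set x := Complex.normSq (z - w) with hx
  set y := (z.re - w.re) ^ 2 + (z.im + w.im) ^ 2 with hy
  have hx' : x = (z.re - w.re) ^ 2 + (z.im - w.im) ^ 2 := by
    rw [hx, Complex.normSq_apply, Complex.sub_re, Complex.sub_im]; ring
  have hx0 : 0 ≤ x := Complex.normSq_nonneg _
  have hy0 : 0 ≤ y := by positivity
  have hyx : y - x = 4 * (z.im * w.im) := by rw [hx', hy]; ring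
  by_cases hxy : x = 0 ∨ y = 0
  · have he0 : e = 0 := by
      rcases h with h | h <;> rcases hxy with h' | h'
      · rw [h', eq_comm, mul_eq_zero] at h
        rcases h with h | h
        · exact pow_eq_zero_iff two_ne_zero |>.1 h
        · exact h0 h' h
      · exact h0 (by rw [h, h', mul_zero]) h'
      · exact h0 h' (by rw [h, h', mul_zero])
      · rw [h', eq_comm, mul_eq_zero] at h
        rcases h with h | h
        · exact pow_eq_zero_iff two_ne_zero |>.1 h
        · exact h0 h h'
    have heq : eigenpoint z = eigenpoint w := by
      rw [eigenpoint_eq_iff]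
      rcases hxy with h' | h'
      · rw [hx'] at h'
        have e1 : z.re - w.re = 0 := by
          rw [← pow_eq_zero_iff two_ne_zero]; nlinarith [sq_nonneg (z.re - w.re), sq_nonneg (z.im - w.im)]
        have e2 : z.im - w.im = 0 := by
          rw [← pow_eq_zero_iff two_ne_zero]; nlinarith [sq_nonneg (z.re - w.re), sq_nonneg (z.im - w.im)]
        exact ⟨by linarith, by rw [sub_eq_zero.1 e2]⟩
      · rw [hy] at h'
        have e1 : z.re - w.re = 0 := by
          rw [← pow_eq_zero_iff two_ne_zero]; nlinarith [sq_nonneg (z.re - w.re), sq_nonneg (z.im + w.im)]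
        have e2 : z.im + w.im = 0 := by
          rw [← pow_eq_zero_iff two_ne_zero]; nlinarith [sq_nonneg (z.re - w.re), sq_nonneg (z.im + w.im)]
        exact ⟨by linarith, by rw [eq_neg_of_add_eq_zero_left e2, neg_sq]⟩
    rw [he0, heq, hdist_self, artanhExt_zero, ENNReal.zero_div]
  push Not at hxy
  have hxp : 0 < x := lt_of_le_of_ne hx0 hxy.1.symm
  have hyp : 0 < y := lt_of_le_of_ne hy0 hxy.2.symm
  rcases he.2.lt_or_eq with h1 | rfl
  · have he2 : 0 < 1 - e ^ 2 := by nlinarith [he.1]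
    have hne : y - x ≠ 0 := by
      rcases h with h | h
      · have : y - x = y * (1 - e ^ 2) := by rw [h]; ring
        rw [this]; positivity
      · have : y - x = -(x * (1 - e ^ 2)) := by rw [h]; ring
        rw [this, neg_ne_zero]; positivity
    rw [hyx] at hne
    have hz : z.im ≠ 0 := fun h => hne (by rw [h]; ring)
    have hw : w.im ≠ 0 := fun h => hne (by rw [h]; ring)
    rw [artanhExt_of_lt h1]
    refine hdist_div_two (isOrdinary_eigenpoint hz) (isOrdinary_eigenpoint hw) he.1 h1 ?_
    rw [coshDist_eigenpoint hz hw, ← hx, ← hy]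
    have hab : 4 * |z.im * w.im| = |y - x| := by rw [hyx, abs_mul]; norm_num
    rw [hab]
    rcases h with h | h
    · have : y - x = y * (1 - e ^ 2) := by rw [h]; ring
      rw [this, abs_of_pos (by positivity), h]
      field_simp
      ring
    · have : y - x = -(x * (1 - e ^ 2)) := by rw [h]; ring
      rw [this, abs_neg, abs_of_pos (by positivity), h]
      field_simp
  -- For e = 1 one gets x = y > 0: an eigenvalue is real, its eigenpoint is asymptotic, and the
  -- eigenpoints differ.
  · have hxy' : x = y := by rcases h with h | h <;> linarith
    have him : z.im * w.im = 0 := by linarith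
    have hne : eigenpoint z ≠ eigenpoint w := by
      rw [Ne, eigenpoint_eq_iff]
      rintro ⟨e1, e2⟩
      have : x = 0 := by
        rw [hx', e1]; nlinarith
      exact hxp.ne' this
    rw [artanhExt_one]
    rcases mul_eq_zero.1 him with h' | h'
    · rw [hdist_eq_top_left (isAsymptotic_eigenpoint h') hne, ENNReal_top_div_two]
    · rw [hdist_eq_top_right (isAsymptotic_eigenpoint h') hne, ENNReal_top_div_two]

theorem CanonicalBCKValues.eigenratio {C : Matrix (Fin 2) (Fin 2) ℂ} {p m e : ℝ}
    (h : CanonicalBCKValues C p m e) :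
    (‖DA C‖ = e ^ 2 * EA C ∨ EA C = e ^ 2 * ‖DA C‖) ∧ (‖DA C‖ = 0 → EA C = 0 → e = 0) := by
  rcases h with _ | ⟨β, h0, h1⟩ | ⟨α, t, ε, h0, h1, ht, hε⟩
  · simp [DA, EA]
  · obtain ⟨e1, e2, e3⟩ := invariants_matS β
    rw [e2, e3]
    rcases h0.eq_or_lt with rfl | h0
    · simp
    · have : 0 < Real.sin β := Real.sin_pos_of_pos_of_lt_pi h0 (by linarith [Real.pi_pos])
      rw [Real.sign_of_pos h0]
      exact ⟨.inl (by ring), fun h => absurd h (by positivity)⟩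
  · obtain ⟨-, ⟨e1, e2⟩ | ⟨e1, e2⟩⟩ := invariants_matL (α := α) (t := t) hε <;> rw [e1, e2] <;> simp

lemma charpoly_roots {A : Matrix (Fin 2) (Fin 2) ℂ} {l m : ℂ} (htr : A.trace = l + m)
    (hdet : A.det = l * m) : A.charpoly.roots = {l, m} := by
  have : A.charpoly = (Polynomial.X - Polynomial.C l) * (Polynomial.X - Polynomial.C m) := by
    rw [Matrix.charpoly_fin_two, htr, hdet, Polynomial.C_add, Polynomial.C_mul]; ring
  rw [this, Polynomial.roots_mul (mul_ne_zero (Polynomial.X_sub_C_ne_zero l)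
    (Polynomial.X_sub_C_ne_zero m)), Polynomial.roots_X_sub_C, Polynomial.roots_X_sub_C]
  rfl

lemma isHalfEigendistance_iff {A : Matrix (Fin 2) (Fin 2) ℂ} {l m : ℂ} (htr : A.trace = l + m)
    (hdet : A.det = l * m) (s : ℝ≥0∞) :
    IsHalfEigendistance A s ↔ s = hdist (eigenpoint l) (eigenpoint m) / 2 := by
  constructor
  · rintro ⟨z, w, h, rfl⟩
    rw [charpoly_roots htr hdet] at h
    rcases Multiset.cons_eq_cons.1 h with ⟨rfl, h2⟩ | ⟨-, cs, h1, h2⟩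
    · rw [Multiset.singleton_inj.1 h2]
    · rw [Multiset.singleton_eq_cons_iff] at h1 h2
      rw [h1.1, h2.1, hdist_comm]
  · rintro rfl
    exact ⟨l, m, charpoly_roots htr hdet, rfl⟩

/-- Only the ratio of |D| to E matters, and it is invariant; so the eigenvalues of A itself can be
used and no eigenpoints have to be transported. -/
theorem HasBCKValues.isHalfEigendistance_iff {A : Matrix (Fin 2) (Fin 2) ℂ} {p m e : ℝ}
    (h : HasBCKValues A p m e) (s : ℝ≥0∞) : IsHalfEigendistance A s ↔ s = artanhExt e := by
  obtain ⟨C, hAC, hC⟩ := h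
  obtain ⟨z, w, htr, hdet⟩ := exists_eigenvalues A
  obtain ⟨k, hk, -, hD, hE⟩ := exists_scale_of_realMobiusEquiv hAC
  obtain ⟨t, V, hV, hVA⟩ := exists_schur htr hdet
  obtain ⟨-, -, -, hD', hE'⟩ := invariants_of_unitary hV hVA
  have hx : Complex.normSq (z - w) = 4 / k * ‖DA C‖ := by
    rw [hD, ← hD', norm_DA_upperTri]; field_simp
  have hy : (z.re - w.re) ^ 2 + (z.im + w.im) ^ 2 = 4 / k * EA C := by
    rw [hE, ← hE', EA_upperTri]; field_simp
  obtain ⟨h1, h2⟩ := hC.eigenratio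
  rw [ConfRange.isHalfEigendistance_iff htr hdet,
    hdist_eigenpoint_div_two hC.mem_Icc.2.2 (e := e) ?_ ?_]
  · rw [hx, hy]
    rcases h1 with h1 | h1
    · left; rw [h1]; ring
    · right; rw [h1]; ring
  · rw [hx, hy]
    intro h3 h4
    exact h2 ((mul_eq_zero.1 h3).resolve_left (by positivity))
      ((mul_eq_zero.1 h4).resolve_left (by positivity))

/-! ### Classification of conformal ranges -/

theorem exists_sorted_ratio (A : Matrix (Fin 2) (Fin 2) ℂ) :
    ∃ x y z : ℝ, 0 ≤ x ∧ x ≤ y ∧ y ≤ z ∧ SameRatio (ratioEntries A) {x, y, z} := by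
  obtain ⟨p, m, e, C, hAC, hC⟩ := exists_hasBCKValues A
  obtain ⟨x, y, z, h1, h2, h3, h4, -⟩ := hC.exists_sorted
  exact ⟨x, y, z, h1, h2, h3, hAC.sameRatio.trans h4⟩

theorem HasBCKValues.semiAxisLength {A : Matrix (Fin 2) (Fin 2) ℂ} {p m e : ℝ}
    (h : HasBCKValues A p m e) (s : ℝ≥0∞) :
    (IsMajorSemiAxisLength (conformalRange A) s ↔ s = artanhExt p) ∧
      (IsMinorSemiAxisLength (conformalRange A) s ↔ s = artanhExt m) := by
  obtain ⟨C, hAC, hC⟩ := h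
  have hc := hAC.hCongruent
  have hs := conformalRange_subset A
  rw [hc.isMajorSemiAxisLength_iff hs, hc.isMinorSemiAxisLength_iff hs]
  exact hC.semiAxisLength s

/-- The type of the conformal range of a canonical representative. -/
theorem CanonicalBCKValues.type {C : Matrix (Fin 2) (Fin 2) ℂ} {p m e : ℝ}
    (h : CanonicalBCKValues C p m e) :
    C = 0 ∨
    (p = 1 ∧ conformalRange C = parabolicDisk m ∧ ‖DA C‖ = EA C ∧
      ((m < 1 ∨ 0 < EA C) → 0 < EA C ∧ IsEllipticParabolicDisk (conformalRange C))) ∨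
    (m < 1 ∧ conformalRange C = centralEllipse p m ∧
      ((p = 1 ∨ ‖DA C‖ = EA C) → ‖DA C‖ = EA C ∧ 0 < EA C ∧ IsDistanceBand (conformalRange C))) := by
  rcases h with _ | ⟨β, h0, h1⟩ | ⟨α, t, ε, h0, h1, ht, hε⟩
  · exact .inl rfl
  · obtain ⟨-, e2, e3⟩ := invariants_matS β
    have hcs := Real.sin_sq_add_cos_sq β
    have hc : 0 ≤ Real.cos β := Real.cos_nonneg_of_mem_Icc ⟨by linarith [Real.pi_pos], h1⟩
    refine .inr (.inl ⟨rfl, conformalRange_matS β, e2.trans e3.symm, fun h => ?_⟩)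
    rw [e3] at h
    have hm : Real.cos β < 1 := by
      rcases h with h | h
      · exact h
      · nlinarith
    rw [e3, conformalRange_matS]
    exact ⟨by nlinarith, isEllipticParabolicDisk_parabolicDisk hc hm⟩
  · obtain ⟨-, hd⟩ := invariants_matL (α := α) (t := t) hε
    obtain ⟨k1, k2, -, -, -, k6⟩ := semiAxes_matL (Real.cos_sq_le_one α) ht
    refine .inr (.inr ⟨k2, conformalRange_matL ht hε, fun h => ?_⟩)
    -- Both χ⁺ = 1 and |D| = E characterize cos²α = 1, the case of a band.
    have hc : Real.cos α ^ 2 = 1 := by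
      rcases h with h | h
      · rw [h, one_pow, eq_comm, div_eq_one_iff_eq (by positivity)] at k6
        linarith
      · rcases hd with ⟨h1, h2⟩ | ⟨h1, h2⟩ <;> rw [h1, h2] at h <;> simp only [h]
    rw [conformalRange_matL ht hε, hc, div_self (Real.sqrt_pos.2 (by positivity)).ne']
    rw [hc] at hd
    refine ⟨?_, ?_, isDistanceBand_band k1 k2⟩ <;>
      rcases hd with ⟨h1, h2⟩ | ⟨h1, h2⟩ <;> simp only [h1, h2, one_pos]

theorem xor_type {A : Matrix (Fin 2) (Fin 2) ℂ} (hDE : ‖DA A‖ = EA A) (hE : 0 < EA A) :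
    Xor (IsDistanceBand (conformalRange A)) (IsEllipticParabolicDisk (conformalRange A)) := by
  obtain ⟨p, m, e, C, hAC, hC⟩ := exists_hasBCKValues A
  obtain ⟨k, hk, -, hD', hE'⟩ := exists_scale_of_realMobiusEquiv hAC
  have hc := hAC.hCongruent
  have hs := conformalRange_subset A
  rw [hc.isDistanceBand_iff hs, hc.isEllipticParabolicDisk_iff hs]
  have hDC : ‖DA C‖ = EA C := by rw [hD', hE', hDE]
  have hEC : 0 < EA C := by rw [hE']; positivity
  rcases hC.type with rfl | ⟨-, -, -, h⟩ | ⟨-, -, h⟩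
  · simp [EA, DA] at hEC
  · exact .inr ⟨(h (.inr hEC)).2, fun hb => hb.not_isEllipticParabolicDisk (h (.inr hEC)).2⟩
  · exact .inl ⟨(h (.inr hDC)).2.2, (h (.inr hDC)).2.2.not_isEllipticParabolicDisk⟩

lemma HCongruent.forall_isOrdinary {S T : Set (ℝ × ℝ)} (hS : S ⊆ closedPlane)
    (h : HCongruent S T) (ho : ∀ p ∈ S, IsOrdinary p) : ∀ p ∈ T, IsOrdinary p := by
  obtain ⟨M, N, hM, rfl⟩ := (hCongruent_iff hS).1 h
  exact hM.forall_image_isOrdinary hS ho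

/-- An asymptotic point is not congruent to the conformal range of a matrix of canonical type
`S_β` or `L_{α,t}`. -/
lemma CanonicalBCKValues.not_hCongruent_zero {C : Matrix (Fin 2) (Fin 2) ℂ} {p m e : ℝ}
    (h : CanonicalBCKValues C p m e) (hp : p = 0) (hm : m = 0)
    (hc : HCongruent (conformalRange C) (conformalRange 0)) :
    C = 0 := by
  have hsub := conformalRange_subset C
  rcases h with _ | ⟨β, h0, h1⟩ | ⟨α, t, ε, h0, h1, ht, hε⟩
  · rfl
  · norm_num at hp
  · exfalso
    rw [conformalRange_matL ht hε, hp, hm] at hc hsub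
    have := hc.forall_isOrdinary hsub
      (fun p hp => isOrdinary_of_mem_centralEllipse le_rfl le_rfl one_pos hp) (0, -1)
      (by rw [conformalRange_zero]; rfl)
    exact isAsymptotic_bot.not_isOrdinary this

/-- The semi-axis lengths are invariants and `artanhExt` is injective, so the values χ⁺, χ⁻ agree,
and with them the ratio {(χ⁻)² : (χ⁺)² : 1}. The zero matrix, whose ratio has another form, is
recognized by its range being an asymptotic point. -/
theorem sameRatio_of_hCongruent {A B : Matrix (Fin 2) (Fin 2) ℂ}
    (h : HCongruent (conformalRange A) (conformalRange B)) :
    SameRatio (ratioEntries A) (ratioEntries B) := by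
  have hs := conformalRange_subset A
  obtain ⟨p, m, e, hA⟩ := exists_hasBCKValues A
  obtain ⟨p', m', e', hB⟩ := exists_hasBCKValues B
  have hp : artanhExt p = artanhExt p' := by
    rw [← (hB.semiAxisLength _).1, ← h.isMajorSemiAxisLength_iff hs, (hA.semiAxisLength _).1]
  have hm : artanhExt m = artanhExt m' := by
    rw [← (hB.semiAxisLength _).2, ← h.isMinorSemiAxisLength_iff hs, (hA.semiAxisLength _).2]
  obtain ⟨C, hAC, hC⟩ := hA
  obtain ⟨C', hBC, hC'⟩ := hB
  have iC := hC.mem_Icc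
  have iC' := hC'.mem_Icc
  obtain rfl := artanhExt_injOn iC.1 iC'.1 hp
  obtain rfl := artanhExt_injOn iC.2.1 iC'.2.1 hm
  have hCC : HCongruent (conformalRange C) (conformalRange C') :=
    (hAC.hCongruent.symm hs).trans (h.trans hBC.hCongruent)
  suffices hr : SameRatio (ratioEntries C) (ratioEntries C') from
    hAC.sameRatio.trans (hr.trans hBC.sameRatio.symm)
  rcases hC.sameRatio with ⟨rfl, rfl, rfl, rfl⟩ | ⟨-, -, -, -, h1⟩
  · rw [hC'.not_hCongruent_zero rfl rfl (hCC.symm (conformalRange_subset 0))]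
    exact .refl _
  · rcases hC'.sameRatio with ⟨rfl, rfl, rfl, rfl⟩ | ⟨-, -, -, -, h2⟩
    · rw [hC.not_hCongruent_zero rfl rfl hCC]
      exact .refl _
    · exact h1.trans h2.symm

lemma CanonicalBCKValues.eq_zero_of_sameRatio {C : Matrix (Fin 2) (Fin 2) ℂ} {p m e : ℝ}
    (h : CanonicalBCKValues C p m e) (hr : SameRatio (ratioEntries 0) (ratioEntries C)) : C = 0 := by
  rcases h.sameRatio with ⟨h, -⟩ | ⟨h1, h2, h3, -, h5⟩
  · exact h
  · have := hr.trans h5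
    rw [ratioEntries_zero] at this
    obtain ⟨k, -, -, -, h6⟩ := this.exists_pos le_rfl le_rfl le_rfl (sq_nonneg m)
      (by gcongr) (pow_le_one₀ (h1.trans h2) h3)
    simp at h6

/-- Equal ratios give equal χ⁺, χ⁻, and representatives of the same kind then have literally the
same range. A mixed pair would need χ⁺ = 1 and χ⁻ < 1, thus a band and an elliptic parabolic disk
with |D| = E > 0, against the assumption on types. -/
theorem hCongruent_of_sameRatio {A B : Matrix (Fin 2) (Fin 2) ℂ}
    (hr : SameRatio (ratioEntries A) (ratioEntries B))
    (ht : ‖DA A‖ = EA A → 0 < EA A →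
      (IsEllipticParabolicDisk (conformalRange A) ↔ IsEllipticParabolicDisk (conformalRange B))) :
    HCongruent (conformalRange A) (conformalRange B) := by
  have hsA := conformalRange_subset A
  have hsB := conformalRange_subset B
  obtain ⟨p, m, e, hA⟩ := exists_hasBCKValues A
  obtain ⟨p', m', e', hB⟩ := exists_hasBCKValues B
  obtain ⟨x, y, z, h1, h2, h3, h4⟩ := exists_sorted_ratio B
  obtain ⟨rfl, rfl, -⟩ := hB.eq_sqrt h1 h2 h3 h4
  obtain ⟨rfl, rfl, -⟩ := hA.eq_sqrt h1 h2 h3 (hr.trans h4)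
  obtain ⟨C, hAC, hC⟩ := hA
  obtain ⟨C', hBC, hC'⟩ := hB
  obtain ⟨k, hk, -, hD, hE⟩ := exists_scale_of_realMobiusEquiv hAC
  have hCC : SameRatio (ratioEntries C) (ratioEntries C') :=
    hAC.sameRatio.symm.trans (hr.trans hBC.sameRatio)
  rw [hAC.hCongruent.isEllipticParabolicDisk_iff hsA,
    hBC.hCongruent.isEllipticParabolicDisk_iff hsB] at ht
  have ht' : ‖DA C‖ = EA C → 0 < EA C →
      (IsEllipticParabolicDisk (conformalRange C) ↔ IsEllipticParabolicDisk (conformalRange C')) := by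
    intro g1 g2
    rw [hD, hE] at g1
    rw [hE] at g2
    exact ht (mul_left_cancel₀ hk.ne' g1) (pos_of_mul_pos_right g2 hk.le)
  suffices heq : conformalRange C = conformalRange C' from
    hAC.hCongruent.trans (heq ▸ hBC.hCongruent.symm hsB)
  rcases hC.type with rfl | ⟨hp, hS, hDE, hT⟩ | ⟨hm, hL, hT⟩
  · rw [hC'.eq_zero_of_sameRatio hCC]
  · rcases hC'.type with rfl | ⟨-, hS', -⟩ | ⟨hm', -, hT'⟩
    · rw [hC.eq_zero_of_sameRatio hCC.symm]
    · rw [hS, hS']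
    · obtain ⟨g1, g2⟩ := hT (.inl hm')
      exact absurd ((ht' hDE g1).1 g2) (hT' (.inl hp)).2.2.not_isEllipticParabolicDisk
  · rcases hC'.type with rfl | ⟨hp', -, -, hT'⟩ | ⟨-, hL', -⟩
    · rw [hC.eq_zero_of_sameRatio hCC.symm]
    · obtain ⟨g1, g2, g3⟩ := hT (.inl hp')
      exact absurd ((ht' g1 g2).2 (hT' (.inl hm)).2) g3.not_isEllipticParabolicDisk
    · rw [hL, hL']

end ConfRange

end

/-! ### Assembly of the theorem -/

theorem mainTheorem6 :
    -- full invariant of the conformal range up to hyperbolic isometries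
    (∀ A B : Matrix (Fin 2) (Fin 2) ℂ,
      ConfRange.HCongruent (ConfRange.conformalRange A) (ConfRange.conformalRange B) ↔
        (ConfRange.SameRatio (ConfRange.ratioEntries A) (ConfRange.ratioEntries B) ∧
          (‖ConfRange.DA A‖ = ConfRange.EA A → 0 < ConfRange.EA A →
            ((ConfRange.IsDistanceBand (ConfRange.conformalRange A) ↔
                ConfRange.IsDistanceBand (ConfRange.conformalRange B)) ∧
              (ConfRange.IsEllipticParabolicDisk (ConfRange.conformalRange A) ↔
                ConfRange.IsEllipticParabolicDisk (ConfRange.conformalRange B)))))) ∧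
    -- the choice of type makes sense when `|D_A| = E_A > 0`
    (∀ A : Matrix (Fin 2) (Fin 2) ℂ,
      ‖ConfRange.DA A‖ = ConfRange.EA A → 0 < ConfRange.EA A →
        Xor (ConfRange.IsDistanceBand (ConfRange.conformalRange A))
          (ConfRange.IsEllipticParabolicDisk (ConfRange.conformalRange A))) ∧
    -- the unordered ratio can be ordered with non-negative entries
    (∀ A : Matrix (Fin 2) (Fin 2) ℂ, ∃ χ₁ χ₂ χ₃ : ℝ, 0 ≤ χ₁ ∧ χ₁ ≤ χ₂ ∧ χ₂ ≤ χ₃ ∧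
      ConfRange.SameRatio (ConfRange.ratioEntries A) {χ₁, χ₂, χ₃}) ∧
    -- the characteristic BCK values (in Lean `0 / 0 = 0`, which is the convention used here)
    (∀ (A : Matrix (Fin 2) (Fin 2) ℂ) (χ₁ χ₂ χ₃ : ℝ), 0 ≤ χ₁ → χ₁ ≤ χ₂ → χ₂ ≤ χ₃ →
      ConfRange.SameRatio (ConfRange.ratioEntries A) {χ₁, χ₂, χ₃} →
        ∀ χp χm χe : ℝ, ConfRange.HasBCKValues A χp χm χe ↔
          (χp = √(χ₂ / χ₃) ∧ χm = √(χ₁ / χ₃) ∧ χe = √((χ₂ - χ₁) / (χ₃ - χ₁)))) ∧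
    -- the corresponding semi-axis lengths and the half `h`-eigendistance
    (∀ (A : Matrix (Fin 2) (Fin 2) ℂ) (χp χm χe : ℝ), ConfRange.HasBCKValues A χp χm χe →
      (χp ∈ Set.Icc (0 : ℝ) 1 ∧ χm ∈ Set.Icc (0 : ℝ) 1 ∧ χe ∈ Set.Icc (0 : ℝ) 1) ∧
      (∀ s : ENNReal, ConfRange.IsMajorSemiAxisLength (ConfRange.conformalRange A) s ↔
        s = ConfRange.artanhExt χp) ∧
      (∀ s : ENNReal, ConfRange.IsMinorSemiAxisLength (ConfRange.conformalRange A) s ↔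
        s = ConfRange.artanhExt χm) ∧
      (∀ s : ENNReal, ConfRange.IsHalfEigendistance A s ↔
        s = ConfRange.artanhExt χe)) ∧
    -- the equivalent expressions for this length
    (∀ u : ℝ, 0 ≤ u → u < 1 →
      Real.arcosh (1 / √(1 - u ^ 2)) = Real.artanh u ∧
      Real.arsinh (u / √(1 - u ^ 2)) = Real.artanh u ∧
      1 / 2 * Real.arcosh ((1 + u ^ 2) / (1 - u ^ 2)) = Real.artanh u) := by
  refine ⟨fun A B => ⟨fun h => ⟨ConfRange.sameRatio_of_hCongruent h, fun _ _ =>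
      ⟨h.isDistanceBand_iff (ConfRange.conformalRange_subset A),
        h.isEllipticParabolicDisk_iff (ConfRange.conformalRange_subset A)⟩⟩,
      fun h => ConfRange.hCongruent_of_sameRatio h.1 fun h1 h2 => (h.2 h1 h2).2⟩,
    fun A => ConfRange.xor_type, ConfRange.exists_sorted_ratio, ?_, ?_, ?_⟩
  · intro A x y z hx hxy hyz hr p m e
    refine ⟨fun h => h.eq_sqrt hx hxy hyz hr, ?_⟩
    rintro ⟨rfl, rfl, rfl⟩
    -- Some triple of values exists, and by uniqueness it is the one given by the formulas.
    obtain ⟨p, m, e, h⟩ := ConfRange.exists_hasBCKValues A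
    obtain ⟨rfl, rfl, rfl⟩ := h.eq_sqrt hx hxy hyz hr
    exact h
  · intro A p m e h
    have hI : p ∈ Set.Icc (0 : ℝ) 1 ∧ m ∈ Set.Icc (0 : ℝ) 1 ∧ e ∈ Set.Icc (0 : ℝ) 1 :=
      let ⟨_, _, hC⟩ := h
      hC.mem_Icc
    exact ⟨hI, fun s => (h.semiAxisLength s).1, fun s => (h.semiAxisLength s).2,
      h.isHalfEigendistance_iff⟩
  · intro u h0 h1
    refine ⟨ConfRange.arcosh_one_div_sqrt h0 h1, ConfRange.arsinh_div_sqrt h0 h1, ?_⟩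
    rw [ConfRange.arcosh_double h0 h1]; ring
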